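/- **Setting.** A *bicomplicial category* is a Quillen exact category $\mathcal E$ with an exact endofunctor $C$, natural transformations $\iota:\mathrm{id}\to C$, $r:CC\to C$ and a natural isomorphism $\sigma:CC\to CC$ such that $r\,C(\iota)=r\,\iota_C=\mathrm{id}_C$, $\sigma\,C(\iota)=\iota_C$, $\sigma\sigma=\mathrm{id}_{CC}$, each $\iota_x:x\to Cx$ is an admissible monomorphism, and the suspension $T:=C/\mathrm{id}_{\mathcal E}$ is fully faithful and essentially surjective. Morphisms $f,g:x\to y$ are *$C$-homotopic* if $f-g=H\iota_x$ for some $H:Cx\to y$; this gives $C$-homotopy equivalences, $C$-contractible objects (those with $\mathrm{id}_x$ homotopic to $0$) and the homotopy category $\pi_0(\mathcal E)$, which is triangulated with exact triangles isomorphic to $x\xrightarrow{f}y\to\mathrm{Cone}f\to Tx$, where $\mathrm{Cone}f=y\sqcup_xCx$. A class $w$ of morphisms is a *class of complicial weak equivalences* if it has the two-out-of-three property, is closed under extensions (if a morphism of admissible short exact sequences is in $w$ on both ends, it is in $w$ in the middle), and contains all $C$-homotopy equivalences; it is *thick* if moreover it is closed under retracts. A *bicomplicial pair* is $(\mathcal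 E,w)$ with such $w$; put $\mathcal E^w=\{x: (0\to x)\in w\}$. A *null class* is a full subcategory containing all $C$-contractible objects and satisfying two out of three for admissible short exact sequences. $\mathcal N_{\mathrm{nul}}$ denotes the smallest null class containing $\mathcal N$ and $v_{\mathrm{thi}}$ the smallest thick class of complicial weak equivalences containing $v$. For a class of morphisms $v$ and a full subcategory $\mathcal D$, $\mathcal D_v$ is the class of objects connected to an object of $\mathcal D$ by a zig-zag of morphisms in $v$. An ordered pair $(\mathcal N,\mathcal M)$ of triangulated subcategories is *factorizable* if every morphism from an object of $\mathcal N$ to an object of $\mathcal M$ factors through an object of $\mathcal N\cap\mathcal M$. Let $\mathrm{Ch}_b(\mathcal E)$ be the category of bounded complexes. $\mathbb A$ denotes $\mathrm{Ch}_b(\mathcal E)$ with the structure induced degreewise from $\mathcal E$; $\mathbb B$ denotes $\mathrm{Ch}_b(\mathcal E)$ with degreewise admissible short exact sequences and $Cx=\mathrm{Cone}(\mathrm{id}_x)$; $\mathbb B_{\mathrm{frob}}$ is $\mathbb B$ with the admissible short exact sequences $x\rightarrowtail y\twoheadrightarrow z$ for which every $x\to Cu$ extends to $y$. $\mathrm{Acy}_b(\mathcal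 E)$ is the class of complexes chain homotopy equivalent to a complex that decomposes into admissible short exact sequences, $\mathrm{qis}$ the class of chain maps whose mapping cone is in $\mathrm{Acy}_b(\mathcal E)$, $lw$ the class of chain maps that are degreewise in $w$, and $\mathrm{Acy}_b^{lw}(\mathcal E)=\mathrm{Ch}_b(\mathcal E^w)$. $\mathrm{Tot}:\mathrm{Ch}_b(\mathcal E)\to\mathcal E$ is the total functor, i.e. the iterated mapping cone of the complex (with respect to $C$), suitably desuspended, so that a complex concentrated in degree $0$ is sent to its degree $0$ term; $tw:=\mathrm{Tot}^{-1}(w)$ and $\mathrm{Acy}_b^{tw}(\mathcal E)$ is the class of complexes $x$ with $(0\to x)\in tw$. Finally $\mathcal D_b(\mathcal E)$ is the Verdier quotient of the homotopy category of $\mathrm{Ch}_b(\mathcal E)$ by $\mathrm{Acy}_b(\mathcal E)$, $\mathcal D_b(\mathcal E,w)$ is the Verdier quotient of $\mathcal D_b(\mathcal E)$ by the triangulated subcategory generated by the image of $\mathcal D_b(\mathcal E^w)$, and $qw$ is the class of chain maps which become isomorphisms in $\mathcal D_b(\mathcal E,w)$. **Theorem.** Let $(\mathcal E,w)$ be a bicomplicial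 pair. 1. $\mathrm{Acy}_b^{tw}(\mathcal E)=\bigl((\mathrm{Acy}_b^{lw}(\mathcal E))_{\mathrm{qis}}\bigr)_{\mathrm{nul}}$, the null closure being taken in $\mathbb B_{\mathrm{frob}}$, and $\mathrm{Acy}_b^{tw}(\mathcal E)=\bigl((\mathrm{Acy}_b(\mathcal E))_{lw}\bigr)_{\mathrm{nul}}$, the null closure being taken in $\mathbb A$. 2. If the (isomorphism closed) images of $\mathrm{Acy}_b(\mathcal E)$ and $\mathrm{Acy}_b^{lw}(\mathcal E)$ in $\pi_0(\mathbb A)$ are triangulated subcategories forming, in one of the two orders, a factorizable pair, then $\mathrm{Acy}_b^{tw}(\mathcal E)=(\mathrm{Acy}_b(\mathcal E))_{lw}$. If the same holds for their images in $\pi_0(\mathbb B)$, then $\mathrm{Acy}_b^{tw}(\mathcal E)=(\mathrm{Acy}_b^{lw}(\mathcal E))_{\mathrm{qis}}$. 3. $qw=tw_{\mathrm{thi}}$, the thick closure being taken in $\mathbb B_{\mathrm{frob}}$. In particular, if $w$ is thick, then $qw=tw$. -/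

import Mathlib

open CategoryTheory CategoryTheory.Limits
open scoped ZeroObject

universe v u

noncomputable section

namespace Bicomplicial

/-! ## Exact categories -/

section Exact

variable {E : Type u} [Category.{v} E] [Preadditive E]

/-- A morphism is an admissible monomorphism (inflation) for a class of short complexes `conf`
if it is the first morphism of a member of `conf`. -/
def IsInflation (conf : ObjectProperty (ShortComplex E)) {x y : E} (i : x ⟶ y) : Prop :=
  ∃ (z : E) (p : y ⟶ z) (h : i ≫ p = 0), conf (ShortComplex.mk i p h)

/-- A morphism is an admissible epimorphism (deflation) for a class of short complexes `conf`
if it is the second morphism of a member of `conf`. -/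
def IsDeflation (conf : ObjectProperty (ShortComplex E)) {y z : E} (p : y ⟶ z) : Prop :=
  ∃ (x : E) (i : x ⟶ y) (h : i ≫ p = 0), conf (ShortComplex.mk i p h)

/-- A class `conf` of short complexes in an additive category is the class of admissible short
exact sequences of a Quillen exact structure. -/
structure IsExactStructure (conf : ObjectProperty (ShortComplex E)) : Prop where
  of_iso : ∀ {S S' : ShortComplex E}, Nonempty (S ≅ S') → conf S → conf S'
  isKernel : ∀ S : ShortComplex E, conf S → Nonempty (IsLimit (KernelFork.ofι S.f S.zero))
  isCokernel : ∀ S : ShortComplex E, conf S → Nonempty (IsColimit (CokernelCofork.ofπ S.g S.zero))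
  inflation_id : ∀ x : E, IsInflation conf (𝟙 x)
  deflation_id : ∀ x : E, IsDeflation conf (𝟙 x)
  inflation_comp : ∀ {x y z : E} (i : x ⟶ y) (j : y ⟶ z),
    IsInflation conf i → IsInflation conf j → IsInflation conf (i ≫ j)
  deflation_comp : ∀ {x y z : E} (p : x ⟶ y) (q : y ⟶ z),
    IsDeflation conf p → IsDeflation conf q → IsDeflation conf (p ≫ q)
  inflation_pushout : ∀ {x y x' : E} (i : x ⟶ y) (f : x ⟶ x'), IsInflation conf i →
    ∃ (y' : E) (f' : y ⟶ y') (i' : x' ⟶ y'), IsPushout i f f' i' ∧ IsInflation conf i'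
  deflation_pullback : ∀ {y z z' : E} (p : y ⟶ z) (f : z' ⟶ z), IsDeflation conf p →
    ∃ (y' : E) (f' : y' ⟶ y) (p' : y' ⟶ z'), IsPullback f' p' p f ∧ IsDeflation conf p'

end Exact

/-! ## Notions depending on the admissible sequences, `C` and `ι` only -/

/-- The data of a class of admissible short exact sequences, an endofunctor `C` and a natural
transformation `ι : id ⟶ C` on an additive category.  This is the part of the structure of a
bicomplicial category which enters in the definitions of contractible objects, homotopies, null
classes and complicial weak equivalences. -/
structure ConeStructure (K : Type u) [Category.{v} K] [Preadditive K] where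
  /-- the admissible short exact sequences -/
  conflation : ObjectProperty (ShortComplex K)
  /-- the cone functor `C` -/
  C : K ⥤ K
  /-- the natural transformation `ι : id ⟶ C` -/
  ι : 𝟭 K ⟶ C

namespace ConeStructure

variable {K : Type u} [Category.{v} K] [Preadditive K] (𝓚 : ConeStructure K)

/-- The component `ι_x : x ⟶ C x`. -/
def inc (x : K) : x ⟶ 𝓚.C.obj x := 𝓚.ι.app x

lemma inc_naturality {x y : K} (f : x ⟶ y) :
    f ≫ 𝓚.inc y = 𝓚.inc x ≫ 𝓚.C.map f := 𝓚.ι.naturality f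

/-- `f` and `g` are `C`-homotopic. -/
def Homotopic : HomRel K := fun x _ f g => ∃ H, f - g = 𝓚.inc x ≫ H

/-- The `C`-homotopy equivalences. -/
def homotopyEquivalences : MorphismProperty K := fun x y f =>
  ∃ g : y ⟶ x, 𝓚.Homotopic (f ≫ g) (𝟙 x) ∧ 𝓚.Homotopic (g ≫ f) (𝟙 y)

/-- The `C`-contractible objects: the identity is `C`-homotopic to zero. -/
def contractible : ObjectProperty K := fun x => 𝓚.Homotopic (𝟙 x) 0

/-- The homotopy category `π₀`: same objects, `C`-homotopy classes of morphisms. -/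
abbrev Pi0 : Type u := CategoryTheory.Quotient 𝓚.Homotopic

/-- The projection to the homotopy category. -/
abbrev toPi0 : K ⥤ 𝓚.Pi0 := CategoryTheory.Quotient.functor 𝓚.Homotopic

/-- The same category with the Frobenius admissible short exact sequences: those whose admissible
monomorphism `i : x ⟶ y` has the property that every morphism `x ⟶ C u` extends along `i`. -/
def frob : ConeStructure K where
  conflation := fun S => 𝓚.conflation S ∧
    ∀ (u : K) (f : S.X₁ ⟶ 𝓚.C.obj u), ∃ g : S.X₂ ⟶ 𝓚.C.obj u, S.f ≫ g = f
  C := 𝓚.C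
  ι := 𝓚.ι

/-- Null classes: full subcategories which contain the `C`-contractible objects and satisfy
two out of three for admissible short exact sequences. -/
structure IsNullClass (N : ObjectProperty K) : Prop where
  contractible_le : 𝓚.contractible ≤ N
  prop_X₃ : ∀ S : ShortComplex K, 𝓚.conflation S → N S.X₁ → N S.X₂ → N S.X₃
  prop_X₂ : ∀ S : ShortComplex K, 𝓚.conflation S → N S.X₁ → N S.X₃ → N S.X₂
  prop_X₁ : ∀ S : ShortComplex K, 𝓚.conflation S → N S.X₂ → N S.X₃ → N S.X₁

/-- The null closure: the smallest null class containing `N`. -/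
def nullClosure (N : ObjectProperty K) : ObjectProperty K := fun x =>
  ∀ M : ObjectProperty K, 𝓚.IsNullClass M → N ≤ M → M x

/-- Classes of complicial weak equivalences: saturated (two out of three), extensional (closed
under extensions), and containing all `C`-homotopy equivalences. -/
structure IsComplicialWeakEquivalences (w : MorphismProperty K) : Prop where
  saturated : w.HasTwoOutOfThreeProperty
  extensional : ∀ {S S' : ShortComplex K} (φ : S ⟶ S'), 𝓚.conflation S → 𝓚.conflation S' →
    w φ.τ₁ → w φ.τ₃ → w φ.τ₂
  homotopyEquivalences_le : 𝓚.homotopyEquivalences ≤ w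

/-- The thick complicial closure: the smallest class of complicial weak equivalences which
contains `v` and is closed under retracts in the category of morphisms. -/
def thickClosure (v : MorphismProperty K) : MorphismProperty K := fun _ _ f =>
  ∀ w : MorphismProperty K, 𝓚.IsComplicialWeakEquivalences w → w.IsStableUnderRetracts →
    v ≤ w → w f

/-- Triangulated subcategories of `π₀` (closed under isomorphisms).  The exact triangles of `π₀`
are those isomorphic to `x ⟶ y ⟶ Cone f ⟶ T x`, where `Cone f` is the pushout of `ι_x` along
`f : x ⟶ y`; in particular `Cone (x ⟶ 0)` is the suspension `T x`, so that two out of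
three for exact triangles includes stability under `T` and its inverse. -/
structure IsTriangulatedSubcategory (D : ObjectProperty 𝓚.Pi0) : Prop where
  isClosedUnderIsomorphisms : D.IsClosedUnderIsomorphisms
  zero : ∀ z : K, IsZero z → D (𝓚.toPi0.obj z)
  prop_cone : ∀ {x y c : K} (f : x ⟶ y) (j : 𝓚.C.obj x ⟶ c) (i : y ⟶ c),
    IsPushout (𝓚.inc x) f j i →
      D (𝓚.toPi0.obj x) → D (𝓚.toPi0.obj y) → D (𝓚.toPi0.obj c)
  prop_target : ∀ {x y c : K} (f : x ⟶ y) (j : 𝓚.C.obj x ⟶ c) (i : y ⟶ c),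
    IsPushout (𝓚.inc x) f j i →
      D (𝓚.toPi0.obj x) → D (𝓚.toPi0.obj c) → D (𝓚.toPi0.obj y)
  prop_source : ∀ {x y c : K} (f : x ⟶ y) (j : 𝓚.C.obj x ⟶ c) (i : y ⟶ c),
    IsPushout (𝓚.inc x) f j i →
      D (𝓚.toPi0.obj y) → D (𝓚.toPi0.obj c) → D (𝓚.toPi0.obj x)

/-- The ordered pair of triangulated subcategories `(N, M)` of `π₀` is factorizable: any morphism
from an object of `N` to an object of `M` factors through an object of `N ∩ M`. -/
structure IsFactorizable (N M : ObjectProperty 𝓚.Pi0) : Prop where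
  left : 𝓚.IsTriangulatedSubcategory N
  right : 𝓚.IsTriangulatedSubcategory M
  factors : ∀ {x y : 𝓚.Pi0} (f : x ⟶ y), N x → M y →
    ∃ (z : 𝓚.Pi0) (a : x ⟶ z) (b : z ⟶ y), N z ∧ M z ∧ a ≫ b = f

end ConeStructure

/-- The `w`-closure `D_w` of a full subcategory `D`: objects connected to an object of `D` by a
zig-zag of morphisms in `w`. -/
def zigzagClosure {K : Type u} [Category.{v} K] (w : MorphismProperty K) (D : ObjectProperty K) :
    ObjectProperty K := fun x =>
  ∃ y, D y ∧ Relation.EqvGen (fun a b => ∃ f : a ⟶ b, w f) x y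

/-- The full subcategory of `w`-trivial objects: those `x` such that `0 ⟶ x` is in `w`. -/
def trivialObjects {K : Type u} [Category.{v} K] [HasZeroMorphisms K] [HasZeroObject K]
    (w : MorphismProperty K) : ObjectProperty K := fun x =>
  w (0 : (0 : K) ⟶ x)

/-! ## Bicomplicial categories -/

/-- A bicomplicial category: a Quillen exact category with an exact endofunctor `C`, natural
transformations `ι : id ⟶ C`, `r : C C ⟶ C` and a natural involution `σ` of `C C` such that
`r C(ι) = r ι_C = id`, `σ C(ι) = ι_C`, `σ σ = id`, such that `ι` is an admissible monomorphism and
such that the quotient functor `T = C / id` is fully faithful and essentially surjective.  (The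
quotient functor, which is determined up to unique isomorphism, is part of the data.) -/
structure BicomplicialCategory (E : Type u) [Category.{v} E] [Preadditive E] extends
    ConeStructure E where
  exact : IsExactStructure conflation
  C_additive : C.Additive
  C_exact : ∀ S : ShortComplex E, conflation S → conflation (S.map C)
  /-- the natural transformation `r : C C ⟶ C` -/
  r : C ⋙ C ⟶ C
  /-- the symmetry `σ` of `C C` -/
  σ : C ⋙ C ⟶ C ⋙ C
  map_ι_r : ∀ x : E, C.map (ι.app x) ≫ r.app x = 𝟙 (C.obj x)
  ι_C_r : ∀ x : E, ι.app (C.obj x) ≫ r.app x = 𝟙 (C.obj x)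
  map_ι_σ : ∀ x : E, C.map (ι.app x) ≫ σ.app x = ι.app (C.obj x)
  σ_σ : ∀ x : E, σ.app x ≫ σ.app x = 𝟙 (C.obj (C.obj x))
  /-- the suspension functor `T = C / id` -/
  T : E ⥤ E
  /-- the projection `C ⟶ T` -/
  π : C ⟶ T
  ι_π : ∀ x : E, toConeStructure.inc x ≫ π.app x = 0
  conflation_ι_π : ∀ x : E,
    conflation (ShortComplex.mk (toConeStructure.inc x) (π.app x) (ι_π x))
  T_full : T.Full
  T_faithful : T.Faithful
  T_essSurj : T.EssSurj

/-! ## Bounded complexes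

Complexes are indexed cohomologically: the component `x_n` of homological degree `n` is `x.X (-n)`.
-/

section Complexes

variable (E : Type u) [Category.{v} E] [Preadditive E]

/-- The complexes concentrated in the degrees `-m, …, m`. -/
def concentrated (m : ℕ) : ObjectProperty (CochainComplex E ℤ) := fun x =>
  ∀ i : ℤ, (m : ℤ) < |i| → IsZero (x.X i)

/-- The bounded complexes. -/
def bounded : ObjectProperty (CochainComplex E ℤ) := fun x => ∃ m : ℕ, concentrated E m x

/-- The category `Ch_b(E)` of bounded complexes. -/
abbrev Chb : Type (max u v) := (bounded E).FullSubcategory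

variable {E}

lemma concentrated_mono {m m' : ℕ} (h : m ≤ m') {x : CochainComplex E ℤ}
    (hx : concentrated E m x) : concentrated E m' x :=
  fun i hi => hx i (by omega)

instance [HasZeroObject E] : (bounded E).ContainsZero where
  exists_zero := ⟨0, isZero_zero _, 0, fun i _ =>
    (HomologicalComplex.eval E (ComplexShape.up ℤ) i).map_isZero (isZero_zero _)⟩

variable [HasBinaryBiproducts E]

lemma bounded_mappingCone {x y : CochainComplex E ℤ} (f : x ⟶ y)
    (hx : bounded E x) (hy : bounded E y) : bounded E (CochainComplex.mappingCone f) := by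
  obtain ⟨m, hm⟩ := hx
  obtain ⟨n, hn⟩ := hy
  refine ⟨m + n + 1, fun i hi => ?_⟩
  rw [CochainComplex.mappingCone.isZero_X_iff]
  exact ⟨hm _ (by grind), hn _ (by grind)⟩

/-- The mapping cone of a morphism of bounded complexes. -/
def coneB {x y : Chb E} (f : x ⟶ y) : Chb E :=
  ⟨CochainComplex.mappingCone f.hom, bounded_mappingCone f.hom x.property y.property⟩

/-- Strictly acyclic complexes: those which decompose into admissible short exact sequences
`Z i ⟶ x.X i ⟶ Z (i + 1)`. -/
def strictlyAcyclic (conf : ObjectProperty (ShortComplex E)) : ObjectProperty (Chb E) := fun x =>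
  ∃ (Z : ℤ → E) (k : ∀ i, Z i ⟶ x.obj.X i) (p : ∀ i, x.obj.X i ⟶ Z (i + 1))
    (h : ∀ i, k i ≫ p i = 0),
    (∀ i, conf (ShortComplex.mk (k i) (p i) (h i))) ∧
    ∀ i, x.obj.d i (i + 1) = p i ≫ k (i + 1)

/-- `Acy_b(E)`: bounded complexes which are chain homotopy equivalent to a strictly acyclic
complex. -/
def acyclic (conf : ObjectProperty (ShortComplex E)) : ObjectProperty (Chb E) := fun x =>
  ∃ y : Chb E, strictlyAcyclic conf y ∧ Nonempty (HomotopyEquiv x.obj y.obj)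

/-- The quasi-isomorphisms `qis`: chain maps with acyclic mapping cone. -/
def qis (conf : ObjectProperty (ShortComplex E)) : MorphismProperty (Chb E) := fun _ _ f =>
  acyclic conf (coneB f)

/-- The level weak equivalences `lw`. -/
def lw (w : MorphismProperty E) : MorphismProperty (Chb E) := fun _ _ f =>
  ∀ i : ℤ, w (f.hom.f i)

/-- `Acy_b^{lw}(E) = Ch_b(E^w)`. -/
def acyclicLw [HasZeroObject E] (w : MorphismProperty E) : ObjectProperty (Chb E) := fun x =>
  ∀ i : ℤ, trivialObjects w (x.obj.X i)

/-- The degreewise admissible short exact sequences of bounded complexes. -/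
def levelConflation (conf : ObjectProperty (ShortComplex E)) :
    ObjectProperty (ShortComplex (Chb E)) := fun S =>
  ∀ i : ℤ, conf (ShortComplex.mk (S.f.hom.f i) (S.g.hom.f i) (by
    rw [← HomologicalComplex.comp_f, ← ObjectProperty.FullSubcategory.comp_hom, S.zero]
    rfl))

/-- The usual structure `𝔹` on `Ch_b(E)`: degreewise admissible short exact sequences, `C x` is the
mapping cone of the identity of `x` and `ι` is the canonical inclusion. -/
def structB (conf : ObjectProperty (ShortComplex E)) : ConeStructure (Chb E) where
  conflation := levelConflation conf
  C :=
    { obj := fun x => coneB (𝟙 x)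
      map := fun {x y} f => ObjectProperty.homMk
        (CochainComplex.mappingCone.map (𝟙 x.obj) (𝟙 y.obj) f.hom f.hom (by simp))
      map_id := fun x => by
        ext1
        exact CochainComplex.mappingCone.map_id _
      map_comp := fun {x y z} f g => by
        ext1
        exact CochainComplex.mappingCone.map_comp (𝟙 x.obj) (𝟙 y.obj) (𝟙 z.obj) f.hom f.hom
          (by simp) g.hom g.hom (by simp) }
  ι :=
    { app := fun x => ObjectProperty.homMk (CochainComplex.mappingCone.inr (𝟙 x.obj))
      naturality := fun x y f => by
        ext1
        change f.hom ≫ CochainComplex.mappingCone.inr (𝟙 y.obj) =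
          CochainComplex.mappingCone.inr (𝟙 x.obj) ≫
            CochainComplex.mappingCone.map (𝟙 x.obj) (𝟙 y.obj) f.hom f.hom (by simp)
        simp [CochainComplex.mappingCone.map] }

end Complexes

/-! ## The derived category of a pair and quasi-weak equivalences -/

section Derived

/-- The triangulated closure of `P`: the smallest triangulated subcategory (closed under
isomorphisms) containing `P`. -/
def triClosure {T : Type u} [Category.{v} T] [HasZeroObject T] [HasShift T ℤ] [Preadditive T]
    [∀ n : ℤ, (shiftFunctor T n).Additive] [Pretriangulated T] (P : ObjectProperty T) :
    ObjectProperty T := fun x =>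
  ∀ Q : ObjectProperty T, Q.IsTriangulated → Q.IsClosedUnderIsomorphisms → P ≤ Q → Q x

instance {T : Type u} [Category.{v} T] [HasZeroObject T] [HasShift T ℤ] [Preadditive T]
    [∀ n : ℤ, (shiftFunctor T n).Additive] [Pretriangulated T] (P : ObjectProperty T) :
    (triClosure P).IsClosedUnderIsomorphisms where
  of_iso e hx Q hQ hQ' hP := hQ'.of_iso e (hx Q hQ hQ' hP)

instance {T : Type u} [Category.{v} T] [HasZeroObject T] [HasShift T ℤ] [Preadditive T]
    [∀ n : ℤ, (shiftFunctor T n).Additive] [Pretriangulated T] (P : ObjectProperty T) :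
    (triClosure P).IsTriangulated where
  exists_zero := ⟨0, isZero_zero _, fun Q _ _ _ => Q.prop_zero⟩
  isStableUnderShiftBy n := ⟨fun x hx Q hQ hQ' hP => Q.le_shift n x (hx Q hQ hQ' hP)⟩
  ext₂' t ht h₁ h₃ := ObjectProperty.le_isoClosure _ _ fun Q hQ hQ' hP =>
    Q.ext_of_isTriangulatedClosed₂ t ht (h₁ Q hQ hQ' hP) (h₃ Q hQ hQ' hP)

variable (E : Type u) [Category.{v} E] [Preadditive E]

/-- The bounded complexes in the homotopy category of complexes. -/
def boundedH : ObjectProperty (HomotopyCategory E (ComplexShape.up ℤ)) :=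
  (bounded E).strictMap (HomotopyCategory.quotient E (ComplexShape.up ℤ))

variable {E} in
lemma boundedH_quotient_obj_iff (x : CochainComplex E ℤ) :
    boundedH E ((HomotopyCategory.quotient _ _).obj x) ↔ bounded E x := by
  refine ⟨?_, fun h => ⟨_, h⟩⟩
  simp only [boundedH, ObjectProperty.strictMap_iff]
  rintro ⟨y, h, hy⟩
  obtain rfl : y = x := congr_arg Quotient.as hy
  exact h

instance [HasZeroObject E] : (boundedH E).ContainsZero where
  exists_zero :=
    ⟨(HomotopyCategory.quotient _ _).obj 0, Functor.map_isZero _ (isZero_zero _), by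
      rw [boundedH_quotient_obj_iff]
      exact ⟨0, fun i _ =>
        (HomologicalComplex.eval E (ComplexShape.up ℤ) i).map_isZero (isZero_zero _)⟩⟩

instance : (boundedH E).IsStableUnderShift ℤ where
  isStableUnderShiftBy n :=
    { le_shift := fun x hx => by
        obtain ⟨x : CochainComplex _ _, rfl⟩ := x.quotient_obj_surjective
        rw [boundedH_quotient_obj_iff] at hx
        obtain ⟨m, hm⟩ := hx
        rw [ObjectProperty.prop_shift_iff, HomotopyCategory.shift_quotient_obj,
          boundedH_quotient_obj_iff]
        exact ⟨m + n.natAbs, fun i hi => hm (i + n) (by grind)⟩ }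

variable [HasZeroObject E] [HasBinaryBiproducts E]

instance : (boundedH E).IsTriangulatedClosed₃ where
  ext₃' T hT h₁ h₂ := by
    have h₁' : bounded E T.obj₁.as := by rwa [← boundedH_quotient_obj_iff]
    have h₂' : bounded E T.obj₂.as := by rwa [← boundedH_quotient_obj_iff]
    obtain ⟨f : T.obj₁.as ⟶ T.obj₂.as, hf⟩ :=
      (HomotopyCategory.quotient _ _).map_surjective T.mor₁
    refine ⟨_, ?_, ⟨Pretriangulated.Triangle.π₃.mapIso (Pretriangulated.isoTriangleOfIso₁₂ T _ hT
      (HomotopyCategory.mappingCone_triangleh_distinguished f)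
        (Iso.refl _) (Iso.refl _) ?_)⟩⟩
    · exact (boundedH_quotient_obj_iff _).2 (bounded_mappingCone f h₁' h₂')
    · exact (Category.comp_id _).trans (hf.symm.trans (Category.id_comp _).symm)

instance : (boundedH E).IsTriangulated where
  toIsTriangulatedClosed₂ := .of_isTriangulatedClosed₃

/-- The homotopy category `H_b(E)` of bounded complexes, as a triangulated category. -/
abbrev Hb : Type (max u v) := (boundedH E).FullSubcategory

/-- The projection `P : Ch_b(E) ⥤ H_b(E)`. -/
def toHb : Chb E ⥤ Hb E :=
  (boundedH E).lift ((bounded E).ι ⋙ HomotopyCategory.quotient E (ComplexShape.up ℤ))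
    fun x => (boundedH_quotient_obj_iff _).2 x.property

variable {E}
variable (conf : ObjectProperty (ShortComplex E)) (w : MorphismProperty E)

/-- The triangulated subcategory of `H_b(E)` formed by the acyclic complexes.  (For an exact
structure, the image of `Acy_b(E)` is already a triangulated subcategory.) -/
abbrev acyclicH : ObjectProperty (Hb E) := triClosure ((acyclic conf).strictMap (toHb E))

/-- The bounded derived category `D_b(E)`: the Verdier quotient of `H_b(E)` by the acyclic
complexes. -/
abbrev Db : Type (max u v) := (acyclicH conf).trW.Localization

/-- The projection `Ch_b(E) ⥤ D_b(E)`. -/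
def toDb : Chb E ⥤ Db conf := toHb E ⋙ (acyclicH conf).trW.Q

/-- The triangulated image of `D_b(E^w) ⥤ D_b(E)`: the smallest triangulated subcategory
containing the images of all the objects of `D_b(E^w)`, i.e. of the bounded complexes in `E^w`. -/
abbrev imageDb : ObjectProperty (Db conf) := triClosure ((acyclicLw w).strictMap (toDb conf))

/-- The bounded derived category `D_b(E, w)` of the pair: the cokernel of
`D_b(E^w) ⥤ D_b(E)`, i.e. the Verdier quotient of `D_b(E)` by the triangulated image. -/
abbrev DbPair : Type (max u v) := (imageDb conf w).trW.Localization

/-- The projection `Ch_b(E) ⥤ D_b(E, w)`. -/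
def toDbPair : Chb E ⥤ DbPair conf w := toDb conf ⋙ (imageDb conf w).trW.Q

/-- The quasi-weak equivalences `qw`: the chain maps which become isomorphisms in `D_b(E, w)`. -/
def qw : MorphismProperty (Chb E) := fun _ _ f => IsIso ((toDbPair conf w).map f)

end Derived

namespace BicomplicialCategory

variable {E : Type u} [Category.{v} E] [Preadditive E] (𝓑 : BicomplicialCategory E)

instance : 𝓑.C.Additive := 𝓑.C_additive

/-- The structure `𝔸` on `Ch_b(E)` which is induced degreewise by that of `E`. -/
def structA : ConeStructure (Chb E) where
  conflation := levelConflation 𝓑.conflation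
  C := (bounded E).lift ((bounded E).ι ⋙ 𝓑.C.mapHomologicalComplex (ComplexShape.up ℤ))
    fun x => by
      obtain ⟨m, hm⟩ := x.property
      exact ⟨m, fun i hi => 𝓑.C.map_isZero (hm i hi)⟩
  ι :=
    { app := fun x => ObjectProperty.homMk
        { f := fun i => 𝓑.inc (x.obj.X i)
          comm' := fun i j _ => (𝓑.inc_naturality (x.obj.d i j)).symm }
      naturality := fun x y f => by
        ext i
        exact 𝓑.inc_naturality (f.hom.f i) }

/-! ### The total functor -/

instance : 𝓑.T.IsEquivalence where
  faithful := 𝓑.T_faithful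
  full := 𝓑.T_full
  essSurj := 𝓑.T_essSurj

instance {x y : E} (f : x ⟶ y) : HasPushout (𝓑.inc x) f := by
  obtain ⟨y', f', i', h, -⟩ := 𝓑.exact.inflation_pushout (𝓑.inc x) f
    ⟨_, _, 𝓑.ι_π x, 𝓑.conflation_ι_π x⟩
  exact h.hasPushout

/-- The mapping cone of `f`: the pushout of `ι_x : x ⟶ C x` along `f : x ⟶ y`. -/
def cone {x y : E} (f : x ⟶ y) : E := pushout (𝓑.inc x) f

/-- The morphism `C x ⟶ Cone f`. -/
def coneInl {x y : E} (f : x ⟶ y) : 𝓑.C.obj x ⟶ 𝓑.cone f := pushout.inl _ _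

/-- The inclusion `κ : y ⟶ Cone f`. -/
def coneInr {x y : E} (f : x ⟶ y) : y ⟶ 𝓑.cone f := pushout.inr _ _

lemma cone_condition {x y : E} (f : x ⟶ y) :
    𝓑.inc x ≫ 𝓑.coneInl f = f ≫ 𝓑.coneInr f := pushout.condition

lemma cone_hom_ext {x y z : E} {f : x ⟶ y} {a b : 𝓑.cone f ⟶ z}
    (h₁ : 𝓑.coneInl f ≫ a = 𝓑.coneInl f ≫ b) (h₂ : 𝓑.coneInr f ≫ a = 𝓑.coneInr f ≫ b) :
    a = b := pushout.hom_ext h₁ h₂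

/-- The morphism from the cone given by morphisms from `C x` and from `y`. -/
def coneDesc {x y z : E} (f : x ⟶ y) (a : 𝓑.C.obj x ⟶ z) (b : y ⟶ z) (h : 𝓑.inc x ≫ a = f ≫ b) :
    𝓑.cone f ⟶ z := pushout.desc a b h

@[simp]
lemma coneInl_desc {x y z : E} (f : x ⟶ y) (a : 𝓑.C.obj x ⟶ z) (b : y ⟶ z)
    (h : 𝓑.inc x ≫ a = f ≫ b) : 𝓑.coneInl f ≫ 𝓑.coneDesc f a b h = a :=
  pushout.inl_desc _ _ _

@[simp]
lemma coneInl_desc_assoc {x y z t : E} (f : x ⟶ y) (a : 𝓑.C.obj x ⟶ z) (b : y ⟶ z)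
    (h : 𝓑.inc x ≫ a = f ≫ b) (g : z ⟶ t) :
    𝓑.coneInl f ≫ 𝓑.coneDesc f a b h ≫ g = a ≫ g := by
  rw [← Category.assoc, coneInl_desc]

@[simp]
lemma coneInr_desc {x y z : E} (f : x ⟶ y) (a : 𝓑.C.obj x ⟶ z) (b : y ⟶ z)
    (h : 𝓑.inc x ≫ a = f ≫ b) : 𝓑.coneInr f ≫ 𝓑.coneDesc f a b h = b :=
  pushout.inr_desc _ _ _

@[simp]
lemma coneInr_desc_assoc {x y z t : E} (f : x ⟶ y) (a : 𝓑.C.obj x ⟶ z) (b : y ⟶ z)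
    (h : 𝓑.inc x ≫ a = f ≫ b) (g : z ⟶ t) :
    𝓑.coneInr f ≫ 𝓑.coneDesc f a b h ≫ g = b ≫ g := by
  rw [← Category.assoc, coneInr_desc]

/-- The morphism of cones induced by a commutative square. -/
def coneMap {x y x' y' : E} (f : x ⟶ y) (f' : x' ⟶ y') (a : x ⟶ x') (b : y ⟶ y')
    (h : a ≫ f' = f ≫ b) : 𝓑.cone f ⟶ 𝓑.cone f' :=
  𝓑.coneDesc f (𝓑.C.map a ≫ 𝓑.coneInl f') (b ≫ 𝓑.coneInr f') (by
    rw [← Category.assoc, ← 𝓑.inc_naturality, Category.assoc, cone_condition, ← Category.assoc, h,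
      Category.assoc])

@[simp]
lemma coneInl_map {x y x' y' : E} (f : x ⟶ y) (f' : x' ⟶ y') (a : x ⟶ x') (b : y ⟶ y')
    (h : a ≫ f' = f ≫ b) :
    𝓑.coneInl f ≫ 𝓑.coneMap f f' a b h = 𝓑.C.map a ≫ 𝓑.coneInl f' :=
  𝓑.coneInl_desc _ _ _ _

@[simp]
lemma coneInl_map_assoc {x y x' y' z : E} (f : x ⟶ y) (f' : x' ⟶ y') (a : x ⟶ x') (b : y ⟶ y')
    (h : a ≫ f' = f ≫ b) (g : 𝓑.cone f' ⟶ z) :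
    𝓑.coneInl f ≫ 𝓑.coneMap f f' a b h ≫ g = 𝓑.C.map a ≫ 𝓑.coneInl f' ≫ g := by
  rw [← Category.assoc, coneInl_map, Category.assoc]

@[simp]
lemma coneInr_map {x y x' y' : E} (f : x ⟶ y) (f' : x' ⟶ y') (a : x ⟶ x') (b : y ⟶ y')
    (h : a ≫ f' = f ≫ b) :
    𝓑.coneInr f ≫ 𝓑.coneMap f f' a b h = b ≫ 𝓑.coneInr f' :=
  𝓑.coneInr_desc _ _ _ _

@[simp]
lemma coneInr_map_assoc {x y x' y' z : E} (f : x ⟶ y) (f' : x' ⟶ y') (a : x ⟶ x') (b : y ⟶ y')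
    (h : a ≫ f' = f ≫ b) (g : 𝓑.cone f' ⟶ z) :
    𝓑.coneInr f ≫ 𝓑.coneMap f f' a b h ≫ g = b ≫ 𝓑.coneInr f' ≫ g := by
  rw [← Category.assoc, coneInr_map, Category.assoc]

lemma isIso_coneInr {x y : E} (f : x ⟶ y) (hx : IsZero x) : IsIso (𝓑.coneInr f) :=
  ⟨𝓑.coneDesc f 0 (𝟙 y) (hx.eq_of_src _ _), by simp,
    𝓑.cone_hom_ext ((𝓑.C.map_isZero hx).eq_of_src _ _) (by simp)⟩

lemma isIso_coneMap {x y x' y' : E} (f : x ⟶ y) (f' : x' ⟶ y') (a : x ⟶ x') (b : y ⟶ y')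
    (h : a ≫ f' = f ≫ b) [IsIso a] [IsIso b] : IsIso (𝓑.coneMap f f' a b h) :=
  ⟨𝓑.coneMap f' f (inv a) (inv b) (by simp [← h]),
    𝓑.cone_hom_ext (by simp) (by simp),
    𝓑.cone_hom_ext (by simp) (by simp)⟩

/-- The projection `ψ : Cone f ⟶ T x`. -/
def coneProj {x y : E} (f : x ⟶ y) : 𝓑.cone f ⟶ 𝓑.T.obj x :=
  𝓑.coneDesc f (𝓑.π.app x) 0 (by rw [𝓑.ι_π, comp_zero])

lemma isIso_coneProj {x y : E} (f : x ⟶ y) (hy : IsZero y) : IsIso (𝓑.coneProj f) := by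
  obtain ⟨hc⟩ := 𝓑.exact.isCokernel _ (𝓑.conflation_ι_π x)
  have h0 : 𝓑.inc x ≫ 𝓑.coneInl f = 0 := by
    rw [cone_condition, hy.eq_of_src (𝓑.coneInr f) 0, comp_zero]
  let s : 𝓑.T.obj x ⟶ 𝓑.cone f := hc.desc (CokernelCofork.ofπ (𝓑.coneInl f) h0)
  have hs : 𝓑.π.app x ≫ s = 𝓑.coneInl f :=
    hc.fac (CokernelCofork.ofπ (𝓑.coneInl f) h0) WalkingParallelPair.one
  refine ⟨s, 𝓑.cone_hom_ext ?_ (hy.eq_of_src _ _), ?_⟩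
  · rw [← Category.assoc, coneProj, coneInl_desc, hs, Category.comp_id]
  · apply Cofork.IsColimit.hom_ext hc
    change 𝓑.π.app x ≫ s ≫ 𝓑.coneProj f = 𝓑.π.app x ≫ 𝟙 _
    rw [← Category.assoc, hs, coneProj, coneInl_desc, Category.comp_id]

/-- A functor `F` on complexes together with natural morphisms `g` to all the components, which are
annihilated by the differentials. -/
structure PartialTotal (E : Type u) [Category.{v} E] [Preadditive E] where
  /-- the functor on objects -/
  obj : CochainComplex E ℤ → E
  /-- the functor on morphisms -/
  map : ∀ {x y : CochainComplex E ℤ}, (x ⟶ y) → (obj x ⟶ obj y)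
  map_id : ∀ x : CochainComplex E ℤ, map (𝟙 x) = 𝟙 (obj x)
  map_comp : ∀ {x y z : CochainComplex E ℤ} (f : x ⟶ y) (h : y ⟶ z),
    map (f ≫ h) = map f ≫ map h
  /-- the morphisms to the components -/
  g : ∀ (x : CochainComplex E ℤ) (j : ℤ), obj x ⟶ x.X j
  g_naturality : ∀ {x y : CochainComplex E ℤ} (f : x ⟶ y) (j : ℤ), map f ≫ g y j = g x j ≫ f.f j
  g_d : ∀ (x : CochainComplex E ℤ) (j k : ℤ), g x j ≫ x.d j k = 0

/-- The functor `x ↦ x.X b`, with the differentials `x.X b ⟶ x.X j`. -/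
def PartialTotal.single (b : ℤ) : PartialTotal E where
  obj x := x.X b
  map f := f.f b
  map_id _ := rfl
  map_comp _ _ := rfl
  g x j := x.d b j
  g_naturality f j := f.comm b j
  g_d x j k := x.d_comp_d b j k

/-- The functor sending `x` to the cone of `g : F x ⟶ x.X b`. -/
def coneTotal (P : PartialTotal E) (b : ℤ) : PartialTotal E where
  obj x := 𝓑.cone (P.g x b)
  map f := 𝓑.coneMap _ _ (P.map f) (f.f b) (P.g_naturality f b)
  map_id x := 𝓑.cone_hom_ext (by simp [P.map_id]) (by simp)
  map_comp f h := 𝓑.cone_hom_ext (by simp [P.map_comp]) (by simp)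
  g x j := 𝓑.coneDesc _ 0 (x.d b j) (by rw [comp_zero, P.g_d])
  g_naturality f j := 𝓑.cone_hom_ext (by simp) (by simp)
  g_d x j k := 𝓑.cone_hom_ext (by simp) (by simp)

/-- `partialTotal n b` is the totalization of the part `x.X (b - n) ⟶ ⋯ ⟶ x.X b` of a complex,
with `x.X b` placed in degree zero: the iterated mapping cone obtained by
`partialTotal 0 b = x.X b` and `partialTotal (n + 1) b = Cone (partialTotal n (b - 1) ⟶ x.X b)`,
where the morphism to `x.X b` is induced by the differential `x.X (b - 1) ⟶ x.X b`. -/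
def partialTotal : ℕ → ℤ → PartialTotal E
  | 0, b => PartialTotal.single b
  | n + 1, b => 𝓑.coneTotal (partialTotal n (b - 1)) b

/-- Natural morphisms which are compatible with the morphisms to the components. -/
structure PartialTotal.Hom (P Q : PartialTotal E) where
  /-- the components -/
  app : ∀ x : CochainComplex E ℤ, P.obj x ⟶ Q.obj x
  naturality : ∀ {x y : CochainComplex E ℤ} (f : x ⟶ y), P.map f ≫ app y = app x ≫ Q.map f
  app_g : ∀ (x : CochainComplex E ℤ) (j : ℤ), app x ≫ Q.g x j = P.g x j

/-- The inclusion of `x.X b` in the cone. -/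
def singleToCone (P : PartialTotal E) (b : ℤ) :
    (PartialTotal.single b).Hom (𝓑.coneTotal P b) where
  app x := 𝓑.coneInr (P.g x b)
  naturality f := (𝓑.coneInr_map (P.g _ b) (P.g _ b) (P.map f) (f.f b) (P.g_naturality f b)).symm
  app_g _ _ := 𝓑.coneInr_desc _ _ _ _

/-- Functoriality of the cone. -/
def coneTotalMap {P Q : PartialTotal E} (φ : P.Hom Q) (b : ℤ) :
    (𝓑.coneTotal P b).Hom (𝓑.coneTotal Q b) where
  app x := 𝓑.coneMap _ _ (φ.app x) (𝟙 (x.X b)) (by rw [φ.app_g, Category.comp_id])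
  naturality f := 𝓑.cone_hom_ext
    (by simp only [coneTotal, coneInl_map_assoc, coneInl_map, ← Functor.map_comp_assoc,
          φ.naturality])
    (by simp [coneTotal])
  app_g x j := 𝓑.cone_hom_ext (by simp [coneTotal]) (by simp [coneTotal])

/-- The canonical morphism from `partialTotal n b` to `partialTotal (n + 1) b`, which extends the
part of the complex by the component `x.X (b - (n + 1))`. -/
def partialTotalUp : ∀ (n : ℕ) (b : ℤ), (𝓑.partialTotal n b).Hom (𝓑.partialTotal (n + 1) b)
  | 0, b => 𝓑.singleToCone _ b
  | n + 1, b => 𝓑.coneTotalMap (partialTotalUp n (b - 1)) b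

lemma isIso_partialTotalUp (n : ℕ) : ∀ (b : ℤ) (x : CochainComplex E ℤ)
    (_ : IsZero (x.X (b - (n + 1)))), IsIso ((𝓑.partialTotalUp n b).app x) := by
  induction n with
  | zero =>
    intro b x hx
    exact 𝓑.isIso_coneInr (x.d (b - 1) b) (by simpa using hx)
  | succ n ih =>
    intro b x hx
    have h1 : IsIso ((𝓑.partialTotalUp n (b - 1)).app x) := ih (b - 1) x (by
      rwa [show b - 1 - ((n : ℤ) + 1) = b - (((n + 1 : ℕ) : ℤ) + 1) by push_cast; ring])
    exact 𝓑.isIso_coneMap _ _ _ (𝟙 (x.X b)) (by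
      rw [(𝓑.partialTotalUp n (b - 1)).app_g, Category.comp_id])

/-- The projection from `partialTotal (n + 1) b` to the suspension of `partialTotal n (b - 1)`. -/
def partialTotalProj (n : ℕ) {b c : ℤ} (h : b - 1 = c) (x : CochainComplex E ℤ) :
    (𝓑.partialTotal (n + 1) b).obj x ⟶ 𝓑.T.obj ((𝓑.partialTotal n c).obj x) :=
  h ▸ 𝓑.coneProj ((𝓑.partialTotal n (b - 1)).g x b)

lemma partialTotalProj_naturality (n : ℕ) {b c : ℤ} (h : b - 1 = c) {x y : CochainComplex E ℤ}
    (f : x ⟶ y) :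
    (𝓑.partialTotal (n + 1) b).map f ≫ 𝓑.partialTotalProj n h y =
      𝓑.partialTotalProj n h x ≫ 𝓑.T.map ((𝓑.partialTotal n c).map f) := by
  subst h
  exact 𝓑.cone_hom_ext (by simp [partialTotal, coneTotal, partialTotalProj, coneProj])
    (by simp [partialTotal, coneTotal, partialTotalProj, coneProj])

lemma isIso_partialTotalProj (n : ℕ) {b c : ℤ} (h : b - 1 = c) (x : CochainComplex E ℤ)
    (hx : IsZero (x.X b)) : IsIso (𝓑.partialTotalProj n h x) := by
  subst h
  exact 𝓑.isIso_coneProj _ hx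

/-- The desuspension functor: an inverse of the equivalence `T`. -/
def desuspension : E ⥤ E := 𝓑.T.inv

/-- The iterated desuspension functors. -/
def iteratedDesuspension : ℕ → (E ⥤ E)
  | 0 => 𝟭 E
  | k + 1 => 𝓑.desuspension ⋙ iteratedDesuspension k

/-- The totalization of the part `x.X (-m) ⟶ ⋯ ⟶ x.X m` of a complex: the iterated mapping cone
(in which `x.X m` is in degree zero), desuspended `m` times. -/
def truncatedTotal (m : ℕ) : CochainComplex E ℤ ⥤ E where
  obj x := (𝓑.iteratedDesuspension m).obj ((𝓑.partialTotal (2 * m) m).obj x)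
  map f := (𝓑.iteratedDesuspension m).map ((𝓑.partialTotal (2 * m) m).map f)
  map_id x := by rw [PartialTotal.map_id, CategoryTheory.Functor.map_id]
  map_comp f h := by rw [PartialTotal.map_comp, CategoryTheory.Functor.map_comp]

/-- The canonical isomorphism between the totalization of the parts of `x` in the degrees
`-m, …, m` and in the degrees `-(m + 1), …, m + 1`, if `x` is concentrated in the former. -/
def truncatedTotalStep (m : ℕ) (x : CochainComplex E ℤ) (hx : concentrated E m x) :
    (𝓑.truncatedTotal m).obj x ≅ (𝓑.truncatedTotal (m + 1)).obj x :=
  haveI := 𝓑.isIso_partialTotalUp (2 * m) m x (hx _ (by push_cast; grind))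
  haveI := 𝓑.isIso_partialTotalProj (2 * m + 1) (add_sub_cancel_right (m : ℤ) 1) x
    (hx _ (by grind))
  (𝓑.iteratedDesuspension m).mapIso
    (asIso ((𝓑.partialTotalUp (2 * m) m).app x) ≪≫ 𝓑.T.asEquivalence.unitIso.app _ ≪≫
      𝓑.desuspension.mapIso 
        (asIso (𝓑.partialTotalProj (2 * m + 1) (add_sub_cancel_right (m : ℤ) 1) x)).symm)

lemma truncatedTotalStep_naturality (m : ℕ) {x y : CochainComplex E ℤ} (f : x ⟶ y)
    (hx : concentrated E m x) (hy : concentrated E m y) :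
    (𝓑.truncatedTotal m).map f ≫ (𝓑.truncatedTotalStep m y hy).hom =
      (𝓑.truncatedTotalStep m x hx).hom ≫ (𝓑.truncatedTotal (m + 1)).map f := by
  have := 𝓑.isIso_partialTotalProj (2 * m + 1) (add_sub_cancel_right (m : ℤ) 1) x
    (hx _ (by grind))
  have := 𝓑.isIso_partialTotalProj (2 * m + 1) (add_sub_cancel_right (m : ℤ) 1) y
    (hy _ (by grind))
  have h₁ := (𝓑.partialTotalUp (2 * m) m).naturality f
  have h₂ := 𝓑.T.asEquivalence.unitIso.hom.naturality ((𝓑.partialTotal (2 * m + 1) m).map f)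
  have h₃ : 𝓑.T.map ((𝓑.partialTotal (2 * m + 1) m).map f) ≫
        inv (𝓑.partialTotalProj (2 * m + 1) (add_sub_cancel_right (m : ℤ) 1) y) =
      inv (𝓑.partialTotalProj (2 * m + 1) (add_sub_cancel_right (m : ℤ) 1) x) ≫
        (𝓑.partialTotal (2 * m + 1 + 1) ((m : ℤ) + 1)).map f := by
    rw [IsIso.comp_inv_eq, Category.assoc, partialTotalProj_naturality, IsIso.inv_hom_id_assoc]
  have h₄ := congrArg 𝓑.desuspension.map h₃
  rw [Functor.map_comp, Functor.map_comp] at h₄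
  change (𝓑.iteratedDesuspension m).map _ ≫ (𝓑.iteratedDesuspension m).map (_ ≫ _ ≫ _) =
    (𝓑.iteratedDesuspension m).map (_ ≫ _ ≫ _) ≫
      (𝓑.iteratedDesuspension m).map (𝓑.desuspension.map
        ((𝓑.partialTotal (2 * m + 1 + 1) ((m : ℤ) + 1)).map f))
  rw [← Functor.map_comp, ← Functor.map_comp]
  congr 1
  refine (Category.assoc _ _ _).symm.trans ?_
  refine (congrArg (· ≫ _) h₁).trans ?_
  simp only [Category.assoc]
  congr 1
  refine (Category.assoc _ _ _).symm.trans ?_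
  refine (congrArg (· ≫ _) h₂).trans ?_
  refine (Category.assoc _ _ _).trans ?_
  congr 1

/-- The canonical isomorphism between the totalization of the parts of `x` in the degrees
`-m, …, m` and in the degrees `-M, …, M` for `m ≤ M`, if `x` is concentrated in the former. -/
def truncatedTotalIso {m : ℕ} (x : CochainComplex E ℤ) (hx : concentrated E m x) {M : ℕ}
    (h : m ≤ M) : (𝓑.truncatedTotal m).obj x ≅ (𝓑.truncatedTotal M).obj x :=
  Nat.leRec (motive := fun M _ => (𝓑.truncatedTotal m).obj x ≅ (𝓑.truncatedTotal M).obj x)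
    (Iso.refl _) (fun M h e => e ≪≫ 𝓑.truncatedTotalStep M x (concentrated_mono h hx)) h

/-- The action of the total functor on a morphism between complexes concentrated in the degrees
`-m, …, m` and `-n, …, n`, computed by the parts in the degrees `-M, …, M`. -/
def totalMap {m n : ℕ} {x y : CochainComplex E ℤ} (hx : concentrated E m x)
    (hy : concentrated E n y) (f : x ⟶ y) {M : ℕ} (hm : m ≤ M) (hn : n ≤ M) :
    (𝓑.truncatedTotal m).obj x ⟶ (𝓑.truncatedTotal n).obj y :=
  (𝓑.truncatedTotalIso x hx hm).hom ≫ (𝓑.truncatedTotal M).map f ≫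
    (𝓑.truncatedTotalIso y hy hn).inv

lemma totalMap_succ {m n : ℕ} {x y : CochainComplex E ℤ} (hx : concentrated E m x)
    (hy : concentrated E n y) (f : x ⟶ y) {M : ℕ} (hm : m ≤ M) (hn : n ≤ M) :
    𝓑.totalMap hx hy f (hm.trans M.le_succ) (hn.trans M.le_succ) = 𝓑.totalMap hx hy f hm hn := by
  rw [totalMap, totalMap, truncatedTotalIso, truncatedTotalIso, Nat.leRec_succ _ _ hm,
    Nat.leRec_succ _ _ hn]
  simp only [Iso.trans_hom, Iso.trans_inv, Category.assoc]
  have h := 𝓑.truncatedTotalStep_naturality M f (concentrated_mono hm hx)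
    (concentrated_mono hn hy)
  rw [← Category.assoc (𝓑.truncatedTotalStep M x _).hom, ← h, Category.assoc,
    Iso.hom_inv_id_assoc]
  rfl

lemma totalMap_eq {m n : ℕ} {x y : CochainComplex E ℤ} (hx : concentrated E m x)
    (hy : concentrated E n y) (f : x ⟶ y) {M M' : ℕ} (hm : m ≤ M) (hn : n ≤ M) (h : M ≤ M') :
    𝓑.totalMap hx hy f (hm.trans h) (hn.trans h) = 𝓑.totalMap hx hy f hm hn := by
  induction h with
  | refl => rfl
  | step h ih => exact (𝓑.totalMap_succ hx hy f (hm.trans h) (hn.trans h)).trans ih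

lemma totalMap_id {m : ℕ} {x : CochainComplex E ℤ} (hx : concentrated E m x) {M : ℕ}
    (hm : m ≤ M) : 𝓑.totalMap hx hx (𝟙 x) hm hm = 𝟙 _ := by
  rw [totalMap, CategoryTheory.Functor.map_id, Category.id_comp, Iso.hom_inv_id]

lemma totalMap_comp {m n k : ℕ} {x y z : CochainComplex E ℤ} (hx : concentrated E m x)
    (hy : concentrated E n y) (hz : concentrated E k z) (f : x ⟶ y) (h : y ⟶ z) {M : ℕ}
    (hm : m ≤ M) (hn : n ≤ M) (hk : k ≤ M) :
    𝓑.totalMap hx hz (f ≫ h) hm hk = 𝓑.totalMap hx hy f hm hn ≫ 𝓑.totalMap hy hz h hn hk := by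
  simp only [totalMap, CategoryTheory.Functor.map_comp, Category.assoc, Iso.inv_hom_id_assoc]

open Classical in
/-- The smallest `m` such that the bounded complex `x` is concentrated in the degrees
`-m, …, m`. -/
def width (x : Chb E) : ℕ := Nat.find x.property

open Classical in
lemma concentrated_width (x : Chb E) : concentrated E (width x) x.obj := Nat.find_spec x.property

/-- The total functor `Tot : Ch_b(E) ⥤ E`. -/
def Tot : Chb E ⥤ E where
  obj x := (𝓑.truncatedTotal (width x)).obj x.obj
  map {x y} f := 𝓑.totalMap (concentrated_width x) (concentrated_width y) f.hom
    (le_max_left (width x) (width y)) (le_max_right (width x) (width y))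
  map_id x := by
    refine (𝓑.totalMap_eq _ _ _ le_rfl le_rfl (le_max_left (width x) (width x))).trans ?_
    exact 𝓑.totalMap_id _ _
  map_comp {x y z} f h := by
    set M := width x + width y + width z
    rw [← 𝓑.totalMap_eq _ _ (f ≫ h).hom _ _ (show max (width x) (width z) ≤ M by grind),
      ← 𝓑.totalMap_eq _ _ f.hom _ _ (show max (width x) (width y) ≤ M by grind),
      ← 𝓑.totalMap_eq _ _ h.hom _ _ (show max (width y) (width z) ≤ M by grind)]
    exact 𝓑.totalMap_comp _ _ _ _ _ _ _ _

/-- The total weak equivalences `tw`. -/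
def tw (w : MorphismProperty E) : MorphismProperty (Chb E) := w.inverseImage 𝓑.Tot

/-- `Acy_b^{tw}(E)`. -/
def acyclicTw [HasZeroObject E] (w : MorphismProperty E) : ObjectProperty (Chb E) :=
  trivialObjects (𝓑.tw w)

end BicomplicialCategory

end Bicomplicial

end

open Bicomplicial

/-! Everything rests on one generation statement, `acyclicTw_le`: a null class `N` of the Frobenius
structure on `𝔹` which contains the acyclic complexes and the degreewise `w`-trivial ones contains
every complex with `w`-trivial total object.

It is proved by induction on the length of the interval supporting the complex `x`. Splitting off
the lowest term, in degree `a`, presents `x[1]` as the chain mapping cone of some `f : u ⟶ y[1]`,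
with `u` concentrated in degree `a`. By `null_coneB_iff`, `N` does not distinguish this cone from
the cone of `f` formed degreewise with the functor `C` of `E`: for a degreewise cone `c`, the total
complex of the conflation `u ⟶ C u ⊞ y[1] ⟶ c` is strictly acyclic, and `C u` is degreewise
contractible. The degreewise cone is supported on an interval shorter by one. The class of complexes
with trivial total object satisfies the same hypotheses as `N`, so it is preserved by the
replacement too. A complex in a single degree has trivial total object only if it is degreewise
trivial, which starts the induction.

The hypotheses on the `tw`-trivial complexes come from the exactness of the iterated cone, from the
computation of the total object of a strictly acyclic complex (`exists_weq_partialTotal`), and from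
an explicit contraction of the total object of a contractible complex
(`exists_contraction_partialTotal`). Part 1 follows by minimality of the null closure.

For part 2 it is enough that the zig-zag closure is already a null class. In general only closure
under cones fails: a morphism between objects equivalent to objects of `N` need not be equivalent to
a morphism in `N`. A factorization through objects that are both in `N` and trivial provides such a
replacement (`isNullClass_zigzagClosure`).

For part 3, null classes of the Frobenius structure on `𝔹` correspond to triangulated subcategories
of the homotopy category. The universal property of Verdier quotients then shows that a complex
vanishing in `D_b(E, w)` is a retract of a complex with trivial total object
(`exists_retract_of_isZero`), and closure under retracts finishes the proof. -/

noncomputable section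

namespace Bicomplicial

/-! ### Diagram lemmas in a Quillen exact category. -/

section Exact

variable {K : Type u} [Category.{v} K] [Preadditive K]

/-- `x ⟶ y ⟶ z` is an admissible short exact sequence. -/
def Conf (conf : ObjectProperty (ShortComplex K)) {x y z : K} (i : x ⟶ y) (p : y ⟶ z) : Prop :=
  ∃ h : i ≫ p = 0, conf (ShortComplex.mk i p h)

variable {conf : ObjectProperty (ShortComplex K)}

lemma IsInflation.exists_conf {x y : K} {i : x ⟶ y} (h : IsInflation conf i) :
    ∃ (z : K) (p : y ⟶ z), Conf conf i p := by
  obtain ⟨z, p, h, hc⟩ := h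
  exact ⟨z, p, h, hc⟩

lemma IsDeflation.exists_conf {y z : K} {p : y ⟶ z} (h : IsDeflation conf p) :
    ∃ (x : K) (i : x ⟶ y), Conf conf i p := by
  obtain ⟨z, p, h, hc⟩ := h
  exact ⟨z, p, h, hc⟩

namespace Conf

variable {x y z : K} {i : x ⟶ y} {p : y ⟶ z}

lemma isInflation (h : Conf conf i p) : IsInflation conf i := ⟨_, p, h.1, h.2⟩

lemma isDeflation (h : Conf conf i p) : IsDeflation conf p := ⟨_, i, h.1, h.2⟩

lemma _root_.Bicomplicial.conf_mk {S : ShortComplex K} (h : conf S) : Conf conf S.f S.g :=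
  ⟨S.zero, h⟩

end Conf

/-- The opposite class of short complexes. -/
def opConf (conf : ObjectProperty (ShortComplex K)) : ObjectProperty (ShortComplex Kᵒᵖ) :=
  fun S => conf S.unop

lemma Conf.op {x y z : K} {i : x ⟶ y} {p : y ⟶ z} (h : Conf conf i p) :
    Conf (opConf conf) p.op i.op :=
  ⟨by rw [← op_comp, h.1, op_zero], h.2⟩

lemma Conf.unop {x y z : Kᵒᵖ} {i : x ⟶ y} {p : y ⟶ z} (h : Conf (opConf conf) i p) :
    Conf conf p.unop i.unop :=
  ⟨by rw [← unop_comp, h.1, unop_zero], h.2⟩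

namespace IsExactStructure

variable (hE : IsExactStructure conf)
include hE

/-- The axioms are self-dual. Base change statements below are obtained by applying the cobase
change ones in the opposite category. -/
lemma op : IsExactStructure (opConf conf) where
  of_iso := by
    rintro S S' ⟨e⟩ h
    exact hE.of_iso ⟨ShortComplex.isoMk (ShortComplex.π₃.mapIso e).symm.unop
      (ShortComplex.π₂.mapIso e).symm.unop (ShortComplex.π₁.mapIso e).symm.unop
      (Quiver.Hom.op_inj e.inv.comm₂₃.symm) (Quiver.Hom.op_inj e.inv.comm₁₂.symm)⟩ h
  isKernel S h := by
    obtain ⟨hc⟩ := hE.isCokernel _ h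
    exact ⟨KernelFork.IsLimit.ofι _ _
      (fun k hk => (hc.desc (CokernelCofork.ofπ k.unop (by
        change (k ≫ S.g).unop = 0; rw [hk]; rfl))).op)
      (fun k hk => Quiver.Hom.unop_inj (hc.fac (CokernelCofork.ofπ k.unop _)
        WalkingParallelPair.one))
      (fun k hk m hm => Quiver.Hom.unop_inj (Cofork.IsColimit.hom_ext hc (by
        refine Eq.trans ?_ (hc.fac (CokernelCofork.ofπ k.unop _) WalkingParallelPair.one).symm
        exact congrArg Quiver.Hom.unop hm)))⟩
  isCokernel S h := by
    obtain ⟨hc⟩ := hE.isKernel _ h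
    exact ⟨CokernelCofork.IsColimit.ofπ _ _
      (fun k hk => (hc.lift (KernelFork.ofι k.unop (by
        change (S.f ≫ k).unop = 0; rw [hk]; rfl))).op)
      (fun k hk => Quiver.Hom.unop_inj (hc.fac (KernelFork.ofι k.unop _)
        WalkingParallelPair.zero))
      (fun k hk m hm => Quiver.Hom.unop_inj (Fork.IsLimit.hom_ext hc (by
        refine Eq.trans ?_ (hc.fac (KernelFork.ofι k.unop _) WalkingParallelPair.zero).symm
        exact congrArg Quiver.Hom.unop hm)))⟩
  inflation_id x := by
    obtain ⟨z, i, h⟩ := (hE.deflation_id x.unop).exists_conf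
    exact h.op.isInflation
  deflation_id x := by
    obtain ⟨z, i, h⟩ := (hE.inflation_id x.unop).exists_conf
    exact h.op.isDeflation
  inflation_comp i j hi hj := by
    obtain ⟨_, _, hi⟩ := hi.exists_conf
    obtain ⟨_, _, hj⟩ := hj.exists_conf
    obtain ⟨_, _, h⟩ := (hE.deflation_comp _ _ hj.unop.isDeflation hi.unop.isDeflation).exists_conf
    exact h.op.isInflation
  deflation_comp i j hi hj := by
    obtain ⟨_, _, hi⟩ := hi.exists_conf
    obtain ⟨_, _, hj⟩ := hj.exists_conf
    obtain ⟨_, _, h⟩ := (hE.inflation_comp _ _ hj.unop.isInflation hi.unop.isInflation).exists_conf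
    exact h.op.isDeflation
  inflation_pushout i f hi := by
    obtain ⟨_, _, hi⟩ := hi.exists_conf
    obtain ⟨y, f', i', sq, h⟩ := hE.deflation_pullback i.unop f.unop hi.unop.isDeflation
    obtain ⟨_, _, h⟩ := h.exists_conf
    exact ⟨_, f'.op, i'.op, sq.op.flip, h.op.isInflation⟩
  deflation_pullback i f hi := by
    obtain ⟨_, _, hi⟩ := hi.exists_conf
    obtain ⟨y, f', i', sq, h⟩ := hE.inflation_pushout i.unop f.unop hi.unop.isInflation
    obtain ⟨_, _, h⟩ := h.exists_conf
    exact ⟨_, f'.op, i'.op, sq.op.flip, h.op.isDeflation⟩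

lemma epi {x y z : K} {i : x ⟶ y} {p : y ⟶ z} (h : Conf conf i p) : Epi p := by
  obtain ⟨hc⟩ := hE.isCokernel _ h.2
  exact ⟨fun a b hab => Cofork.IsColimit.hom_ext hc hab⟩

lemma mono {x y z : K} {i : x ⟶ y} {p : y ⟶ z} (h : Conf conf i p) : Mono i := by
  obtain ⟨hc⟩ := hE.isKernel _ h.2
  exact ⟨fun a b hab => Fork.IsLimit.hom_ext hc hab⟩

lemma exists_desc {x y z t : K} {i : x ⟶ y} {p : y ⟶ z} (h : Conf conf i p) (k : y ⟶ t)
    (hk : i ≫ k = 0) : ∃ l : z ⟶ t, p ≫ l = k := by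
  obtain ⟨hc⟩ := hE.isCokernel _ h.2
  exact ⟨_, hc.fac (CokernelCofork.ofπ k hk) WalkingParallelPair.one⟩

lemma exists_lift {x y z t : K} {i : x ⟶ y} {p : y ⟶ z} (h : Conf conf i p) (k : t ⟶ y)
    (hk : k ≫ p = 0) : ∃ l : t ⟶ x, l ≫ i = k := by
  obtain ⟨hc⟩ := hE.isKernel _ h.2
  exact ⟨_, hc.fac (KernelFork.ofι k hk) WalkingParallelPair.zero⟩

lemma conf_of_iso {x y z x' y' z' : K} {i : x ⟶ y} {p : y ⟶ z} (h : Conf conf i p)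
    {i' : x' ⟶ y'} {p' : y' ⟶ z'} (e₁ : x ≅ x') (e₂ : y ≅ y') (e₃ : z ≅ z')
    (h₁ : e₁.hom ≫ i' = i ≫ e₂.hom) (h₂ : e₂.hom ≫ p' = p ≫ e₃.hom) : Conf conf i' p' := by
  have h0 : i' ≫ p' = 0 := by
    rw [← cancel_epi e₁.hom, ← Category.assoc, h₁, Category.assoc, h₂, ← Category.assoc, h.1]
    simp
  exact ⟨h0, hE.of_iso (S := ShortComplex.mk i p h.1) ⟨ShortComplex.isoMk e₁ e₂ e₃ h₁ h₂⟩ h.2⟩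

/-- A cokernel of an inflation completes it to an admissible short exact sequence. -/
lemma conf_of_isCokernel {x y z : K} {i : x ⟶ y} (hi : IsInflation conf i) {p : y ⟶ z}
    (h0 : i ≫ p = 0) (hp : Epi p) (hd : ∀ {t : K} (k : y ⟶ t), i ≫ k = 0 → ∃ l, p ≫ l = k) :
    Conf conf i p := by
  obtain ⟨c, q, h⟩ := hi.exists_conf
  have := hE.epi h
  obtain ⟨a, ha⟩ := hE.exists_desc h p h0
  obtain ⟨b, hb⟩ := hd q h.1
  refine hE.conf_of_iso h (Iso.refl _) (Iso.refl _)
    ⟨a, b, ?_, ?_⟩ (by simp) (by simpa using ha.symm)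
  · rw [← cancel_epi q, ← Category.assoc, ha, hb, Category.comp_id]
  · rw [← cancel_epi p, ← Category.assoc, hb, ha, Category.comp_id]

lemma conf_of_isKernel {x y z : K} {p : y ⟶ z} (hp : IsDeflation conf p) {i : x ⟶ y}
    (h0 : i ≫ p = 0) (hi : Mono i) (hd : ∀ {t : K} (k : t ⟶ y), k ≫ p = 0 → ∃ l, l ≫ i = k) :
    Conf conf i p := by
  obtain ⟨c, q, h⟩ := hp.exists_conf
  have := hE.mono h
  obtain ⟨a, ha⟩ := hE.exists_lift h i h0
  obtain ⟨b, hb⟩ := hd q h.1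
  refine hE.conf_of_iso h ⟨b, a, ?_, ?_⟩ (Iso.refl _) (Iso.refl _)
     (by simpa using hb) (by simp)
  · rw [← cancel_mono q, Category.assoc, ha, hb, Category.id_comp]
  · rw [← cancel_mono i, Category.assoc, hb, ha, Category.id_comp]

lemma conf_of_isIso {x y z : K} (i : x ⟶ y) [IsIso i] (hz : IsZero z) (p : y ⟶ z) :
    Conf conf i p := by
  obtain ⟨c, q, h⟩ := (hE.inflation_id x).exists_conf
  have hc : IsZero c := by
    have := hE.epi h
    have hq : q = 0 := by simpa using h.1
    rw [IsZero.iff_id_eq_zero, ← cancel_epi q, hq]; simp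
  exact hE.conf_of_iso h (Iso.refl _) (asIso i) (hc.iso hz) (by simp) (hz.eq_of_tgt _ _)

lemma conf_of_isIso' {x y z : K} (p : y ⟶ z) [IsIso p] (hx : IsZero x) (i : x ⟶ y) :
    Conf conf i p := by
  obtain ⟨c, q, h⟩ := (hE.deflation_id z).exists_conf
  have hc : IsZero c := by
    have := hE.mono h
    have hq : q = 0 := by simpa using h.1
    rw [IsZero.iff_id_eq_zero, ← cancel_mono q, hq]; simp
  exact hE.conf_of_iso h (hc.iso hx) (asIso p).symm (Iso.refl _) (hc.eq_of_src _ _) (by simp)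

/-- Cobase change of an admissible short exact sequence. -/
lemma conf_pushout {x y z x' y' : K} {i : x ⟶ y} {p : y ⟶ z} (h : Conf conf i p) {f : x ⟶ x'}
    {f' : y ⟶ y'} {i' : x' ⟶ y'} (sq : IsPushout i f f' i') {p' : y' ⟶ z} (h₁ : f' ≫ p' = p)
    (h₂ : i' ≫ p' = 0) : Conf conf i' p' := by
  have := hE.epi h
  refine hE.conf_of_isCokernel ?_ h₂ ⟨fun a b hab => ?_⟩ fun k hk => ?_
  · obtain ⟨y₁, f₁, i₁, sq₁, h₁⟩ := hE.inflation_pushout i f h.isInflation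
    obtain ⟨_, q, h₁⟩ := h₁.exists_conf
    let e := sq₁.isoIsPushout _ _ sq
    exact (hE.conf_of_iso h₁ (Iso.refl _) e (Iso.refl _) (i' := i') (p' := e.inv ≫ q)
      (by simp [e]) (by simp)).isInflation
  · rw [← cancel_epi p, ← h₁, Category.assoc, hab, Category.assoc]
  · obtain ⟨l, hl⟩ := hE.exists_desc h (f' ≫ k) (by
      rw [← Category.assoc, sq.w, Category.assoc, hk, comp_zero])
    refine ⟨l, sq.hom_ext ?_ ?_⟩
    · rw [← Category.assoc, h₁, hl]
    · rw [← Category.assoc, h₂, zero_comp, hk]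

lemma exists_pushout {x y z x' : K} {i : x ⟶ y} {p : y ⟶ z} (h : Conf conf i p) (f : x ⟶ x') :
    ∃ (y' : K) (f' : y ⟶ y') (i' : x' ⟶ y') (p' : y' ⟶ z), IsPushout i f f' i' ∧
      f' ≫ p' = p ∧ Conf conf i' p' := by
  obtain ⟨y', f', i', sq, -⟩ := hE.inflation_pushout i f h.isInflation
  have w : i ≫ p = f ≫ (0 : x' ⟶ z) := by rw [h.1, comp_zero]
  exact ⟨y', f', i', sq.desc p 0 w, sq, sq.inl_desc _ _ _,
    hE.conf_pushout h sq (sq.inl_desc _ _ _) (sq.inr_desc _ _ _)⟩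

/-- Base change of an admissible short exact sequence. -/
lemma conf_pullback {x y z z' y' : K} {i : x ⟶ y} {p : y ⟶ z} (h : Conf conf i p) {f : z' ⟶ z}
    {f' : y' ⟶ y} {p' : y' ⟶ z'} (sq : IsPullback f' p' p f) {i' : x ⟶ y'} (h₁ : i' ≫ f' = i)
    (h₂ : i' ≫ p' = 0) : Conf conf i' p' :=
  (hE.op.conf_pushout h.op (f := f.op) (f' := f'.op) (i' := p'.op) sq.op.flip
    (p' := i'.op) (congrArg Quiver.Hom.op h₁) (by rw [← op_comp, h₂, op_zero])).unop

lemma exists_pullback {x y z z' : K} {i : x ⟶ y} {p : y ⟶ z} (h : Conf conf i p) (f : z' ⟶ z) :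
    ∃ (y' : K) (f' : y' ⟶ y) (p' : y' ⟶ z') (i' : x ⟶ y'), IsPullback f' p' p f ∧
      i' ≫ f' = i ∧ Conf conf i' p' := by
  obtain ⟨y', f', i', sq, -⟩ := hE.deflation_pullback p f h.isDeflation
  have w : i ≫ p = (0 : x ⟶ z') ≫ f := by rw [h.1, zero_comp]
  exact ⟨y', f', i', sq.lift i 0 w, sq, sq.lift_fst _ _ _,
    hE.conf_pullback h sq (sq.lift_fst _ _ _) (sq.lift_snd _ _ _)⟩

/-- The short five lemma. -/
lemma isIso_of_conf {x a b z : K} {i₁ : x ⟶ a} {p₁ : a ⟶ z} {i₂ : x ⟶ b} {p₂ : b ⟶ z}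
    (h₁ : Conf conf i₁ p₁) (h₂ : Conf conf i₂ p₂) (φ : a ⟶ b) (hi : i₁ ≫ φ = i₂)
    (hp : φ ≫ p₂ = p₁) : IsIso φ := by
  -- In terms of elements, `R` consists of the pairs `(α, β)` with equal images in `z`. Then `β - φ
  -- α` lies in `x`, and the inverse of `φ` sends `β` to `α + (β - φ α)`, with the correction viewed
  -- in `a`; this is independent of `α`.
  obtain ⟨R, s, t, k, sq, hk, hR⟩ := hE.exists_pullback h₁ p₂
  have := hE.epi hR
  have := hE.mono h₂
  obtain ⟨ρ, hρ⟩ := hE.exists_lift h₂ (t - s ≫ φ) (by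
    rw [Preadditive.sub_comp, Category.assoc, hp, sq.w, sub_self])
  obtain ⟨ψ, hψ⟩ := hE.exists_desc hR (s + ρ ≫ i₁) (by
    have : k ≫ ρ = - 𝟙 x := by
      rw [← cancel_mono i₂, Category.assoc, hρ, Preadditive.comp_sub, hR.1, ← Category.assoc, hk,
        hi]
      simp
    rw [Preadditive.comp_add, hk, ← Category.assoc, this]
    simp)
  refine ⟨ψ, ?_, ?_⟩
  · have hσ := sq.lift_fst (𝟙 a) φ (by rw [Category.id_comp, hp])
    have hσ' := sq.lift_snd (𝟙 a) φ (by rw [Category.id_comp, hp])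
    set σ := sq.lift (𝟙 a) φ (by rw [Category.id_comp, hp])
    have h0 : σ ≫ ρ = 0 := by
      rw [← cancel_mono i₂, Category.assoc, hρ, Preadditive.comp_sub, hσ', ← Category.assoc, hσ]
      simp
    rw [← hσ', Category.assoc, hψ, Preadditive.comp_add, hσ, ← Category.assoc, h0]
    simp
  · rw [← cancel_epi t, ← Category.assoc, hψ, Preadditive.add_comp, Category.assoc, hi, hρ]
    simp

/-- The comparison map from the actual pushout is a morphism of conflations with identical ends, so
the short five lemma applies. -/
lemma isPushout_of_conf {x y z x' y' : K} {i : x ⟶ y} {p : y ⟶ z} (h : Conf conf i p)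
    {i' : x' ⟶ y'} {p' : y' ⟶ z} (h' : Conf conf i' p') (f : x ⟶ x') (g : y ⟶ y')
    (h₁ : i ≫ g = f ≫ i') (h₂ : g ≫ p' = p) : IsPushout i f g i' := by
  obtain ⟨P, f₁, i₁, p₁, sq, hf, h₁'⟩ := hE.exists_pushout h f
  have hφ := hE.isIso_of_conf h₁' h' (sq.desc g i' h₁) (sq.inr_desc _ _ _)
    (sq.hom_ext (by simp [h₂, hf]) (by simp [h'.1, h₁'.1]))
  exact IsPushout.of_iso sq (Iso.refl _) (Iso.refl _) (Iso.refl _) (asIso (sq.desc g i' h₁))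
    (by simp) (by simp) (by simp) (by simp)

lemma isPullback_of_conf {x y z z' y' : K} {i : x ⟶ y} {p : y ⟶ z} (h : Conf conf i p)
    {i' : x ⟶ y'} {p' : y' ⟶ z'} (h' : Conf conf i' p') (f : z' ⟶ z) (g : y' ⟶ y)
    (h₁ : g ≫ p = p' ≫ f) (h₂ : i' ≫ g = i) : IsPullback g p' p f :=
  (hE.op.isPushout_of_conf h.op h'.op f.op g.op (congrArg Quiver.Hom.op h₁)
    (congrArg Quiver.Hom.op h₂)).unop.flip

/-- Noether's isomorphism theorem. -/
lemma conf_noether {x y z a b c : K} {i : x ⟶ y} {p : y ⟶ a} {j : y ⟶ z} {q : z ⟶ b}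
    {r : z ⟶ c} (h₁ : Conf conf i p) (h₂ : Conf conf j q) (h₃ : Conf conf (i ≫ j) r)
    {s : a ⟶ c} {t : c ⟶ b} (hs : p ≫ s = j ≫ r) (ht : r ≫ t = q) : Conf conf s t := by
  have := hE.epi h₁
  have := hE.epi h₃
  have h0 (S : PushoutCocone j p) : (i ≫ j) ≫ S.inl = 0 := by
    rw [Category.assoc, S.condition, ← Category.assoc, h₁.1, zero_comp]
  -- `s` is the cobase change of `j` along `p`: a cocone on `j` and `p` is determined by a morphism
  -- from `z` which kills `i ≫ j`, and such a morphism factors through `r`.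
  refine hE.conf_pushout h₂ (f := p) (f' := r) ⟨⟨hs.symm⟩, ⟨PushoutCocone.IsColimit.mk _
    (fun S => (hE.exists_desc h₃ S.inl (h0 S)).choose)
    (fun S => (hE.exists_desc h₃ S.inl (h0 S)).choose_spec) (fun S => ?_) fun S m hm _ => ?_⟩⟩
    ht ?_
  · rw [← cancel_epi p, ← Category.assoc, hs, Category.assoc,
      (hE.exists_desc h₃ S.inl (h0 S)).choose_spec, S.condition]
  · rw [← cancel_epi r, (hE.exists_desc h₃ S.inl (h0 S)).choose_spec, hm]
  · rw [← cancel_epi p, ← Category.assoc, hs, Category.assoc, ht, h₂.1, comp_zero]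

/-- The base change of an inflation along a deflation is an inflation. -/
lemma conf_pullback_inflation {x y z z' y' w : K} {k : x ⟶ y} {p : y ⟶ z} (hp : Conf conf k p)
    {i : z' ⟶ z} {q : z ⟶ w} (hi : Conf conf i q) {a : y' ⟶ y} {b : y' ⟶ z'}
    (sq : IsPullback a b p i) : Conf conf a (p ≫ q) := by
  have := hE.mono hi
  refine hE.conf_of_isKernel (hE.deflation_comp _ _ hp.isDeflation hi.isDeflation) ?_
    ⟨fun u v huv => sq.hom_ext huv ?_⟩ fun k hk => ?_
  · rw [← Category.assoc, sq.w, Category.assoc, hi.1, comp_zero]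
  · rw [← cancel_mono i, Category.assoc, ← sq.w, ← Category.assoc, huv, Category.assoc, sq.w,
      Category.assoc]
  · obtain ⟨l, hl⟩ := hE.exists_lift hi (k ≫ p) (by rwa [Category.assoc])
    exact ⟨sq.lift k l hl.symm, sq.lift_fst _ _ _⟩

/-- The nine lemma, for the cokernels of a morphism of admissible short exact sequences. -/
lemma conf_nine {x₁ x₂ x₃ z₁ z₂ z₃ c₁ c₂ c₃ : K} {f : x₁ ⟶ x₂} {g : x₂ ⟶ x₃} {f' : z₁ ⟶ z₂}
    {g' : z₂ ⟶ z₃} {j₁ : x₁ ⟶ z₁} {j₂ : x₂ ⟶ z₂} {j₃ : x₃ ⟶ z₃} {q₁ : z₁ ⟶ c₁} {q₂ : z₂ ⟶ c₂}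
    {q₃ : z₃ ⟶ c₃} {s : c₁ ⟶ c₂} {t : c₂ ⟶ c₃} (hx : Conf conf f g) (hz : Conf conf f' g')
    (h₁ : Conf conf j₁ q₁) (h₂ : Conf conf j₂ q₂) (h₃ : Conf conf j₃ q₃)
    (e₁ : f ≫ j₂ = j₁ ≫ f') (e₂ : g ≫ j₃ = j₂ ≫ g') (e₃ : f' ≫ q₂ = q₁ ≫ s)
    (e₄ : g' ≫ q₃ = q₂ ≫ t) : Conf conf s t := by
  -- `j₂` is factored through the pullback `Q` of `g'` and `j₃`. The second factor `a` is a base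
  -- change of `j₃` with cokernel `c₃`; the first factor `n` is a cobase change of `j₁` with
  -- cokernel `c₁`. Noether's theorem for `n ≫ a` gives the sequence of cokernels.
  obtain ⟨Q, a, b, m, sq, hm, hQ⟩ := hE.exists_pullback hz j₃
  have ha := hE.conf_pullback_inflation hz h₃ sq
  have hn := sq.lift_fst j₂ g e₂.symm
  have hn' := sq.lift_snd j₂ g e₂.symm
  set n := sq.lift j₂ g e₂.symm
  have po := hE.isPushout_of_conf hx hQ j₁ n
    (sq.hom_ext (by rw [Category.assoc, hn, Category.assoc, hm, e₁])
      (by rw [Category.assoc, hn', Category.assoc, hQ.1, hx.1, comp_zero])) hn'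
  have w : f ≫ (0 : x₂ ⟶ c₁) = j₁ ≫ q₁ := by rw [h₁.1, comp_zero]
  have hr := po.inl_desc (0 : x₂ ⟶ c₁) q₁ w
  have hr' := po.inr_desc (0 : x₂ ⟶ c₁) q₁ w
  set r := po.desc (0 : x₂ ⟶ c₁) q₁ w
  have h₂' : Conf conf (n ≫ a) q₂ := by rwa [hn]
  refine hE.conf_noether (hE.conf_pushout h₁ po.flip hr' hr) ha h₂' (po.hom_ext ?_ ?_) e₄.symm
  · rw [← Category.assoc, hr, zero_comp, ← Category.assoc, h₂'.1]
  · rw [← Category.assoc, hr', ← Category.assoc, hm, e₃]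

variable [HasZeroObject K]

lemma conf_zero_left (x : K) : Conf conf (0 : (0 : K) ⟶ x) (𝟙 x) :=
  hE.conf_of_isIso' _ (isZero_zero _) _

lemma conf_zero_right (x : K) : Conf conf (𝟙 x) (0 : x ⟶ (0 : K)) :=
  hE.conf_of_isIso _ (isZero_zero _) _

variable [HasBinaryBiproducts K]

lemma conf_biprod (x y : K) : Conf conf (biprod.inl : x ⟶ x ⊞ y) biprod.snd :=
  hE.conf_pushout (hE.conf_zero_left y) (f := (0 : (0 : K) ⟶ x)) (f' := biprod.inr)
    (IsPushout.of_isColimit' ⟨by simp⟩ (PushoutCocone.IsColimit.mk _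
      (fun S => biprod.desc S.inr S.inl) (by simp) (by simp)
      (fun S m h₁ h₂ => biprod.hom_ext' _ _ (by simpa using h₂) (by simpa using h₁))))
    (by simp) (by simp)

lemma conf_biprod' (x y : K) : Conf conf (biprod.inr : y ⟶ x ⊞ y) biprod.fst :=
  hE.conf_of_iso (hE.conf_biprod y x) (Iso.refl _) (biprod.braiding y x) (Iso.refl _)
    (by ext <;> simp) (by simp)

lemma conf_of_split {x y z : K} {i : x ⟶ y} {p : y ⟶ z} (s : z ⟶ y) (r : y ⟶ x)
    (h₀ : i ≫ p = 0) (h₁ : i ≫ r = 𝟙 x) (h₂ : s ≫ p = 𝟙 z) (h₃ : r ≫ i + p ≫ s = 𝟙 y) :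
    Conf conf i p := by
  have h₄ : s ≫ r = 0 := by
    have := (ShortComplex.Splitting.mk (S := ShortComplex.mk i p h₀) r s h₁ h₂ h₃).s_r
    exact this
  exact hE.conf_of_iso (hE.conf_biprod x z) (Iso.refl _)
    ⟨biprod.desc i s, biprod.lift r p, by ext <;> simp [h₀, h₁, h₂, h₄], by simp [h₃]⟩
    (Iso.refl _) (by simp) (by simp only []; ext <;> simp [h₀, h₂])

omit [HasZeroObject K] in
/-- Direct sums of admissible short exact sequences. -/
lemma conf_biprod_map {x y z x' y' z' : K} {i : x ⟶ y} {p : y ⟶ z} {i' : x' ⟶ y'} {p' : y' ⟶ z'}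
    (h : Conf conf i p) (h' : Conf conf i' p') :
    Conf conf (biprod.map i i') (biprod.map p p') := by
  have := hE.epi h
  have := hE.epi h'
  -- A sum of inflations is a composite of sums with an identity, and `j ⊞ 𝟙` is the cobase change
  -- of `j` along the inclusion of `a`.
  have key {a b c : K} {j : a ⟶ b} {q : b ⟶ c} (hj : Conf conf j q) (d : K) :
      IsInflation conf (biprod.map j (𝟙 d)) :=
    (hE.conf_pushout hj (f := (biprod.inl : a ⟶ a ⊞ d)) (f' := biprod.inl)
      (p' := biprod.fst ≫ q) (IsPushout.of_isColimit' ⟨by simp⟩ (PushoutCocone.IsColimit.mk _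
        (fun S => biprod.desc S.inl (biprod.inr ≫ S.inr)) (by simp)
        (fun S => biprod.hom_ext' _ _ (by simpa using S.condition) (by simp))
        (fun S m h₁ h₂ => biprod.hom_ext' _ _ (by simpa using h₁) (by simp [← h₂])))) (by simp)
        (by ext <;> simp [hj.1])).isInflation
  refine hE.conf_of_isCokernel ?_ (by ext <;> simp [h.1, h'.1]) inferInstance fun k hk => ?_
  · obtain ⟨_, _, h₁⟩ := (key h x').exists_conf
    obtain ⟨_, _, h₂⟩ := (key h' y).exists_conf
    have h₃ := (hE.conf_of_iso h₂ (biprod.braiding _ _) (biprod.braiding _ _) (Iso.refl _)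
      (i' := biprod.map (𝟙 y) i') (p' := (biprod.braiding _ _).inv ≫ _) (by ext <;> simp)
      (by rw [Iso.hom_inv_id_assoc, Iso.refl_hom, Category.comp_id])).isInflation
    convert hE.inflation_comp _ _ h₁.isInflation h₃
    ext <;> simp
  · obtain ⟨l, hl⟩ := hE.exists_desc h (biprod.inl ≫ k) (by
      simpa using (biprod.inl : x ⟶ x ⊞ x') ≫= hk)
    obtain ⟨l', hl'⟩ := hE.exists_desc h' (biprod.inr ≫ k) (by
      simpa using (biprod.inr : x' ⟶ x ⊞ x') ≫= hk)
    exact ⟨biprod.desc l l', by ext <;> simp [hl, hl']⟩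

/-- `(i, f)` is the graph of `f`, which is a split inflation, followed by `i ⊞ 𝟙`. -/
lemma isInflation_lift {x y x' : K} {i : x ⟶ y} (h : IsInflation conf i) (f : x ⟶ x') :
    IsInflation conf (biprod.lift i f) := by
  obtain ⟨z, p, h⟩ := h.exists_conf
  have h₁ : Conf conf (biprod.lift (𝟙 x) f) (biprod.desc (-f) (𝟙 x')) :=
    hE.conf_of_split biprod.inr biprod.fst (by simp) (by simp) (by simp)
      (by ext <;> simp)
  have h₂ := hE.inflation_comp _ _ h₁.isInflation
    (hE.conf_biprod_map h (hE.conf_zero_right x')).isInflation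
  convert h₂
  ext <;> simp

lemma isDeflation_desc {y z z' : K} {p : y ⟶ z} (h : IsDeflation conf p) (f : z' ⟶ z) :
    IsDeflation conf (biprod.desc p f) := by
  obtain ⟨x, i, h⟩ := h.exists_conf
  have h₁ : Conf conf (biprod.lift (-f) (𝟙 z')) (biprod.desc (𝟙 z) f) :=
    hE.conf_of_split biprod.inl biprod.snd (by simp) (by simp) (by simp)
      (by ext <;> simp)
  have h₂ := hE.deflation_comp _ _
    (hE.conf_biprod_map h (hE.conf_zero_left z')).isDeflation h₁.isDeflation
  convert h₂
  ext <;> simp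

/-- The admissible short exact sequence of a pushout along an inflation. -/
lemma conf_of_isPushout {x y x' y' : K} {i : x ⟶ y} {f : x ⟶ x'} {f' : y ⟶ y'} {i' : x' ⟶ y'}
    (h : IsInflation conf i) (sq : IsPushout i f f' i') :
    Conf conf (biprod.lift i f) (biprod.desc f' (-i')) := by
  refine hE.conf_of_isCokernel (hE.isInflation_lift h f) (by simp [sq.w]) ⟨fun a b hab => ?_⟩
    fun k hk => ?_
  · exact sq.hom_ext (by simpa using biprod.inl ≫= hab) (by simpa using biprod.inr ≫= hab)
  · have w : i ≫ biprod.inl ≫ k = f ≫ (-(biprod.inr ≫ k)) := by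
      rw [biprod.lift_eq, Preadditive.add_comp] at hk
      simpa [eq_neg_iff_add_eq_zero] using hk
    exact ⟨sq.desc _ _ w, by ext <;> simp⟩

end IsExactStructure

end Exact
end Bicomplicial

end

/-! ### Calculus of cones, null classes and weak equivalences in a complicial exact category. -/

noncomputable section

namespace Bicomplicial

namespace ConeStructure

variable {K : Type u} [Category.{v} K] [Preadditive K] {𝓚 : ConeStructure K}

lemma homotopic_zero_iff {x y : K} {f : x ⟶ y} : 𝓚.Homotopic f 0 ↔ ∃ H, f = 𝓚.inc x ≫ H := by
  simp [Homotopic]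

lemma homotopic_iff_sub {x y : K} {f g : x ⟶ y} : 𝓚.Homotopic f g ↔ 𝓚.Homotopic (f - g) 0 := by
  simp [Homotopic]

lemma Homotopic.add_zero {x y : K} {f g : x ⟶ y} (hf : 𝓚.Homotopic f 0) (hg : 𝓚.Homotopic g 0) :
    𝓚.Homotopic (f + g) 0 := by
  rw [homotopic_zero_iff] at *
  obtain ⟨H, rfl⟩ := hf
  obtain ⟨H', rfl⟩ := hg
  exact ⟨H + H', by simp⟩

lemma Homotopic.neg_zero {x y : K} {f : x ⟶ y} (hf : 𝓚.Homotopic f 0) :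
    𝓚.Homotopic (-f) 0 := by
  rw [homotopic_zero_iff] at *
  obtain ⟨H, rfl⟩ := hf
  exact ⟨-H, by simp⟩

lemma Homotopic.comp_zero {x y z : K} {f : x ⟶ y} (hf : 𝓚.Homotopic f 0) (g : y ⟶ z) :
    𝓚.Homotopic (f ≫ g) 0 := by
  rw [homotopic_zero_iff] at *
  obtain ⟨H, rfl⟩ := hf
  exact ⟨H ≫ g, by simp⟩

lemma Homotopic.zero_comp {x y z : K} {f : x ⟶ y} (hf : 𝓚.Homotopic f 0) (g : z ⟶ x) :
    𝓚.Homotopic (g ≫ f) 0 := by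
  rw [homotopic_zero_iff] at *
  obtain ⟨H, rfl⟩ := hf
  exact ⟨𝓚.C.map g ≫ H, by rw [← Category.assoc, inc_naturality, Category.assoc]⟩

lemma homotopic_of_contractible {x y z : K} (hy : 𝓚.contractible y) (f : x ⟶ y) (g : y ⟶ z) :
    𝓚.Homotopic (f ≫ g) 0 := by
  have := Homotopic.zero_comp (Homotopic.comp_zero hy g) f
  rwa [Category.id_comp] at this

lemma contractible_of_isZero {x : K} (hx : IsZero x) : 𝓚.contractible x :=
  homotopic_zero_iff.2 ⟨0, hx.eq_of_src _ _⟩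

instance : Congruence 𝓚.Homotopic where
  equivalence := ⟨fun _ => ⟨0, by simp⟩, fun ⟨H, h⟩ => ⟨-H, by simp [← h]⟩,
    fun ⟨H, h⟩ ⟨H', h'⟩ => ⟨H + H', by simp [← h, ← h']⟩⟩
  comp_left f g g' h := by
    rw [homotopic_iff_sub, ← Preadditive.comp_sub]
    exact (homotopic_iff_sub.1 h).zero_comp f
  comp_right g h := by
    rw [homotopic_iff_sub, ← Preadditive.sub_comp]
    exact (homotopic_iff_sub.1 h).comp_zero g

variable (𝓚) in
/-- The properties of the admissible sequences and of the cone functor of a complicial exact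
category which are needed for the calculus of mapping cones. -/
structure IsComplicial : Prop where
  exact : IsExactStructure 𝓚.conflation
  inflation_inc : ∀ x : K, IsInflation 𝓚.conflation (𝓚.inc x)
  contractible_C : ∀ x : K, 𝓚.contractible (𝓚.C.obj x)
  map_conf : ∀ {x y z : K} {i : x ⟶ y} {p : y ⟶ z}, Conf 𝓚.conflation i p →
    Conf 𝓚.conflation (𝓚.C.map i) (𝓚.C.map p)
  exists_retraction : ∀ x : K, ∃ ρ : 𝓚.C.obj (𝓚.C.obj x) ⟶ 𝓚.C.obj x,
    𝓚.C.map (𝓚.inc x) ≫ ρ = 𝟙 _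

lemma IsNullClass.of_conf {N : ObjectProperty K} (h₀ : 𝓚.contractible ≤ N)
    (h₁ : ∀ {x y z : K} {i : x ⟶ y} {p : y ⟶ z}, Conf 𝓚.conflation i p → N y → N z → N x)
    (h₂ : ∀ {x y z : K} {i : x ⟶ y} {p : y ⟶ z}, Conf 𝓚.conflation i p → N x → N z → N y)
    (h₃ : ∀ {x y z : K} {i : x ⟶ y} {p : y ⟶ z}, Conf 𝓚.conflation i p → N x → N y → N z) :
    𝓚.IsNullClass N :=
  ⟨h₀, fun _ hS => h₃ (conf_mk hS), fun _ hS => h₂ (conf_mk hS), fun _ hS => h₁ (conf_mk hS)⟩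

section

variable {N : ObjectProperty K} (hN : 𝓚.IsNullClass N) {x y z : K} {i : x ⟶ y} {p : y ⟶ z}
include hN

lemma IsNullClass.left (h : Conf 𝓚.conflation i p) (hy : N y) (hz : N z) : N x :=
  hN.prop_X₁ _ h.2 hy hz

lemma IsNullClass.mid (h : Conf 𝓚.conflation i p) (hx : N x) (hz : N z) : N y :=
  hN.prop_X₂ _ h.2 hx hz

lemma IsNullClass.right (h : Conf 𝓚.conflation i p) (hx : N x) (hy : N y) : N z :=
  hN.prop_X₃ _ h.2 hx hy

lemma IsNullClass.of_iso (hK : IsExactStructure 𝓚.conflation) (e : x ≅ y) (hx : N x) : N y := by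
  obtain ⟨z, q, h⟩ := (hK.inflation_id x).exists_conf
  have hz : IsZero z := by
    have := hK.epi h
    have hq : q = 0 := by simpa using h.1
    rw [IsZero.iff_id_eq_zero, ← cancel_epi q, hq]; simp
  exact hN.mid (hK.conf_of_isIso e.hom hz 0) hx (hN.contractible_le _ (contractible_of_isZero hz))

end

namespace IsComplicial

variable (hK : 𝓚.IsComplicial)
include hK

lemma exists_cone {x y : K} (f : x ⟶ y) :
    ∃ (c : K) (j : 𝓚.C.obj x ⟶ c) (k : y ⟶ c), IsPushout (𝓚.inc x) f j k := by
  obtain ⟨c, j, k, sq, -⟩ := hK.exact.inflation_pushout _ f (hK.inflation_inc x)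
  exact ⟨c, j, k, sq⟩

/-- The cone of an inflation is an extension of the cokernel. -/
lemma conf_cone_of_conf {x y z c : K} {i : x ⟶ y} {p : y ⟶ z} (h : Conf 𝓚.conflation i p)
    {j : 𝓚.C.obj x ⟶ c} {k : y ⟶ c} (sq : IsPushout (𝓚.inc x) i j k) :
    ∃ q : c ⟶ z, k ≫ q = p ∧ Conf 𝓚.conflation j q := by
  have w : 𝓚.inc x ≫ (0 : 𝓚.C.obj x ⟶ z) = i ≫ p := by rw [h.1, Limits.comp_zero]
  exact ⟨sq.desc 0 p w, sq.inr_desc _ _ _,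
    hK.exact.conf_pushout h sq.flip (sq.inr_desc _ _ _) (sq.inl_desc _ _ _)⟩

/-- Here `t` is the suspension of `x`: the cone of `f` is an extension of it by `y`. -/
lemma conf_cone {x y c : K} {f : x ⟶ y} {j : 𝓚.C.obj x ⟶ c} {k : y ⟶ c}
    (sq : IsPushout (𝓚.inc x) f j k) : ∃ (t : K) (π : 𝓚.C.obj x ⟶ t) (q : c ⟶ t),
      j ≫ q = π ∧ Conf 𝓚.conflation (𝓚.inc x) π ∧ Conf 𝓚.conflation k q := by
  obtain ⟨t, π, h⟩ := (hK.inflation_inc x).exists_conf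
  have w : 𝓚.inc x ≫ π = f ≫ 0 := by rw [h.1, Limits.comp_zero]
  exact ⟨t, π, sq.desc π 0 w, sq.inl_desc _ _ _, h,
    hK.exact.conf_pushout h sq (sq.inl_desc _ _ _) (sq.inr_desc _ _ _)⟩

variable [HasZeroObject K] [HasBinaryBiproducts K]

/-- The mapping cone is exact. -/
lemma conf_cone_map {x₁ x₂ x₃ y₁ y₂ y₃ c₁ c₂ c₃ : K} {i : x₁ ⟶ x₂} {p : x₂ ⟶ x₃} {i' : y₁ ⟶ y₂}
    {p' : y₂ ⟶ y₃} (h : Conf 𝓚.conflation i p) (h' : Conf 𝓚.conflation i' p') {f₁ : x₁ ⟶ y₁}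
    {f₂ : x₂ ⟶ y₂} {f₃ : x₃ ⟶ y₃} (e₁ : i ≫ f₂ = f₁ ≫ i') (e₂ : p ≫ f₃ = f₂ ≫ p')
    {j₁ : 𝓚.C.obj x₁ ⟶ c₁} {k₁ : y₁ ⟶ c₁} (sq₁ : IsPushout (𝓚.inc x₁) f₁ j₁ k₁)
    {j₂ : 𝓚.C.obj x₂ ⟶ c₂} {k₂ : y₂ ⟶ c₂} (sq₂ : IsPushout (𝓚.inc x₂) f₂ j₂ k₂)
    {j₃ : 𝓚.C.obj x₃ ⟶ c₃} {k₃ : y₃ ⟶ c₃} (sq₃ : IsPushout (𝓚.inc x₃) f₃ j₃ k₃)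
    {s : c₁ ⟶ c₂} {t : c₂ ⟶ c₃} (hs₁ : j₁ ≫ s = 𝓚.C.map i ≫ j₂) (hs₂ : k₁ ≫ s = i' ≫ k₂)
    (ht₁ : j₂ ≫ t = 𝓚.C.map p ≫ j₃) (ht₂ : k₂ ≫ t = p' ≫ k₃) : Conf 𝓚.conflation s t :=
  -- A cone is the cokernel of the inflation `(ι, f) : x ⟶ C x ⊞ y`, so the nine lemma applies.
  hK.exact.conf_nine h (hK.exact.conf_biprod_map (hK.map_conf h) h')
    (hK.exact.conf_of_isPushout (hK.inflation_inc _) sq₁)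
    (hK.exact.conf_of_isPushout (hK.inflation_inc _) sq₂)
    (hK.exact.conf_of_isPushout (hK.inflation_inc _) sq₃)
    (by ext <;> simp [inc_naturality, e₁]) (by ext <;> simp [inc_naturality, e₂])
    (by ext <;> simp [hs₁, hs₂]) (by ext <;> simp [ht₁, ht₂])

omit [HasZeroObject K] [HasBinaryBiproducts K] hK in
lemma exists_cone_map {x₁ x₂ y₁ y₂ c₁ c₂ : K} {i : x₁ ⟶ x₂} {i' : y₁ ⟶ y₂} {f₁ : x₁ ⟶ y₁}
    {f₂ : x₂ ⟶ y₂} (e₁ : i ≫ f₂ = f₁ ≫ i')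
    {j₁ : 𝓚.C.obj x₁ ⟶ c₁} {k₁ : y₁ ⟶ c₁} (sq₁ : IsPushout (𝓚.inc x₁) f₁ j₁ k₁)
    {j₂ : 𝓚.C.obj x₂ ⟶ c₂} {k₂ : y₂ ⟶ c₂} (sq₂ : IsPushout (𝓚.inc x₂) f₂ j₂ k₂) :
    ∃ s : c₁ ⟶ c₂, j₁ ≫ s = 𝓚.C.map i ≫ j₂ ∧ k₁ ≫ s = i' ≫ k₂ := by
  have w : 𝓚.inc x₁ ≫ 𝓚.C.map i ≫ j₂ = f₁ ≫ i' ≫ k₂ := by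
    rw [← Category.assoc, ← inc_naturality, Category.assoc, sq₂.w, ← Category.assoc, e₁,
      Category.assoc]
  exact ⟨sq₁.desc _ _ w, sq₁.inl_desc _ _ _, sq₁.inr_desc _ _ _⟩

lemma exists_conf_cone_map {x₁ x₂ x₃ y₁ y₂ y₃ c₁ c₂ c₃ : K} {i : x₁ ⟶ x₂} {p : x₂ ⟶ x₃}
    {i' : y₁ ⟶ y₂}
    {p' : y₂ ⟶ y₃} (h : Conf 𝓚.conflation i p) (h' : Conf 𝓚.conflation i' p') {f₁ : x₁ ⟶ y₁}
    {f₂ : x₂ ⟶ y₂} {f₃ : x₃ ⟶ y₃} (e₁ : i ≫ f₂ = f₁ ≫ i') (e₂ : p ≫ f₃ = f₂ ≫ p')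
    {j₁ : 𝓚.C.obj x₁ ⟶ c₁} {k₁ : y₁ ⟶ c₁} (sq₁ : IsPushout (𝓚.inc x₁) f₁ j₁ k₁)
    {j₂ : 𝓚.C.obj x₂ ⟶ c₂} {k₂ : y₂ ⟶ c₂} (sq₂ : IsPushout (𝓚.inc x₂) f₂ j₂ k₂)
    {j₃ : 𝓚.C.obj x₃ ⟶ c₃} {k₃ : y₃ ⟶ c₃} (sq₃ : IsPushout (𝓚.inc x₃) f₃ j₃ k₃) :
    ∃ (s : c₁ ⟶ c₂) (t : c₂ ⟶ c₃), Conf 𝓚.conflation s t := by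
  obtain ⟨s, hs⟩ := exists_cone_map e₁ sq₁ sq₂
  obtain ⟨t, ht⟩ := exists_cone_map e₂ sq₂ sq₃
  exact ⟨s, t, hK.conf_cone_map h h' e₁ e₂ sq₁ sq₂ sq₃ hs.1 hs.2 ht.1 ht.2⟩

end IsComplicial

/-! ### Complicial weak equivalences and null classes -/

section

variable {w : MorphismProperty K}

lemma IsComplicialWeakEquivalences.ext (hw : 𝓚.IsComplicialWeakEquivalences w)
    {x₁ x₂ x₃ y₁ y₂ y₃ : K} {i : x₁ ⟶ x₂} {p : x₂ ⟶ x₃} {i' : y₁ ⟶ y₂}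
    {p' : y₂ ⟶ y₃} (h : Conf 𝓚.conflation i p) (h' : Conf 𝓚.conflation i' p') {f₁ : x₁ ⟶ y₁}
    {f₂ : x₂ ⟶ y₂} {f₃ : x₃ ⟶ y₃} (e₁ : i ≫ f₂ = f₁ ≫ i') (e₂ : p ≫ f₃ = f₂ ≫ p')
    (h₁ : w f₁) (h₃ : w f₃) : w f₂ :=
  hw.extensional (S := ShortComplex.mk i p h.1) (S' := ShortComplex.mk i' p' h'.1)
    ⟨f₁, f₂, f₃, e₁.symm, e₂.symm⟩ h.2 h'.2 h₁ h₃

lemma IsComplicialWeakEquivalences.of_isIso (hw : 𝓚.IsComplicialWeakEquivalences w) {x y : K}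
    (f : x ⟶ y) [IsIso f] : w f :=
  hw.homotopyEquivalences_le _ ⟨inv f, ⟨0, by simp⟩, ⟨0, by simp⟩⟩

variable (w) in
lemma IsComplicialWeakEquivalences.comp (hw : 𝓚.IsComplicialWeakEquivalences w) {x y z : K}
    {f : x ⟶ y} {g : y ⟶ z} (hf : w f) (hg : w g) : w (f ≫ g) :=
  have := hw.saturated
  w.comp_mem _ _ hf hg

lemma IsComplicialWeakEquivalences.of_postcomp (hw : 𝓚.IsComplicialWeakEquivalences w) {x y z : K}
    {f : x ⟶ y} {g : y ⟶ z} (hg : w g) (hfg : w (f ≫ g)) : w f :=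
  have := hw.saturated
  w.of_postcomp f g hg hfg

lemma IsComplicialWeakEquivalences.of_precomp (hw : 𝓚.IsComplicialWeakEquivalences w) {x y z : K}
    {f : x ⟶ y} {g : y ⟶ z} (hf : w f) (hfg : w (f ≫ g)) : w g :=
  have := hw.saturated
  w.of_precomp f g hf hfg

variable [HasZeroObject K]

lemma IsComplicialWeakEquivalences.trivial_of_contractible
    (hw : 𝓚.IsComplicialWeakEquivalences w) {x : K} (hx : 𝓚.contractible x) :
    trivialObjects w x := by
  refine hw.homotopyEquivalences_le _ ⟨0, ⟨0, (isZero_zero K).eq_of_src _ _⟩, ?_⟩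
  rw [homotopic_iff_sub]
  simpa using hx.neg_zero

lemma IsComplicialWeakEquivalences.of_trivial (hw : 𝓚.IsComplicialWeakEquivalences w) {x y : K}
    (hx : trivialObjects w x) (hy : trivialObjects w y) (f : x ⟶ y) : w f :=
  hw.of_precomp hx (show w (0 ≫ f) by rwa [Limits.zero_comp])

lemma IsComplicialWeakEquivalences.trivial_iff (hw : 𝓚.IsComplicialWeakEquivalences w) {x y : K}
    {f : x ⟶ y} (hf : w f) : trivialObjects w x ↔ trivialObjects w y := by
  refine ⟨fun h => ?_, fun h => hw.of_postcomp (g := f) hf ?_⟩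
  · have := IsComplicialWeakEquivalences.comp w hw h hf
    rwa [Limits.zero_comp] at this
  · rwa [Limits.zero_comp]

lemma IsComplicialWeakEquivalences.trivial_of_isZero (hw : 𝓚.IsComplicialWeakEquivalences w)
    {x : K} (hx : IsZero x) : trivialObjects w x :=
  hw.trivial_of_contractible (contractible_of_isZero hx)

variable (hK : 𝓚.IsComplicial) (hw : 𝓚.IsComplicialWeakEquivalences w)
include hK hw

/-- The extension axiom is applied to the morphism from `x ⟶ y ⟶ z` to `0 ⟶ z ⟶ z`. -/
lemma IsComplicial.weq_of_conf_right {x y z : K} {i : x ⟶ y} {p : y ⟶ z}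
    (h : Conf 𝓚.conflation i p) (hx : trivialObjects w x) : w p :=
  hw.ext h (hK.exact.conf_zero_left z) (f₁ := 0) (f₃ := 𝟙 z) (by simp [h.1]) (by simp)
    (hw.of_trivial hx (hw.trivial_of_isZero (isZero_zero K)) _) (hw.of_isIso _)

lemma IsComplicial.weq_of_conf_left {x y z : K} {i : x ⟶ y} {p : y ⟶ z}
    (h : Conf 𝓚.conflation i p) (hz : trivialObjects w z) : w i :=
  hw.ext (hK.exact.conf_zero_right x) h (f₁ := 𝟙 x) (f₃ := 0) (by simp) (by simp [h.1])
    (hw.of_isIso _) hz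

lemma IsComplicial.trivial_mid {x y z : K} {i : x ⟶ y} {p : y ⟶ z}
    (h : Conf 𝓚.conflation i p) (hx : trivialObjects w x) (hz : trivialObjects w z) :
    trivialObjects w y :=
  (hw.trivial_iff (hK.weq_of_conf_right hw h hx)).2 hz

lemma IsComplicial.trivial_right {x y z : K} {i : x ⟶ y} {p : y ⟶ z}
    (h : Conf 𝓚.conflation i p) (hx : trivialObjects w x) (hy : trivialObjects w y) :
    trivialObjects w z :=
  (hw.trivial_iff (hK.weq_of_conf_right hw h hx)).1 hy

variable [HasBinaryBiproducts K]

/-- This reduces questions on weak equivalences to trivial objects. If `f` is in `w`, then so is `j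
: C x ⟶ c`, by the extension axiom over the common quotient, the suspension of `x`. Conversely `f`
is the inflation `x ⟶ C x ⊞ y` with cokernel `c`, followed by a projection with kernel `C x`. -/
lemma IsComplicial.weq_iff_trivial_cone {x y c : K} {f : x ⟶ y} {j : 𝓚.C.obj x ⟶ c} {k : y ⟶ c}
    (sq : IsPushout (𝓚.inc x) f j k) : w f ↔ trivialObjects w c := by
  have hC := hw.trivial_of_contractible (hK.contractible_C x)
  constructor
  · intro hf
    obtain ⟨t, π, q, hq, h, h'⟩ := hK.conf_cone sq
    have : w j := hw.ext h h' (f₁ := f) (f₃ := 𝟙 t) sq.w (by simp [hq]) hf (hw.of_isIso _)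
    exact (hw.trivial_iff this).1 hC
  · intro hc
    have h := hK.exact.conf_of_isPushout (hK.inflation_inc _) sq
    have h₁ := hK.weq_of_conf_left hw h hc
    have h₂ := hK.weq_of_conf_right hw (hK.exact.conf_biprod (𝓚.C.obj x) y) hC
    have := IsComplicialWeakEquivalences.comp w hw h₁ h₂
    rwa [biprod.lift_snd] at this

/-- The cone of `i` is an extension of `z` by `C x`, hence trivial, so `i` is a weak equivalence. -/
lemma IsComplicial.trivial_left {x y z : K} {i : x ⟶ y} {p : y ⟶ z}
    (h : Conf 𝓚.conflation i p) (hy : trivialObjects w y) (hz : trivialObjects w z) :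
    trivialObjects w x := by
  obtain ⟨c, j, k, sq⟩ := hK.exists_cone i
  obtain ⟨q, -, h'⟩ := hK.conf_cone_of_conf h sq
  exact (hw.trivial_iff ((hK.weq_iff_trivial_cone hw sq).2 (hK.trivial_mid hw h'
    (hw.trivial_of_contractible (hK.contractible_C x)) hz))).2 hy

lemma IsComplicial.isNullClass_trivialObjects : 𝓚.IsNullClass (trivialObjects w) :=
  .of_conf (fun _ h => hw.trivial_of_contractible h) (fun h => hK.trivial_left hw h)
    (fun h => hK.trivial_mid hw h) (fun h => hK.trivial_right hw h)

variable {x₁ x₂ x₃ y₁ y₂ y₃ : K} {i : x₁ ⟶ x₂} {p : x₂ ⟶ x₃} {i' : y₁ ⟶ y₂}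
    {p' : y₂ ⟶ y₃} (h : Conf 𝓚.conflation i p) (h' : Conf 𝓚.conflation i' p') {f₁ : x₁ ⟶ y₁}
    {f₂ : x₂ ⟶ y₂} {f₃ : x₃ ⟶ y₃} (e₁ : i ≫ f₂ = f₁ ≫ i') (e₂ : p ≫ f₃ = f₂ ≫ p')
include h h' e₁ e₂

lemma IsComplicial.weq_right (h₁ : w f₁) (h₂ : w f₂) : w f₃ := by
  obtain ⟨c₁, j₁, k₁, sq₁⟩ := hK.exists_cone f₁
  obtain ⟨c₂, j₂, k₂, sq₂⟩ := hK.exists_cone f₂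
  obtain ⟨c₃, j₃, k₃, sq₃⟩ := hK.exists_cone f₃
  obtain ⟨s, t, hst⟩ := hK.exists_conf_cone_map h h' e₁ e₂ sq₁ sq₂ sq₃
  rw [hK.weq_iff_trivial_cone hw sq₁] at h₁
  rw [hK.weq_iff_trivial_cone hw sq₂] at h₂
  rw [hK.weq_iff_trivial_cone hw sq₃]
  exact hK.trivial_right hw hst h₁ h₂

lemma IsComplicial.weq_left (h₂ : w f₂) (h₃ : w f₃) : w f₁ := by
  obtain ⟨c₁, j₁, k₁, sq₁⟩ := hK.exists_cone f₁
  obtain ⟨c₂, j₂, k₂, sq₂⟩ := hK.exists_cone f₂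
  obtain ⟨c₃, j₃, k₃, sq₃⟩ := hK.exists_cone f₃
  obtain ⟨s, t, hst⟩ := hK.exists_conf_cone_map h h' e₁ e₂ sq₁ sq₂ sq₃
  rw [hK.weq_iff_trivial_cone hw sq₃] at h₃
  rw [hK.weq_iff_trivial_cone hw sq₂] at h₂
  rw [hK.weq_iff_trivial_cone hw sq₁]
  exact hK.trivial_left hw hst h₂ h₃

end

section

variable [HasZeroObject K] [HasBinaryBiproducts K]

/-- The cone of a homotopy equivalence is contractible. -/
lemma IsComplicial.contractible_of_homotopyEquivalence (hK : 𝓚.IsComplicial) {x y c : K}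
    {f : x ⟶ y} (hf : 𝓚.homotopyEquivalences f) {j : 𝓚.C.obj x ⟶ c} {k : y ⟶ c}
    (sq : IsPushout (𝓚.inc x) f j k) : 𝓚.contractible c := by
  obtain ⟨g, ⟨H, hH⟩, hg⟩ := hf
  have h := hK.exact.conf_of_isPushout (hK.inflation_inc _) sq
  have hp := hK.exact.epi h
  set ℓ := biprod.lift (𝓚.inc x) f
  set p := biprod.desc j (-k)
  -- Subtracting the homotopy `H` on `C x` turns the homotopy inverse `g` into a strict retraction
  -- of `ℓ`. So `c` is the direct factor cut out by `𝟙 - g' ≫ ℓ`, and it suffices that this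
  -- idempotent is null-homotopic.
  set g' : 𝓚.C.obj x ⊞ y ⟶ x := biprod.snd ≫ g - biprod.fst ≫ H with hg'
  have h₁ : ℓ ≫ g' = 𝟙 x := by simp [ℓ, g', ← hH]
  obtain ⟨s, hs⟩ := hK.exact.exists_desc h (𝟙 _ - g' ≫ ℓ) (by
    rw [Preadditive.comp_sub, ← Category.assoc, h₁]; simp)
  have hsp : s ≫ p = 𝟙 c := by
    rw [← cancel_epi p, ← Category.assoc, hs, Preadditive.sub_comp, Category.assoc, h.1]
    simp
  -- All terms factor through the contractible object `C x`, except one which contains `g ≫ f - 𝟙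
  -- y`.
  have hh : 𝓚.Homotopic (𝟙 _ - g' ≫ ℓ) 0 := by
    have hC := hK.contractible_C x
    have e : 𝟙 _ - g' ≫ ℓ = biprod.fst ≫ biprod.inl + (biprod.fst ≫ (H ≫ ℓ) +
        (-(biprod.snd ≫ g ≫ 𝓚.inc x) ≫ biprod.inl + (-(biprod.snd ≫ (g ≫ f - 𝟙 y) ≫ biprod.inr)))) :=
        by
      simp only [hg', ℓ, biprod.lift_eq]
      rw [← biprod.total]
      simp only [Preadditive.sub_comp, Preadditive.comp_add, Category.assoc,
        Preadditive.comp_sub, Category.id_comp]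
      abel
    rw [e]
    exact (homotopic_of_contractible hC _ _).add_zero ((homotopic_of_contractible hC _ _).add_zero
      ((homotopic_of_contractible hC (biprod.snd ≫ g ≫ 𝓚.inc x) biprod.inl).neg_zero.add_zero
      (((homotopic_iff_sub.1 hg).comp_zero _).zero_comp _).neg_zero))
  have : 𝟙 c = s ≫ (𝟙 _ - g' ≫ ℓ) ≫ p := by
    rw [← hs, Category.assoc, hsp, Category.comp_id, hsp]
  change 𝓚.Homotopic (𝟙 c) 0
  rw [this]
  exact (hh.comp_zero _).zero_comp _

/-- Homotopy equivalences need no separate check: such an `f` is the inflation `x ⟶ C x ⊞ y`, whose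
cokernel is contractible, followed by the projection with contractible kernel `C x`. -/
lemma IsComplicial.isComplicialWeakEquivalences_of (hK : 𝓚.IsComplicial)
    {w : MorphismProperty K} (h₁ : w.HasTwoOutOfThreeProperty)
    (h₂ : ∀ {S S' : ShortComplex K} (φ : S ⟶ S'), 𝓚.conflation S → 𝓚.conflation S' →
      w φ.τ₁ → w φ.τ₃ → w φ.τ₂) (h₃ : ∀ x : K, w (𝟙 x))
    (h₄ : ∀ x : K, 𝓚.contractible x → w (0 : (0 : K) ⟶ x)) :
    𝓚.IsComplicialWeakEquivalences w where
  saturated := h₁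
  extensional := h₂
  homotopyEquivalences_le x y f hf := by
    obtain ⟨c, j, k, sq⟩ := hK.exists_cone f
    have hc := h₄ _ (hK.contractible_of_homotopyEquivalence hf sq)
    have h := hK.exact.conf_of_isPushout (hK.inflation_inc _) sq
    have h' := hK.exact.conf_zero_right x
    have e₁ : w (biprod.lift (𝓚.inc x) f) := h₂ (S := .mk _ _ h'.1) (S' := .mk _ _ h.1)
      ⟨𝟙 x, biprod.lift (𝓚.inc x) f, 0, by simp, by simp [h.1]⟩ h'.2 h.2 (h₃ _) hc
    have hb := hK.exact.conf_biprod (𝓚.C.obj x) y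
    have hb' := hK.exact.conf_zero_left y
    have hC := h₄ _ (hK.contractible_C x)
    have e₂ : w (biprod.snd : 𝓚.C.obj x ⊞ y ⟶ y) := h₂ (S := .mk _ _ hb.1) (S' := .mk _ _ hb'.1)
      ⟨0, biprod.snd, 𝟙 y, by simp, by simp⟩ hb.2 hb'.2
      (w.of_precomp (0 : 0 ⟶ 𝓚.C.obj x) 0 hC (by
        rw [Limits.comp_zero, ← (isZero_zero K).eq_of_src (𝟙 _) 0]; exact h₃ _)) (h₃ _)
    have := w.comp_mem _ _ e₁ e₂
    rwa [biprod.lift_snd] at this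

end

/-! ### The Frobenius structure -/

lemma conf_frob_iff {x y z : K} {i : x ⟶ y} {p : y ⟶ z} : Conf 𝓚.frob.conflation i p ↔
    Conf 𝓚.conflation i p ∧ ∀ (u : K) (f : x ⟶ 𝓚.C.obj u), ∃ g, i ≫ g = f :=
  ⟨fun h => ⟨⟨h.1, h.2.1⟩, h.2.2⟩, fun h => ⟨h.1.1, h.1.2, h.2⟩⟩

variable (𝓚) in
/-- A complicial structure all of whose admissible sequences are Frobenius. -/
structure IsFrobenius : Prop extends 𝓚.IsComplicial where
  exists_extension : ∀ {x y z : K} {i : x ⟶ y} {p : y ⟶ z}, Conf 𝓚.conflation i p →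
    ∀ (u : K) (f : x ⟶ 𝓚.C.obj u), ∃ g, i ≫ g = f

lemma exists_extension_inc {x u : K} (hu : 𝓚.contractible (𝓚.C.obj u)) (f : x ⟶ 𝓚.C.obj u) :
    ∃ g, 𝓚.inc x ≫ g = f := by
  obtain ⟨H, hH⟩ := homotopic_zero_iff.1 hu
  exact ⟨𝓚.C.map f ≫ H, by
    rw [← Category.assoc, ← inc_naturality, Category.assoc, ← hH, Category.comp_id]⟩

lemma isExactStructure_frob (hK : IsExactStructure 𝓚.conflation) :
    IsExactStructure 𝓚.frob.conflation where
  of_iso := by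
    rintro S S' ⟨e⟩ h
    refine ⟨hK.of_iso ⟨e⟩ h.1, fun u f => ?_⟩
    obtain ⟨g, hg⟩ := h.2 u (e.hom.τ₁ ≫ f)
    exact ⟨e.inv.τ₂ ≫ g, by
      rw [← Category.assoc, ← e.inv.comm₁₂, Category.assoc, hg, ← Category.assoc,
        ← ShortComplex.comp_τ₁, e.inv_hom_id]
      simp⟩
  isKernel S h := hK.isKernel S h.1
  isCokernel S h := hK.isCokernel S h.1
  inflation_id x := by
    obtain ⟨z, p, h⟩ := (hK.inflation_id x).exists_conf
    exact (conf_frob_iff.2 ⟨h, fun u f => ⟨f, by simp⟩⟩).isInflation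
  deflation_id x := by
    obtain ⟨z, p, h⟩ := (hK.deflation_id x).exists_conf
    have hp : p = 0 := by simpa using h.1
    have := hK.mono h
    have hz : IsZero z := by rw [IsZero.iff_id_eq_zero, ← cancel_mono p, hp]; simp
    exact (conf_frob_iff.2 ⟨h, fun u f => ⟨0, hz.eq_of_src _ _⟩⟩).isDeflation
  inflation_comp i j hi hj := by
    obtain ⟨_, _, hi⟩ := hi.exists_conf
    obtain ⟨_, _, hj⟩ := hj.exists_conf
    rw [conf_frob_iff] at hi hj
    obtain ⟨_, _, h⟩ := (hK.inflation_comp _ _ hi.1.isInflation hj.1.isInflation).exists_conf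
    refine (conf_frob_iff.2 ⟨h, fun u f => ?_⟩).isInflation
    obtain ⟨g, rfl⟩ := hi.2 u f
    obtain ⟨g', rfl⟩ := hj.2 u g
    exact ⟨g', by simp⟩
  deflation_comp {x y z} p q hp hq := by
    obtain ⟨a, i, hp⟩ := hp.exists_conf
    obtain ⟨b, j, hq⟩ := hq.exists_conf
    rw [conf_frob_iff] at hp hq
    obtain ⟨c, k, h⟩ := (hK.deflation_comp _ _ hp.1.isDeflation hq.1.isDeflation).exists_conf
    refine (conf_frob_iff.2 ⟨h, fun u f => ?_⟩).isDeflation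
    have := hK.mono h
    obtain ⟨s, hs⟩ := hK.exists_lift h i (by rw [← Category.assoc, hp.1.1, Limits.zero_comp])
    obtain ⟨t, ht⟩ := hK.exists_lift hq.1 (k ≫ p) (by rw [Category.assoc, h.1])
    -- The kernel `c` of `p ≫ q` is an extension of `b` by `a`, by Noether's theorem in the opposite
    -- category. The restriction of `f` to `a` extends along `i`, and the remaining defect is a
    -- morphism on `b`, which extends along `j`.
    have hst : Conf 𝓚.conflation s t := by
      have sq := hK.op.conf_noether hq.1.op hp.1.op (r := k.op)
        (by rw [← op_comp]; exact h.op) (s := t.op) (t := s.op)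
        (congrArg Quiver.Hom.op ht) (congrArg Quiver.Hom.op hs)
      exact sq.unop
    obtain ⟨g, hg⟩ := hp.2 u (s ≫ f)
    obtain ⟨l, hl⟩ := hK.exists_desc hst (f - k ≫ g) (by
      rw [Preadditive.comp_sub, ← Category.assoc, hs, hg, sub_self])
    obtain ⟨m, hm⟩ := hq.2 u l
    exact ⟨g + p ≫ m, by
      rw [Preadditive.comp_add, ← Category.assoc k, ← ht, Category.assoc, hm, hl]; abel⟩
  inflation_pushout i f hi := by
    obtain ⟨_, _, hi⟩ := hi.exists_conf
    rw [conf_frob_iff] at hi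
    obtain ⟨y', f', i', p', sq, -, h⟩ := hK.exists_pushout hi.1 f
    refine ⟨y', f', i', sq, (conf_frob_iff.2 ⟨h, fun u a => ?_⟩).isInflation⟩
    obtain ⟨g, hg⟩ := hi.2 u (f ≫ a)
    exact ⟨sq.desc g a hg, sq.inr_desc _ _ _⟩
  deflation_pullback p f hp := by
    obtain ⟨_, _, hp⟩ := hp.exists_conf
    rw [conf_frob_iff] at hp
    obtain ⟨y', f', p', i', sq, hi, h⟩ := hK.exists_pullback hp.1 f
    refine ⟨y', f', p', sq, (conf_frob_iff.2 ⟨h, fun u a => ?_⟩).isDeflation⟩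
    obtain ⟨g, hg⟩ := hp.2 u a
    exact ⟨f' ≫ g, by rw [← Category.assoc, hi, hg]⟩

lemma IsComplicial.isFrobenius_frob (hK : 𝓚.IsComplicial) : 𝓚.frob.IsFrobenius where
  exact := isExactStructure_frob hK.exact
  inflation_inc x := by
    obtain ⟨z, p, h⟩ := (hK.inflation_inc x).exists_conf
    exact (conf_frob_iff.2 ⟨h, fun u f =>
      exists_extension_inc (hK.contractible_C u) f⟩).isInflation
  contractible_C := hK.contractible_C
  map_conf {x y z i p} h := by
    rw [conf_frob_iff] at h ⊢
    refine ⟨hK.map_conf h.1, fun u f => ?_⟩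
    -- Extending `ι_x` along `i` and applying `C` splits `C i`, because `C (ι_x)` has a retraction.
    -- Every morphism from `C x` then extends.
    obtain ⟨g, hg⟩ := h.2 x (𝓚.inc x)
    obtain ⟨ρ, hρ⟩ := hK.exists_retraction x
    have key (f : 𝓚.C.obj x ⟶ 𝓚.C.obj u) : 𝓚.C.map i ≫ 𝓚.C.map g ≫ ρ ≫ f = f := by
      rw [← Category.assoc, ← Functor.map_comp, hg, ← Category.assoc, hρ, Category.id_comp]
    exact ⟨_, key f⟩
  exists_retraction := hK.exists_retraction
  exists_extension h := (conf_frob_iff.1 h).2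

end ConeStructure
end Bicomplicial

end

/-! ### The degreewise exact structure on bounded complexes. -/

noncomputable section

namespace Bicomplicial

section Level

variable {E : Type u} [Category.{v} E] [Preadditive E] {conf : ObjectProperty (ShortComplex E)}

lemma conf_level_iff {x y z : Chb E} {f : x ⟶ y} {g : y ⟶ z} :
    Conf (levelConflation conf) f g ↔ ∀ i, Conf conf (f.hom.f i) (g.hom.f i) := by
  refine ⟨fun h i => ⟨_, h.2 i⟩, fun h => ⟨?_, fun i => (h i).2⟩⟩
  ext i
  exact (h i).1

lemma bounded_of_isZero {x y : CochainComplex E ℤ} (hx : bounded E x)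
    (h : ∀ i, IsZero (x.X i) → IsZero (y.X i)) : bounded E y := by
  obtain ⟨m, hm⟩ := hx
  exact ⟨m, fun i hi => h i (hm i hi)⟩

lemma bounded_of_isZero₂ {x x' y : CochainComplex E ℤ} (hx : bounded E x) (hx' : bounded E x')
    (h : ∀ i, IsZero (x.X i) → IsZero (x'.X i) → IsZero (y.X i)) : bounded E y := by
  obtain ⟨m, hm⟩ := hx
  obtain ⟨m', hm'⟩ := hx'
  exact ⟨max m m', fun i hi => h i (concentrated_mono (le_max_left _ _) hm i hi)
    (concentrated_mono (le_max_right _ _) hm' i hi)⟩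

/-- A degreewise pushout square of bounded complexes is a pushout square. -/
lemma isPushout_of_level {a b c d : Chb E} {f : a ⟶ b} {g : a ⟶ c} {h : b ⟶ d} {k : c ⟶ d}
    (sq : ∀ i, IsPushout (f.hom.f i) (g.hom.f i) (h.hom.f i) (k.hom.f i)) : IsPushout f g h k := by
  have hw (S : PushoutCocone f g) (i : ℤ) :
      f.hom.f i ≫ S.inl.hom.f i = g.hom.f i ≫ S.inr.hom.f i :=
    congrArg (fun φ => φ.hom.f i) S.condition
  refine ⟨⟨?_⟩, ⟨PushoutCocone.IsColimit.mk _ (fun S => ObjectProperty.homMk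
    { f := fun i => (sq i).desc (S.inl.hom.f i) (S.inr.hom.f i) (hw S i)
      comm' := fun i j _ => (sq i).hom_ext ?_ ?_ }) ?_ ?_ ?_⟩⟩
  · ext i
    exact (sq i).w
  · rw [← Category.assoc, (sq i).inl_desc, ← Category.assoc, h.hom.comm, Category.assoc,
      (sq j).inl_desc, S.inl.hom.comm]
  · rw [← Category.assoc, (sq i).inr_desc, ← Category.assoc, k.hom.comm, Category.assoc,
      (sq j).inr_desc, S.inr.hom.comm]
  · intro S
    ext i
    exact (sq i).inl_desc _ _ _
  · intro S
    ext i
    exact (sq i).inr_desc _ _ _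
  · intro S m h₁ h₂
    ext i
    refine (sq i).hom_ext ?_ ?_
    · exact (congrArg (fun φ => φ.hom.f i) h₁).trans ((sq i).inl_desc _ _ _).symm
    · exact (congrArg (fun φ => φ.hom.f i) h₂).trans ((sq i).inr_desc _ _ _).symm

lemma isPullback_of_level {a b c d : Chb E} {f : a ⟶ b} {g : a ⟶ c} {h : b ⟶ d} {k : c ⟶ d}
    (sq : ∀ i, IsPullback (f.hom.f i) (g.hom.f i) (h.hom.f i) (k.hom.f i)) :
    IsPullback f g h k := by
  have hw (S : PullbackCone h k) (i : ℤ) :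
      S.fst.hom.f i ≫ h.hom.f i = S.snd.hom.f i ≫ k.hom.f i :=
    congrArg (fun φ => φ.hom.f i) S.condition
  refine ⟨⟨?_⟩, ⟨PullbackCone.IsLimit.mk _ (fun S => ObjectProperty.homMk
    { f := fun i => (sq i).lift (S.fst.hom.f i) (S.snd.hom.f i) (hw S i)
      comm' := fun i j _ => (sq j).hom_ext ?_ ?_ }) ?_ ?_ ?_⟩⟩
  · ext i
    exact (sq i).w
  · rw [Category.assoc, ← f.hom.comm, ← Category.assoc, (sq i).lift_fst, Category.assoc,
      (sq j).lift_fst, S.fst.hom.comm]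
  · rw [Category.assoc, ← g.hom.comm, ← Category.assoc, (sq i).lift_snd, Category.assoc,
      (sq j).lift_snd, S.snd.hom.comm]
  · intro S
    ext i
    exact (sq i).lift_fst _ _ _
  · intro S
    ext i
    exact (sq i).lift_snd _ _ _
  · intro S m h₁ h₂
    ext i
    refine (sq i).hom_ext ?_ ?_
    · exact (congrArg (fun φ => φ.hom.f i) h₁).trans ((sq i).lift_fst _ _ _).symm
    · exact (congrArg (fun φ => φ.hom.f i) h₂).trans ((sq i).lift_snd _ _ _).symm

variable (hE : IsExactStructure conf)
include hE

/-- A chain map with degreewise conflations to given quotients has a cokernel. -/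
lemma exists_level_cokernel {x y : Chb E} (f : x ⟶ y) (Z : ℤ → E) (p : ∀ i, y.obj.X i ⟶ Z i)
    (h : ∀ i, Conf conf (f.hom.f i) (p i)) :
    ∃ (z : Chb E) (g : y ⟶ z), Conf (levelConflation conf) f g ∧ ∀ i, z.obj.X i = Z i := by
  have hp i := hE.epi (h i)
  have hd (i j : ℤ) : ∃ d : Z i ⟶ Z j, p i ≫ d = y.obj.d i j ≫ p j :=
    hE.exists_desc (h i) _ (by
      rw [← Category.assoc, f.hom.comm, Category.assoc, (h j).1, comp_zero])
  choose d hd using hd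
  let z : CochainComplex E ℤ :=
    { X := Z
      d := d
      shape := fun i j hij => by
        rw [← cancel_epi (p i), hd, y.obj.shape _ _ hij]; simp
      d_comp_d' := fun i j k _ _ => by
        rw [← cancel_epi (p i), ← Category.assoc, hd, Category.assoc, hd]; simp }
  have hz : bounded E z := bounded_of_isZero y.property fun i hi => by
    rw [IsZero.iff_id_eq_zero, ← cancel_epi (p i)]
    exact hi.eq_of_src _ _
  exact ⟨⟨z, hz⟩, ObjectProperty.homMk ⟨p, fun i j _ => hd i j⟩, conf_level_iff.2 h, fun _ => rfl⟩

lemma exists_level_kernel {x y : Chb E} (f : x ⟶ y) (Z : ℤ → E) (p : ∀ i, Z i ⟶ x.obj.X i)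
    (h : ∀ i, Conf conf (p i) (f.hom.f i)) :
    ∃ (z : Chb E) (g : z ⟶ x), Conf (levelConflation conf) g f ∧ ∀ i, z.obj.X i = Z i := by
  have hp i := hE.mono (h i)
  have hd (i j : ℤ) : ∃ d : Z i ⟶ Z j, d ≫ p j = p i ≫ x.obj.d i j :=
    hE.exists_lift (h j) _ (by
      rw [Category.assoc, ← f.hom.comm, ← Category.assoc, (h i).1, zero_comp])
  choose d hd using hd
  let z : CochainComplex E ℤ :=
    { X := Z
      d := d
      shape := fun i j hij => by
        rw [← cancel_mono (p j), hd, x.obj.shape _ _ hij]; simp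
      d_comp_d' := fun i j k _ _ => by
        rw [← cancel_mono (p k), Category.assoc, hd, ← Category.assoc, hd]; simp }
  have hz : bounded E z := bounded_of_isZero x.property fun i hi => by
    rw [IsZero.iff_id_eq_zero, ← cancel_mono (p i)]
    exact hi.eq_of_tgt _ _
  exact ⟨⟨z, hz⟩, ObjectProperty.homMk ⟨p, fun i j _ => (hd i j).symm⟩, conf_level_iff.2 h,
    fun _ => rfl⟩

/-- Cokernels chosen independently in each degree assemble to a complex by their universal property,
so no compatibility of the choices is needed. -/
lemma isInflation_level {x y : Chb E} {f : x ⟶ y} (h : ∀ i, IsInflation conf (f.hom.f i)) :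
    IsInflation (levelConflation conf) f := by
  choose Z p h using fun i => (h i).exists_conf
  obtain ⟨_, _, h, -⟩ := exists_level_cokernel hE f Z p h
  exact h.isInflation

lemma isDeflation_level {x y : Chb E} {f : x ⟶ y} (h : ∀ i, IsDeflation conf (f.hom.f i)) :
    IsDeflation (levelConflation conf) f := by
  choose Z p h using fun i => (h i).exists_conf
  obtain ⟨_, _, h, -⟩ := exists_level_kernel hE f Z p h
  exact h.isDeflation

omit hE in
lemma IsInflation.level {x y : Chb E} {f : x ⟶ y} (h : IsInflation (levelConflation conf) f)
    (i : ℤ) : IsInflation conf (f.hom.f i) := by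
  obtain ⟨_, _, h⟩ := h.exists_conf
  exact (conf_level_iff.1 h i).isInflation

omit hE in
lemma IsDeflation.level {x y : Chb E} {f : x ⟶ y} (h : IsDeflation (levelConflation conf) f)
    (i : ℤ) : IsDeflation conf (f.hom.f i) := by
  obtain ⟨_, _, h⟩ := h.exists_conf
  exact (conf_level_iff.1 h i).isDeflation

/-- The degreewise admissible sequences form an exact structure on the bounded complexes. -/
lemma isExactStructure_level : IsExactStructure (levelConflation conf) where
  of_iso := by
    rintro S S' ⟨e⟩ h i
    exact hE.of_iso ⟨(ShortComplex.mapNatIso _ (Iso.refl ((bounded E).ι ⋙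
      HomologicalComplex.eval E (ComplexShape.up ℤ) i))).symm ≪≫ (((bounded E).ι ⋙
      HomologicalComplex.eval E (ComplexShape.up ℤ) i).mapShortComplex.mapIso e)⟩ (h i)
  isKernel S h := by
    have h' := conf_level_iff.1 (conf_mk h)
    have hm i := hE.mono (h' i)
    have hl {t : Chb E} (k : t ⟶ S.X₂) (hk : k ≫ S.g = 0) (i : ℤ) :
        ∃ l, l ≫ S.f.hom.f i = k.hom.f i :=
      hE.exists_lift (h' i) (k.hom.f i) (congrArg (fun φ => φ.hom.f i) hk)
    choose l hl using @hl
    refine ⟨KernelFork.IsLimit.ofι _ _ (fun k hk => ObjectProperty.homMk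
      { f := l k hk
        comm' := fun i j _ => ?_ }) ?_ ?_⟩
    · rw [← cancel_mono (S.f.hom.f j), Category.assoc, Category.assoc, ← S.f.hom.comm,
        ← Category.assoc, hl, hl, k.hom.comm]
    · intro _ k hk
      ext i
      exact hl k hk i
    · intro _ k hk m hm
      ext i
      rw [← cancel_mono (S.f.hom.f i)]
      exact (congrArg (fun φ => φ.hom.f i) hm).trans (hl k hk i).symm
  isCokernel S h := by
    have h' := conf_level_iff.1 (conf_mk h)
    have hm i := hE.epi (h' i)
    have hl {t : Chb E} (k : S.X₂ ⟶ t) (hk : S.f ≫ k = 0) (i : ℤ) :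
        ∃ l, S.g.hom.f i ≫ l = k.hom.f i :=
      hE.exists_desc (h' i) (k.hom.f i) (congrArg (fun φ => φ.hom.f i) hk)
    choose l hl using @hl
    refine ⟨CokernelCofork.IsColimit.ofπ _ _ (fun k hk => ObjectProperty.homMk
      { f := l k hk
        comm' := fun i j _ => ?_ }) ?_ ?_⟩
    · rw [← cancel_epi (S.g.hom.f i), ← Category.assoc, hl, ← Category.assoc, S.g.hom.comm,
        Category.assoc, hl, k.hom.comm]
    · intro _ k hk
      ext i
      exact hl k hk i
    · intro _ k hk m hm
      ext i
      rw [← cancel_epi (S.g.hom.f i)]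
      exact (congrArg (fun φ => φ.hom.f i) hm).trans (hl k hk i).symm
  inflation_id x := isInflation_level hE fun i => hE.inflation_id _
  deflation_id x := isDeflation_level hE fun i => hE.deflation_id _
  inflation_comp f g hf hg := isInflation_level hE fun i =>
    hE.inflation_comp _ _ (hf.level i) (hg.level i)
  deflation_comp f g hf hg := isDeflation_level hE fun i =>
    hE.deflation_comp _ _ (hf.level i) (hg.level i)
  inflation_pushout {x y x'} f g hf := by
    choose Y a b sq hb using fun i => hE.inflation_pushout _ (g.hom.f i) (hf.level i)
    have hd (i j : ℤ) : f.hom.f i ≫ y.obj.d i j ≫ a j = g.hom.f i ≫ x'.obj.d i j ≫ b j := by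
      rw [← Category.assoc, f.hom.comm, Category.assoc, (sq j).w, ← Category.assoc,
        ← g.hom.comm, Category.assoc]
    let z : CochainComplex E ℤ :=
      { X := Y
        d := fun i j => (sq i).desc _ _ (hd i j)
        shape := fun i j hij => (sq i).hom_ext (by simp [y.obj.shape _ _ hij])
          (by simp [x'.obj.shape _ _ hij])
        d_comp_d' := fun i j k _ _ => (sq i).hom_ext (by simp) (by simp) }
    have hz : bounded E z := bounded_of_isZero₂ y.property x'.property fun i hi hi' => by
      rw [IsZero.iff_id_eq_zero]
      exact (sq i).hom_ext (hi.eq_of_src _ _) (hi'.eq_of_src _ _)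
    refine ⟨⟨z, hz⟩, ObjectProperty.homMk ⟨a, fun i j _ => (sq i).inl_desc _ _ _⟩,
      ObjectProperty.homMk ⟨b, fun i j _ => (sq i).inr_desc _ _ _⟩, isPushout_of_level sq,
      isInflation_level hE hb⟩
  deflation_pullback {y z z'} f g hf := by
    choose Y a b sq hb using fun i => hE.deflation_pullback _ (g.hom.f i) (hf.level i)
    have hd (i j : ℤ) : (a i ≫ y.obj.d i j) ≫ f.hom.f j = (b i ≫ z'.obj.d i j) ≫ g.hom.f j := by
      rw [Category.assoc, ← f.hom.comm, ← Category.assoc, (sq i).w, Category.assoc,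
        g.hom.comm, Category.assoc]
    let t : CochainComplex E ℤ :=
      { X := Y
        d := fun i j => (sq j).lift _ _ (hd i j)
        shape := fun i j hij => (sq j).hom_ext (by simp [y.obj.shape _ _ hij])
          (by simp [z'.obj.shape _ _ hij])
        d_comp_d' := fun i j k _ _ => (sq k).hom_ext (by simp) (by simp) }
    have ht : bounded E t := bounded_of_isZero₂ y.property z'.property fun i hi hi' => by
      rw [IsZero.iff_id_eq_zero]
      exact (sq i).hom_ext (hi.eq_of_tgt _ _) (hi'.eq_of_tgt _ _)
    refine ⟨⟨t, ht⟩, ObjectProperty.homMk ⟨a, fun i j _ => ((sq j).lift_fst _ _ _).symm⟩,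
      ObjectProperty.homMk ⟨b, fun i j _ => ((sq j).lift_snd _ _ _).symm⟩, isPullback_of_level sq,
      isDeflation_level hE hb⟩

end Level

instance {E : Type u} [Category.{v} E] [Preadditive E] [HasBinaryBiproducts E] :
    HasBinaryBiproducts (Chb E) where
  has_binary_biproduct x y := HasBinaryBiproduct.mk
    { bicone :=
        { pt := ⟨x.obj ⊞ y.obj, bounded_of_isZero₂ x.property y.property fun i hi hi' => by
            rw [IsZero.iff_id_eq_zero]
            refine (congrArg (fun φ => HomologicalComplex.Hom.f φ i)
              (biprod.total (X := x.obj) (Y := y.obj))).symm.trans ?_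
            rw [HomologicalComplex.add_f_apply, HomologicalComplex.comp_f,
              HomologicalComplex.comp_f,
              hi.eq_of_src ((biprod.inl : x.obj ⟶ x.obj ⊞ y.obj).f i) 0,
              hi'.eq_of_src ((biprod.inr : y.obj ⟶ x.obj ⊞ y.obj).f i) 0, comp_zero, comp_zero,
              add_zero]⟩
          fst := ObjectProperty.homMk biprod.fst
          snd := ObjectProperty.homMk biprod.snd
          inl := ObjectProperty.homMk biprod.inl
          inr := ObjectProperty.homMk biprod.inr
          inl_fst := by ext1; exact biprod.inl_fst
          inl_snd := by ext1; exact biprod.inl_snd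
          inr_fst := by ext1; exact biprod.inr_fst
          inr_snd := by ext1; exact biprod.inr_snd }
      isBilimit := isBinaryBilimitOfTotal _ (by ext1; exact biprod.total) }

end Bicomplicial

end

/-! ### The structures `𝔸` and `𝔹` are complicial, and each object is a suspension. -/

noncomputable section

namespace Bicomplicial

open ConeStructure CochainComplex CochainComplex.HomComplex

variable {E : Type u} [Category.{v} E] [Preadditive E]

namespace BicomplicialCategory

variable (𝓑 : BicomplicialCategory E)

lemma isComplicial : 𝓑.IsComplicial where
  exact := 𝓑.exact
  inflation_inc x := ⟨_, _, _, 𝓑.conflation_ι_π x⟩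
  contractible_C x := homotopic_zero_iff.2 ⟨𝓑.r.app x, (𝓑.ι_C_r x).symm⟩
  map_conf h := conf_mk (𝓑.C_exact _ h.2)
  exists_retraction x := ⟨_, 𝓑.map_ι_r x⟩

lemma isComplicial_structA : 𝓑.structA.IsComplicial where
  exact := isExactStructure_level 𝓑.exact
  inflation_inc x := isInflation_level 𝓑.exact fun i => 𝓑.isComplicial.inflation_inc _
  contractible_C x := homotopic_zero_iff.2 ⟨ObjectProperty.homMk
    ⟨fun i => 𝓑.r.app _, fun i j _ => (𝓑.r.naturality (x.obj.d i j)).symm⟩, by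
      ext i
      exact (𝓑.ι_C_r _).symm⟩
  map_conf h := conf_level_iff.2 fun i => 𝓑.isComplicial.map_conf (conf_level_iff.1 h i)
  exists_retraction x := ⟨ObjectProperty.homMk
    ⟨fun i => 𝓑.r.app _, fun i j _ => (𝓑.r.naturality (x.obj.d i j)).symm⟩, by
      ext i
      exact 𝓑.map_ι_r _⟩

/-- The inverse of `T` is applied in each degree. The resulting deflation from a contractible object
onto an arbitrary `y` serves to replace weak equivalences by spans of deflations. -/
lemma exists_desuspension_structA (y : Chb E) : ∃ (y' : Chb E) (q : 𝓑.structA.C.obj y' ⟶ y),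
    Conf 𝓑.structA.frob.conflation (𝓑.structA.inc y') q := by
  let y' : Chb E := ⟨(𝓑.T.inv.mapHomologicalComplex _).obj y.obj,
    bounded_of_isZero y.property fun i hi => 𝓑.T.inv.map_isZero hi⟩
  refine ⟨y', ObjectProperty.homMk
    { f := fun i => 𝓑.π.app _ ≫ 𝓑.T.asEquivalence.counitIso.hom.app (y.obj.X i)
      comm' := fun i j _ => ?_ }, conf_frob_iff.2 ⟨conf_level_iff.2 fun i => ?_, fun u f => ?_⟩⟩
  · have h := (Functor.whiskerLeft 𝓑.T.asEquivalence.inverse 𝓑.π ≫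
      𝓑.T.asEquivalence.counitIso.hom).naturality (y.obj.d i j)
    exact h.symm
  · exact 𝓑.exact.conf_of_iso (conf_mk (𝓑.conflation_ι_π (𝓑.T.inv.obj (y.obj.X i))))
      (Iso.refl _) (Iso.refl _) (𝓑.T.asEquivalence.counitIso.app (y.obj.X i))
      ((Category.id_comp _).trans (Category.comp_id _).symm) (Category.id_comp _)
  · exact exists_extension_inc (𝓑.isComplicial_structA.contractible_C u) f

end BicomplicialCategory

section StructB

variable [HasBinaryBiproducts E] {conf : ObjectProperty (ShortComplex E)}

/-- The terms of the mapping cone. -/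
def mappingConeXIso {x y : CochainComplex E ℤ} (f : x ⟶ y) (n : ℤ) :
    (mappingCone f).X n ≅ x.X (n + 1) ⊞ y.X n where
  hom := biprod.lift ((mappingCone.fst f).1.v n (n + 1) rfl) ((mappingCone.snd f).v n n (add_zero n))
  inv := biprod.desc ((mappingCone.inl f).v (n + 1) n (by omega)) ((mappingCone.inr f).f n)
  hom_inv_id := by simp [mappingCone.ext_from_iff f (n + 1) n rfl]
  inv_hom_id := by ext <;> simp

lemma mappingCone_inl_v_map {x y x' y' : CochainComplex E ℤ} (f : x ⟶ y) (f' : x' ⟶ y')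
    (a : x ⟶ x') (b : y ⟶ y') (h : f ≫ b = a ≫ f') (n m : ℤ) (hm : m + (-1) = n) :
    (mappingCone.inl f).v m n hm ≫ (mappingCone.map f f' a b h).f n =
      a.f m ≫ (mappingCone.inl f').v m n hm := by
  simp [mappingCone.map]

lemma mappingCone_inr_f_map {x y x' y' : CochainComplex E ℤ} (f : x ⟶ y) (f' : x' ⟶ y')
    (a : x ⟶ x') (b : y ⟶ y') (h : f ≫ b = a ≫ f') (n : ℤ) :
    (mappingCone.inr f).f n ≫ (mappingCone.map f f' a b h).f n =
      b.f n ≫ (mappingCone.inr f').f n := by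
  simp [mappingCone.map]

lemma mappingCone_inl_v_map_assoc {x y x' y' : CochainComplex E ℤ} (f : x ⟶ y) (f' : x' ⟶ y')
    (a : x ⟶ x') (b : y ⟶ y') (h : f ≫ b = a ≫ f') (n m : ℤ) (hm : m + (-1) = n) {z : E}
    (g : (mappingCone f').X n ⟶ z) :
    (mappingCone.inl f).v m n hm ≫ (mappingCone.map f f' a b h).f n ≫ g =
      a.f m ≫ (mappingCone.inl f').v m n hm ≫ g := by
  rw [← Category.assoc, mappingCone_inl_v_map, Category.assoc]

lemma mappingCone_inr_f_map_assoc {x y x' y' : CochainComplex E ℤ} (f : x ⟶ y) (f' : x' ⟶ y')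
    (a : x ⟶ x') (b : y ⟶ y') (h : f ≫ b = a ≫ f') (n : ℤ) {z : E}
    (g : (mappingCone f').X n ⟶ z) :
    (mappingCone.inr f).f n ≫ (mappingCone.map f f' a b h).f n ≫ g =
      b.f n ≫ (mappingCone.inr f').f n ≫ g := by
  rw [← Category.assoc, mappingCone_inr_f_map, Category.assoc]

lemma mappingConeXIso_inv_map {x y x' y' : CochainComplex E ℤ} (f : x ⟶ y) (f' : x' ⟶ y')
    (a : x ⟶ x') (b : y ⟶ y') (h : f ≫ b = a ≫ f') (n : ℤ) :
    (mappingConeXIso f n).inv ≫ (mappingCone.map f f' a b h).f n =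
      biprod.map (a.f (n + 1)) (b.f n) ≫ (mappingConeXIso f' n).inv := by
  apply biprod.hom_ext'
  · rw [mappingConeXIso, biprod.inl_desc_assoc, mappingCone_inl_v_map, biprod.inl_map_assoc,
      mappingConeXIso, biprod.inl_desc]
  · rw [mappingConeXIso, biprod.inr_desc_assoc, mappingCone_inr_f_map, biprod.inr_map_assoc,
      mappingConeXIso, biprod.inr_desc]

lemma exists_retraction_mappingCone_map {x y x' y' : CochainComplex E ℤ} (f : x ⟶ y) (f' : x' ⟶ y')
    (a : x ⟶ x') (b : y ⟶ y') (h : f ≫ b = a ≫ f') (ha : ∀ n, ∃ ρ, a.f n ≫ ρ = 𝟙 (x.X n))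
    (hb : ∀ n, ∃ ρ, b.f n ≫ ρ = 𝟙 (y.X n)) (n : ℤ) :
    ∃ ρ, (mappingCone.map f f' a b h).f n ≫ ρ = 𝟙 ((mappingCone f).X n) := by
  obtain ⟨ρ, h₁⟩ := hb n
  obtain ⟨ρ', h₂⟩ := ha (n + 1)
  refine ⟨(mappingConeXIso f' n).hom ≫ biprod.map ρ' ρ ≫ (mappingConeXIso f n).inv, ?_⟩
  rw [← cancel_epi (mappingConeXIso f n).inv, ← Category.assoc, mappingConeXIso_inv_map]
  simp only [Category.assoc, Iso.inv_hom_id_assoc, Category.comp_id]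
  have h₃ : biprod.map (a.f (n + 1)) (b.f n) ≫ biprod.map ρ' ρ = 𝟙 _ := by
    ext <;> simp [reassoc_of% h₁, reassoc_of% h₂]
  rw [← Category.assoc, h₃, Category.id_comp]

/-- Morphisms to a cone of an identity extend along degreewise split monomorphisms. -/
lemma exists_extension_mappingCone {a b u : CochainComplex E ℤ} (i : a ⟶ b)
    (hi : ∀ n, ∃ ρ, i.f n ≫ ρ = 𝟙 (a.X n)) (f : a ⟶ mappingCone (𝟙 u)) :
    ∃ g : b ⟶ mappingCone (𝟙 u), i ≫ g = f := by
  choose ρ hρ using hi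
  -- A morphism to the cone of `𝟙 u` amounts to its component `γ` in `u`, an arbitrary cochain of
  -- degree zero: the other component has to be `-δ γ`. So it suffices to extend `γ`, which the
  -- degreewise retractions do.
  let γ : Cochain a u 0 := (Cochain.ofHom f).comp (mappingCone.snd (𝟙 u)) (add_zero 0)
  let β : Cochain b u 0 := Cochain.ofHoms fun n => ρ n ≫ γ.v n n (add_zero n)
  have hβ : (Cochain.ofHom i).comp β (add_zero 0) = γ := by
    ext n
    simp [β, ← Category.assoc, hρ]
  let α : Cocycle b u 1 := Cocycle.mk (-δ 0 1 β) 2 rfl (by simp [δ_δ])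
  refine ⟨mappingCone.lift (𝟙 u) α β (by simp [α]), ?_⟩
  apply Cochain.ofHom_injective
  have h₁ : (Cochain.ofHom i).comp α.1 (zero_add 1) = - δ 0 1 γ := by
    rw [← hβ, δ_ofHom_comp]
    simp [α]
  have h₂ : δ 0 1 γ = - (Cochain.ofHom f).comp (mappingCone.fst (𝟙 u)).1 (zero_add 1) := by
    simp only [γ]
    rw [δ_ofHom_comp, mappingCone.δ_snd]
    simp
  rw [Cochain.ofHom_comp, mappingCone.ext_cochain_to_iff _ 0 1 rfl]
  constructor
  · rw [Cochain.comp_assoc_of_first_is_zero_cochain, mappingCone.lift_fst, h₁, h₂, neg_neg]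
  · rw [Cochain.comp_assoc_of_first_is_zero_cochain, mappingCone.lift_snd, hβ]

lemma exists_extension_cone {a b u : Chb E} (i : a ⟶ b)
    (hi : ∀ n, ∃ ρ, i.hom.f n ≫ ρ = 𝟙 (a.obj.X n)) (f : a ⟶ coneB (𝟙 u)) :
    ∃ g : b ⟶ coneB (𝟙 u), i ≫ g = f := by
  obtain ⟨g, hg⟩ := exists_extension_mappingCone i.hom hi f.hom
  exact ⟨ObjectProperty.homMk g, by ext1; exact hg⟩

/-- An extension of `ι_x` is followed by the degreewise projection from the cone of `𝟙 x` to `x`,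
which splits `ι_x` in each degree. -/
lemma exists_retraction_of_extension {x y : Chb E} {i : x ⟶ y}
    (h : ∃ g : y ⟶ (structB conf).C.obj x, i ≫ g = (structB conf).inc x) (n : ℤ) :
    ∃ ρ, i.hom.f n ≫ ρ = 𝟙 (x.obj.X n) := by
  obtain ⟨g, hg⟩ := h
  refine ⟨g.hom.f n ≫ (mappingCone.snd (𝟙 x.obj)).v n n (add_zero n), ?_⟩
  have h₁ : i.hom.f n ≫ g.hom.f n = (mappingCone.inr (𝟙 x.obj)).f n :=
    congrArg (fun φ => φ.hom.f n) hg
  have h₂ := mappingCone.inr_f_snd_v (𝟙 x.obj) n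
  rw [← h₁] at h₂
  exact (Category.assoc _ _ _).symm.trans h₂

lemma exists_retraction_inc (x : Chb E) (n : ℤ) :
    ∃ ρ, ((structB conf).inc x).hom.f n ≫ ρ = 𝟙 (x.obj.X n) :=
  exists_retraction_of_extension ⟨𝟙 _, Category.comp_id _⟩ n

/-- The Frobenius admissible sequences of `𝔹` are the degreewise split ones. -/
lemma conf_frob_structB_iff {x y z : Chb E} {i : x ⟶ y} {p : y ⟶ z} :
    Conf (structB conf).frob.conflation i p ↔ Conf (levelConflation conf) i p ∧
      ∀ n, ∃ ρ, i.hom.f n ≫ ρ = 𝟙 (x.obj.X n) := by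
  rw [conf_frob_iff]
  refine and_congr_right fun h => ⟨fun h' n => ?_, fun h' u f => exists_extension_cone i h' f⟩
  exact exists_retraction_of_extension (h' x _) n

variable (hE : IsExactStructure conf)
include hE

lemma conf_mappingCone [HasZeroObject E] {x y : CochainComplex E ℤ} (f : x ⟶ y) (n : ℤ) :
    Conf conf ((mappingCone.inr f).f n) ((mappingCone.fst f).1.v n (n + 1) rfl) :=
  hE.conf_of_split ((mappingCone.inl f).v (n + 1) n (by omega))
    ((mappingCone.snd f).v n n (add_zero n)) (by simp) (by simp) (by simp)
    (by simp [mappingCone.ext_from_iff f (n + 1) n rfl])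

/-- No formula for a multiplication `C C ⟶ C` is needed: both `ι_{C x}` and `C (ι_x)` are degreewise
split, so the identity of `C x` extends along each of them. -/
lemma isComplicial_structB [HasZeroObject E] : (structB conf).IsComplicial where
  exact := isExactStructure_level hE
  inflation_inc x := isInflation_level hE fun n => (conf_mappingCone hE _ n).isInflation
  contractible_C x := by
    obtain ⟨g, hg⟩ := exists_extension_cone ((structB conf).inc ((structB conf).C.obj x))
      (exists_retraction_inc _) (𝟙 ((structB conf).C.obj x))
    exact homotopic_zero_iff.2 ⟨g, hg.symm⟩
  map_conf {x y z i p} h := conf_level_iff.2 fun n => by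
    have h := conf_level_iff.1 h
    refine hE.conf_of_iso (hE.conf_biprod_map (h (n + 1)) (h n)) (mappingConeXIso _ n).symm
      (mappingConeXIso _ n).symm (mappingConeXIso _ n).symm
      (mappingConeXIso_inv_map _ _ _ _ (by simp) n) (mappingConeXIso_inv_map _ _ _ _ (by simp) n)
  exists_retraction x := by
    obtain ⟨g, hg⟩ := exists_extension_cone ((structB conf).C.map ((structB conf).inc x))
      (exists_retraction_mappingCone_map _ _ _ _
        ((Category.id_comp _).trans (Category.comp_id _).symm) (exists_retraction_inc x)
        (exists_retraction_inc x)) (𝟙 ((structB conf).C.obj x))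
    exact ⟨g, hg⟩

omit hE in
lemma isPushout_mappingCone_f {x y : CochainComplex E ℤ} (f : x ⟶ y) (n : ℤ) :
    IsPushout ((mappingCone.inr (𝟙 x)).f n) (f.f n)
      ((mappingCone.map (𝟙 x) f (𝟙 x) f (by simp)).f n) ((mappingCone.inr f).f n) := by
  refine ⟨⟨mappingCone_inr_f_map _ _ _ _ _ n⟩, ⟨PushoutCocone.IsColimit.mk _ (fun S =>
    (mappingCone.fst f).1.v n (n + 1) rfl ≫ (mappingCone.inl (𝟙 x)).v (n + 1) n (by omega) ≫
      S.inl + (mappingCone.snd f).v n n (add_zero n) ≫ S.inr) ?_ ?_ ?_⟩⟩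
  · intro S
    rw [mappingCone.ext_from_iff _ (n + 1) n rfl]
    constructor
    · rw [mappingCone_inl_v_map_assoc]
      simp
    · rw [mappingCone_inr_f_map_assoc]
      simp [S.condition]
  · intro S
    simp
  · intro S m h₁ h₂
    rw [mappingCone.ext_from_iff _ (n + 1) n rfl]
    constructor
    · rw [← h₁, mappingCone_inl_v_map_assoc]
      simp
    · simpa using h₂

omit hE in
/-- The mapping cone of chain maps is the cone with respect to `𝔹`. -/
lemma isPushout_coneB {x y : Chb E} (f : x ⟶ y) : IsPushout ((structB conf).inc x) f
    (ObjectProperty.homMk (mappingCone.map (𝟙 x.obj) f.hom (𝟙 x.obj) f.hom (by simp)) :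
      (structB conf).C.obj x ⟶ coneB f) (ObjectProperty.homMk (mappingCone.inr f.hom)) :=
  isPushout_of_level fun n => isPushout_mappingCone_f f.hom n

omit hE [HasBinaryBiproducts E] in
lemma bounded_shift {x : CochainComplex E ℤ} (hx : bounded E x) (n : ℤ) : bounded E (x⟦n⟧) := by
  obtain ⟨m, hm⟩ := hx
  exact ⟨m + n.natAbs, fun i hi => hm (i + n) (by grind)⟩

/-- The shift of bounded complexes. -/
def shiftB {E : Type u} [Category.{v} E] [Preadditive E] (n : ℤ) (x : Chb E) : Chb E :=
  ⟨x.obj⟦n⟧, bounded_shift x.property n⟩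

/-- The projection from the mapping cone to the suspension. -/
def coneBProj {x y : Chb E} (f : x ⟶ y) : coneB f ⟶ shiftB 1 x :=
  ObjectProperty.homMk (mappingCone.triangle f.hom).mor₃

lemma conf_coneB [HasZeroObject E] {x y : Chb E} (f : x ⟶ y) :
    Conf (structB conf).frob.conflation (ObjectProperty.homMk (mappingCone.inr f.hom) : y ⟶ coneB f)
      (coneBProj f) := by
  let s := mappingCone.triangleRotateShortComplexSplitting f.hom
  exact conf_frob_structB_iff.2 ⟨conf_level_iff.2 fun n =>
    hE.conf_of_split (s n).s (s n).r ((mappingCone.triangleRotateShortComplex f.hom).map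
      (HomologicalComplex.eval _ _ n)).zero (s n).f_r (s n).s_g (s n).id,
    fun n => ⟨(s n).r, (s n).f_r⟩⟩

lemma conf_inc_structB [HasZeroObject E] (x : Chb E) :
    Conf (structB conf).frob.conflation ((structB conf).inc x) (coneBProj (𝟙 x)) :=
  conf_coneB hE (𝟙 x)

lemma exists_desuspension_structB [HasZeroObject E] (y : Chb E) :
    ∃ (y' : Chb E) (q : (structB conf).C.obj y' ⟶ y),
      Conf (structB conf).frob.conflation ((structB conf).inc y') q := by
  refine ⟨shiftB (-1) y, coneBProj (𝟙 _) ≫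
    ObjectProperty.homMk ((shiftFunctorCompIsoId _ (-1 : ℤ) 1 (by simp)).hom.app y.obj), ?_⟩
  exact (isExactStructure_frob (isExactStructure_level hE)).conf_of_iso (conf_inc_structB hE _)
    (Iso.refl _) (Iso.refl _) ((bounded E).isoMk
      ((shiftFunctorCompIsoId _ (-1 : ℤ) 1 (by simp)).app y.obj))
    ((Category.id_comp _).trans (Category.comp_id _).symm) (Category.id_comp _)

end StructB

end Bicomplicial

end

/-! ### Total objects: exactness, one-term complexes and strictly acyclic complexes. -/

noncomputable section

namespace Bicomplicial

set_option linter.unusedSectionVars false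

open ConeStructure CochainComplex CochainComplex.HomComplex

variable {E : Type u} [Category.{v} E] [Preadditive E] [HasZeroObject E] [HasBinaryBiproducts E]

/-- Functoriality of cones with respect to weak equivalences. -/
lemma ConeStructure.IsComplicial.weq_cone_map {𝓚 : ConeStructure E} {w : MorphismProperty E}
    (hK : 𝓚.IsComplicial) (hw : 𝓚.IsComplicialWeakEquivalences w) {x₁ x₂ y₁ y₂ c₁ c₂ : E}
    {a : x₁ ⟶ x₂} {b : y₁ ⟶ y₂} {f₁ : x₁ ⟶ y₁} {f₂ : x₂ ⟶ y₂} (e : a ≫ f₂ = f₁ ≫ b)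
    {j₁ : 𝓚.C.obj x₁ ⟶ c₁} {k₁ : y₁ ⟶ c₁} (sq₁ : IsPushout (𝓚.inc x₁) f₁ j₁ k₁)
    {j₂ : 𝓚.C.obj x₂ ⟶ c₂} {k₂ : y₂ ⟶ c₂} (sq₂ : IsPushout (𝓚.inc x₂) f₂ j₂ k₂)
    {s : c₁ ⟶ c₂} (hj : j₁ ≫ s = 𝓚.C.map a ≫ j₂) (hk : k₁ ≫ s = b ≫ k₂) (ha : w a) (hb : w b) :
    w s := by
  -- The cones are the quotients of `C x ⊞ y` by `x`, and `C a` is a weak equivalence between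
  -- contractible objects.
  have hC : w (𝓚.C.map a) := hw.of_trivial (hw.trivial_of_contractible (hK.contractible_C _))
    (hw.trivial_of_contractible (hK.contractible_C _)) _
  have hCb : w (biprod.map (𝓚.C.map a) b) :=
    hw.ext (hK.exact.conf_biprod _ _) (hK.exact.conf_biprod _ _) (by simp) (by simp) hC hb
  exact hK.weq_right hw (hK.exact.conf_of_isPushout (hK.inflation_inc _) sq₁)
    (hK.exact.conf_of_isPushout (hK.inflation_inc _) sq₂) (f₁ := a) (f₂ := biprod.map (𝓚.C.map a) b)
    (by ext <;> simp [e, 𝓚.inc_naturality]) (by ext <;> simp [hj, hk]) ha hCb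

namespace BicomplicialCategory

variable (𝓑 : BicomplicialCategory E)

lemma isPushout_cone {x y : E} (f : x ⟶ y) :
    IsPushout (𝓑.inc x) f (𝓑.coneInl f) (𝓑.coneInr f) :=
  IsPushout.of_hasPushout _ _

lemma conf_inc (x : E) : Conf 𝓑.conflation (𝓑.inc x) (𝓑.π.app x) :=
  conf_mk (𝓑.conflation_ι_π x)

lemma conf_coneInr {x y : E} (f : x ⟶ y) :
    Conf 𝓑.conflation (𝓑.coneInr f) (𝓑.coneProj f) :=
  𝓑.exact.conf_pushout (𝓑.conf_inc x) (𝓑.isPushout_cone f) (𝓑.coneInl_desc _ _ _ _)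
    (𝓑.coneInr_desc _ _ _ _)

/-- A partial total object is an iterated cone, and forming cones is exact. -/
lemma conf_partialTotal {x y z : CochainComplex E ℤ} {f : x ⟶ y} {g : y ⟶ z}
    (h : ∀ i, Conf 𝓑.conflation (f.f i) (g.f i)) (n : ℕ) (b : ℤ) :
    Conf 𝓑.conflation ((𝓑.partialTotal n b).map f) ((𝓑.partialTotal n b).map g) := by
  induction n generalizing b with
  | zero => exact h b
  | succ n ih =>
    have e₁ := (𝓑.partialTotal n (b - 1)).g_naturality f b
    have e₂ := (𝓑.partialTotal n (b - 1)).g_naturality g b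
    exact 𝓑.isComplicial.conf_cone_map (ih (b - 1)) (h b) e₁ e₂
      (𝓑.isPushout_cone _) (𝓑.isPushout_cone _) (𝓑.isPushout_cone _)
      (𝓑.coneInl_map _ _ _ _ e₁) (𝓑.coneInr_map _ _ _ _ e₁)
      (𝓑.coneInl_map _ _ _ _ e₂) (𝓑.coneInr_map _ _ _ _ e₂)

lemma isZero_partialTotal {x : CochainComplex E ℤ} (n : ℕ) (b : ℤ)
    (hx : ∀ i ≤ b, IsZero (x.X i)) : IsZero ((𝓑.partialTotal n b).obj x) := by
  induction n generalizing b with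
  | zero => exact hx b le_rfl
  | succ n ih =>
    rw [IsZero.iff_id_eq_zero]
    exact 𝓑.cone_hom_ext
      ((𝓑.C.map_isZero (ih (b - 1) fun i hi => hx i (by omega))).eq_of_src _ _)
      ((hx b le_rfl).eq_of_src _ _)

variable {𝓑} {w : MorphismProperty E} (hw : 𝓑.IsComplicialWeakEquivalences w)
include hw

lemma weq_partialTotal {x y : CochainComplex E ℤ} {f : x ⟶ y} (h : ∀ i, w (f.f i)) (n : ℕ)
    (b : ℤ) : w ((𝓑.partialTotal n b).map f) := by
  induction n generalizing b with
  | zero => exact h b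
  | succ n ih =>
    have e := (𝓑.partialTotal n (b - 1)).g_naturality f b
    exact 𝓑.isComplicial.weq_cone_map hw e
      (𝓑.isPushout_cone _) (𝓑.isPushout_cone _) (𝓑.coneInl_map _ _ _ _ e)
      (𝓑.coneInr_map _ _ _ _ e) (ih (b - 1)) (h b)

/-- In the morphism of conflations `x ⟶ C x ⟶ T x` induced by `f`, the middle component is a map of
contractible objects. -/
lemma weq_T_map_iff {x y : E} {f : x ⟶ y} : w (𝓑.T.map f) ↔ w f := by
  have hC : w (𝓑.C.map f) := hw.of_trivial
    (hw.trivial_of_contractible (𝓑.isComplicial.contractible_C _))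
    (hw.trivial_of_contractible (𝓑.isComplicial.contractible_C _)) _
  exact ⟨fun h => 𝓑.isComplicial.weq_left hw (𝓑.conf_inc x) (𝓑.conf_inc y) (𝓑.inc_naturality f).symm
      (𝓑.π.naturality f).symm hC h,
    fun h => 𝓑.isComplicial.weq_right hw (𝓑.conf_inc x) (𝓑.conf_inc y) (𝓑.inc_naturality f).symm
      (𝓑.π.naturality f).symm h hC⟩

lemma weq_iff_of_iso {x y x' y' : E} {f : x ⟶ y} {f' : x' ⟶ y'} (e : Arrow.mk f ≅ Arrow.mk f') :
    w f ↔ w f' := by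
  have h {x y x' y' : E} {f : x ⟶ y} {f' : x' ⟶ y'} (e : Arrow.mk f ≅ Arrow.mk f') (hf : w f) :
      w f' := by
    refine hw.of_precomp (hw.of_isIso e.hom.left) ?_
    have h₁ : e.hom.left ≫ f' = f ≫ e.hom.right := e.hom.w
    rw [h₁]
    exact IsComplicialWeakEquivalences.comp w hw hf (hw.of_isIso e.hom.right)
  exact ⟨h e, h e.symm⟩

lemma weq_iteratedDesuspension_iff (m : ℕ) {x y : E} {f : x ⟶ y} :
    w ((𝓑.iteratedDesuspension m).map f) ↔ w f := by
  induction m generalizing x y with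
  | zero => rfl
  | succ m ih =>
    -- `T` preserves and reflects `w`, and `T` after its inverse is isomorphic to the identity.
    refine (ih (f := 𝓑.T.inv.map f)).trans ((weq_T_map_iff hw).symm.trans ?_)
    exact weq_iff_of_iso hw (((Functor.mapArrowFunctor _ _).mapIso
      𝓑.T.asEquivalence.counitIso).app (Arrow.mk f))

/-- Total weak equivalences can be computed by the iterated mapping cone of a sufficiently large
part of the complexes. -/
lemma tw_iff {x y : Chb E} (f : x ⟶ y) {M : ℕ} (hx : concentrated E M x.obj)
    (hy : concentrated E M y.obj) : 𝓑.tw w f ↔ w ((𝓑.partialTotal (2 * M) M).map f.hom) := by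
  classical
  have hx' : width x ≤ M := Nat.find_min' _ hx
  have hy' : width y ≤ M := Nat.find_min' _ hy
  have h : 𝓑.Tot.map f = 𝓑.totalMap (concentrated_width x) (concentrated_width y) f.hom hx' hy' :=
    ((𝓑.totalMap_eq _ _ _ _ _ (max_le hx' hy')).symm)
  change w (𝓑.Tot.map f) ↔ _
  rw [h, ← weq_iteratedDesuspension_iff hw M]
  refine weq_iff_of_iso hw (Arrow.isoMk (𝓑.truncatedTotalIso _ (concentrated_width x) hx')
    (𝓑.truncatedTotalIso _ (concentrated_width y) hy') ?_)
  have h₁ : (𝓑.truncatedTotalIso _ (concentrated_width x) hx').hom ≫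
      (𝓑.truncatedTotal M).map f.hom = 𝓑.totalMap (concentrated_width x) (concentrated_width y)
        f.hom hx' hy' ≫ (𝓑.truncatedTotalIso _ (concentrated_width y) hy').hom := by
    simp [totalMap]
  exact h₁

lemma acyclicTw_iff {x : Chb E} {M : ℕ} (hx : concentrated E M x.obj) :
    𝓑.acyclicTw w x ↔ trivialObjects w ((𝓑.partialTotal (2 * M) M).obj x.obj) := by
  have h0 (i : ℤ) : IsZero ((0 : Chb E).obj.X i) :=
    (HomologicalComplex.eval E (ComplexShape.up ℤ) i).map_isZero
      ((bounded E).ι.map_isZero (isZero_zero _))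
  have h₁ := 𝓑.isZero_partialTotal (x := (0 : Chb E).obj) (2 * M) M fun i _ => h0 i
  rw [acyclicTw, trivialObjects, tw_iff hw _ (fun i _ => h0 i) hx]
  refine weq_iff_of_iso hw (Arrow.isoMk (h₁.iso (isZero_zero E)) (Iso.refl _) ?_)
  exact h₁.eq_of_src _ _

lemma lw_le_tw : lw w ≤ 𝓑.tw w := fun x y f hf => by
  obtain ⟨m, hm⟩ := x.property
  obtain ⟨n, hn⟩ := y.property
  rw [tw_iff hw f (concentrated_mono (le_max_left m n) hm) (concentrated_mono (le_max_right m n) hn)]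
  exact weq_partialTotal hw hf _ _

lemma acyclicLw_le_acyclicTw : acyclicLw w ≤ 𝓑.acyclicTw w := fun x hx =>
  lw_le_tw hw _ fun i => by
    have h0 : IsZero ((0 : Chb E).obj.X i) :=
      (HomologicalComplex.eval E (ComplexShape.up ℤ) i).map_isZero
        ((bounded E).ι.map_isZero (isZero_zero _))
    exact hw.of_trivial (hw.trivial_of_isZero h0) (hx i) _

lemma tw_hasTwoOutOfThreeProperty : (𝓑.tw w).HasTwoOutOfThreeProperty := by
  have := hw.saturated
  unfold tw
  infer_instance

lemma tw_ext {S S' : ShortComplex (Chb E)} (φ : S ⟶ S') (h : levelConflation 𝓑.conflation S)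
    (h' : levelConflation 𝓑.conflation S') (h₁ : 𝓑.tw w φ.τ₁) (h₃ : 𝓑.tw w φ.τ₃) :
    𝓑.tw w φ.τ₂ := by
  obtain ⟨m₁, hm₁⟩ := S.X₁.property
  obtain ⟨m₂, hm₂⟩ := S.X₂.property
  obtain ⟨m₃, hm₃⟩ := S.X₃.property
  obtain ⟨n₁, hn₁⟩ := S'.X₁.property
  obtain ⟨n₂, hn₂⟩ := S'.X₂.property
  obtain ⟨n₃, hn₃⟩ := S'.X₃.property
  set M := m₁ + m₂ + m₃ + n₁ + n₂ + n₃
  replace hm₁ := concentrated_mono (m' := M) (by omega) hm₁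
  replace hm₂ := concentrated_mono (m' := M) (by omega) hm₂
  replace hm₃ := concentrated_mono (m' := M) (by omega) hm₃
  replace hn₁ := concentrated_mono (m' := M) (by omega) hn₁
  replace hn₂ := concentrated_mono (m' := M) (by omega) hn₂
  replace hn₃ := concentrated_mono (m' := M) (by omega) hn₃
  rw [tw_iff hw _ hm₁ hn₁] at h₁
  rw [tw_iff hw _ hm₃ hn₃] at h₃
  rw [tw_iff hw _ hm₂ hn₂]
  refine hw.ext (𝓑.conf_partialTotal (conf_level_iff.1 (conf_mk h)) _ _)
    (𝓑.conf_partialTotal (conf_level_iff.1 (conf_mk h')) _ _) ?_ ?_ h₁ h₃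
  · rw [← PartialTotal.map_comp, ← PartialTotal.map_comp]
    exact congrArg (fun φ => (𝓑.partialTotal (2 * M) M).map φ.hom) φ.comm₁₂.symm
  · rw [← PartialTotal.map_comp, ← PartialTotal.map_comp]
    exact congrArg (fun φ => (𝓑.partialTotal (2 * M) M).map φ.hom) φ.comm₂₃.symm

lemma tw_id (x : Chb E) : 𝓑.tw w (𝟙 x) := by
  change w (𝓑.Tot.map (𝟙 x))
  rw [CategoryTheory.Functor.map_id]
  exact hw.of_isIso _

/-- Only contractible complexes of `𝔸` are at stake for the homotopy equivalences; these are
contractible, hence trivial, in each degree. -/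
lemma isComplicialWeakEquivalences_tw_structA : 𝓑.structA.IsComplicialWeakEquivalences (𝓑.tw w) :=
  𝓑.isComplicial_structA.isComplicialWeakEquivalences_of (tw_hasTwoOutOfThreeProperty hw)
    (tw_ext hw) (tw_id hw) fun x hx => acyclicLw_le_acyclicTw hw x fun i => by
      obtain ⟨H, hH⟩ := homotopic_zero_iff.1 hx
      exact hw.trivial_of_contractible (homotopic_zero_iff.2
        ⟨H.hom.f i, congrArg (fun φ => φ.hom.f i) hH⟩)

lemma isNullClass_acyclicTw_structA : 𝓑.structA.IsNullClass (𝓑.acyclicTw w) :=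
  𝓑.isComplicial_structA.isNullClass_trivialObjects (isComplicialWeakEquivalences_tw_structA hw)

/-! ### Complexes concentrated in one degree -/

lemma trivial_T_obj_iff {x : E} : trivialObjects w (𝓑.T.obj x) ↔ trivialObjects w x := by
  have hC := hw.trivial_of_contractible (𝓑.isComplicial.contractible_C x)
  exact ⟨fun h => 𝓑.isComplicial.trivial_left hw (𝓑.conf_inc x) hC h,
    fun h => 𝓑.isComplicial.trivial_right hw (𝓑.conf_inc x) h hC⟩

lemma trivial_partialTotal_iff_of_le {x : CochainComplex E ℤ} {a : ℤ} (hx : ∀ i ≠ a, IsZero (x.X i))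
    (n : ℕ) : trivialObjects w ((𝓑.partialTotal n a).obj x) ↔ trivialObjects w (x.X a) := by
  cases n with
  | zero => rfl
  | succ n =>
    have h := hw.trivial_of_isZero (𝓑.isZero_partialTotal (x := x) n (a - 1)
      fun i hi => hx i (by omega))
    exact (hw.trivial_iff (𝓑.isComplicial.weq_of_conf_left hw (𝓑.conf_coneInr _)
      ((trivial_T_obj_iff hw).2 h))).symm

/-- Each degree above `a` contributes the cone of a morphism to zero, that is a suspension, which
does not affect triviality. The bound `k ≤ n` ensures that degree `a` belongs to the part being
totalized. -/
lemma trivial_partialTotal_single_iff {x : CochainComplex E ℤ} {a : ℤ}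
    (hx : ∀ i ≠ a, IsZero (x.X i)) (k n : ℕ) (b : ℤ) (hb : b = a + k) (hk : k ≤ n) :
    trivialObjects w ((𝓑.partialTotal n b).obj x) ↔ trivialObjects w (x.X a) := by
  induction k generalizing n b with
  | zero =>
    obtain rfl : b = a := by simpa using hb
    exact trivial_partialTotal_iff_of_le hw hx n
  | succ k ih =>
    obtain ⟨n, rfl⟩ : ∃ m, n = m + 1 := ⟨n - 1, by omega⟩
    rw [← ih n (b - 1) (by push_cast at hb; omega) (by omega),
      ← trivial_T_obj_iff hw (x := (𝓑.partialTotal n (b - 1)).obj x)]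
    have h := 𝓑.isComplicial.weq_of_conf_right hw
      (𝓑.conf_coneInr ((𝓑.partialTotal n (b - 1)).g x b))
      (hw.trivial_of_isZero (hx b (by push_cast at hb; omega)))
    exact hw.trivial_iff h

lemma acyclicLw_of_acyclicTw_of_single {x : Chb E} {a : ℤ} (hx : ∀ i ≠ a, IsZero (x.obj.X i))
    (h : 𝓑.acyclicTw w x) : acyclicLw w x := fun i => by
  by_cases hi : i = a
  · subst hi
    obtain ⟨M, hM⟩ := x.property
    by_cases hi : (M : ℤ) < |i|
    · exact hw.trivial_of_isZero (hM i hi)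
    · rw [acyclicTw_iff hw hM] at h
      have := abs_le.1 (not_lt.1 hi)
      exact (trivial_partialTotal_single_iff hw hx (M - i).toNat _ _ (by omega) (by omega)).1 h
  · exact hw.trivial_of_isZero (hx i hi)

/-! ### Strictly acyclic complexes -/

/-- The part of a strictly acyclic complex up to degree `b` has total object weakly equivalent to `Z
(b + 1)`. Inductively the cone of `Tot ⟶ x.X b` is equivalent to the cone of `Z b ⟶ x.X b`, hence to
the quotient `Z (b + 1)`. Compatibility of `q` with the maps to the next component is what lets the
induction continue. -/
lemma exists_weq_partialTotal {x : CochainComplex E ℤ} {Z : ℤ → E} {k : ∀ i, Z i ⟶ x.X i}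
    {p : ∀ i, x.X i ⟶ Z (i + 1)} (h : ∀ i, Conf 𝓑.conflation (k i) (p i))
    (hd : ∀ i, x.d i (i + 1) = p i ≫ k (i + 1)) (n : ℕ) (b c : ℤ) (hc : b + 1 = c)
    (hx : ∀ i < b - n, IsZero (x.X i)) :
    ∃ q : (𝓑.partialTotal n b).obj x ⟶ Z c, w q ∧ q ≫ k c = (𝓑.partialTotal n b).g x c := by
  induction n generalizing b c with
  | zero =>
    subst hc
    refine ⟨p b, 𝓑.isComplicial.weq_of_conf_right hw (h b) (hw.trivial_of_isZero ?_), (hd b).symm⟩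
    -- `Z b` is a quotient of `x.X (b - 1)`, which is zero.
    obtain ⟨a, rfl⟩ : ∃ a, b = a + 1 := ⟨b - 1, by omega⟩
    have := 𝓑.exact.epi (h a)
    rw [IsZero.iff_id_eq_zero, ← cancel_epi (p a)]
    exact (hx a (by simp)).eq_of_src _ _
  | succ n ih =>
    subst hc
    obtain ⟨q, hq, hqk⟩ := ih (b - 1) b (by omega) fun i hi => hx i (by push_cast; omega)
    have e : 𝓑.inc _ ≫ (0 : 𝓑.C.obj _ ⟶ Z (b + 1)) = (𝓑.partialTotal n (b - 1)).g x b ≫ p b := by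
      rw [← hqk, Category.assoc, (h b).1, comp_zero, comp_zero]
    have e' : 𝓑.inc _ ≫ (0 : 𝓑.C.obj _ ⟶ Z (b + 1)) = k b ≫ p b := by
      rw [(h b).1, comp_zero]
    refine ⟨𝓑.coneDesc _ 0 (p b) e, ?_, 𝓑.cone_hom_ext ?_ ?_⟩
    -- The map factors through the cone of `k b`: the first factor is induced by the weak
    -- equivalence `q`, and the second is a deflation with kernel `C (Z b)`.
    · have h₁ : 𝓑.coneDesc _ 0 (p b) e =
          𝓑.coneMap _ (k b) q (𝟙 _) (by rw [hqk, Category.comp_id]) ≫ 𝓑.coneDesc _ 0 (p b) e' :=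
        𝓑.cone_hom_ext (by simp) (by simp)
      rw [h₁]
      refine IsComplicialWeakEquivalences.comp w hw (𝓑.isComplicial.weq_cone_map hw (b := 𝟙 _) ?_
        (𝓑.isPushout_cone _) (𝓑.isPushout_cone _) (𝓑.coneInl_map _ _ _ _ _)
        (𝓑.coneInr_map _ _ _ _ _) hq (hw.of_isIso _))
        (𝓑.isComplicial.weq_of_conf_right hw (𝓑.exact.conf_pushout (h b) (𝓑.isPushout_cone _).flip
          (𝓑.coneInr_desc _ _ _ _) (𝓑.coneInl_desc _ _ _ _))
          (hw.trivial_of_contractible (𝓑.isComplicial.contractible_C _)))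
      rw [hqk, Category.comp_id]
    · simp [partialTotal, coneTotal]
    · simp [partialTotal, coneTotal, hd]

lemma strictlyAcyclic_le_acyclicTw : strictlyAcyclic 𝓑.conflation ≤ 𝓑.acyclicTw w := by
  rintro x ⟨Z, k, p, h, hZ, hd⟩
  obtain ⟨M, hM⟩ := x.property
  rw [acyclicTw_iff hw hM]
  obtain ⟨q, hq, -⟩ := exists_weq_partialTotal hw (fun i => conf_mk (hZ i)) hd (2 * M) M _ rfl
    fun i hi => hM i (by rw [abs_of_neg] <;> push_cast at hi <;> omega)
  -- The total object is equivalent to `Z (M + 1)`, a subobject of `x.X (M + 1)`, which is zero.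
  refine (hw.trivial_iff hq).2 (hw.trivial_of_isZero ?_)
  have := 𝓑.exact.mono (conf_mk (hZ (M + 1)))
  dsimp at this
  rw [IsZero.iff_id_eq_zero, ← cancel_mono (k (M + 1))]
  exact (hM _ (by grind)).eq_of_tgt _ _

end BicomplicialCategory

end Bicomplicial

end

/-! ### Chain homotopies and the total object of a contractible complex. -/

noncomputable section

namespace Bicomplicial

set_option linter.unusedSectionVars false

open ConeStructure CochainComplex CochainComplex.HomComplex

variable {E : Type u} [Category.{v} E] [Preadditive E] [HasZeroObject E] [HasBinaryBiproducts E]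

/-! ### Chain homotopies -/

/-- A morphism from the cone of `𝟙 x` restricting to `f - g` on `x` amounts to a cochain of degree
`-1` with boundary `f - g`. -/
lemma homotopic_structB_iff {conf : ObjectProperty (ShortComplex E)} {x y : Chb E} {f g : x ⟶ y} :
    (structB conf).Homotopic f g ↔ Nonempty (Homotopy f.hom g.hom) := by
  refine ⟨fun ⟨H, hH⟩ => ?_, fun ⟨h⟩ => ?_⟩
  · have hH' : f.hom - g.hom = mappingCone.inr (𝟙 x.obj) ≫ H.hom := congrArg (·.hom) hH
    let H' : mappingCone (𝟙 x.obj) ⟶ y.obj := H.hom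
    refine ⟨(Cochain.equivHomotopy _ _).symm
      ⟨(mappingCone.inl (𝟙 x.obj)).comp (Cochain.ofHom H') (add_zero _), ?_⟩⟩
    rw [δ_comp_ofHom, mappingCone.δ_inl, Category.id_comp, ← Cochain.ofHom_comp, ← hH']
    simp
  · obtain ⟨z, hz⟩ := Cochain.equivHomotopy _ _ h
    let H : mappingCone (𝟙 x.obj) ⟶ y.obj := mappingCone.desc (𝟙 x.obj) z (f.hom - g.hom) (by
      simp [hz])
    refine ⟨ObjectProperty.homMk H, ?_⟩
    ext1
    have h₁ : mappingCone.inr (𝟙 x.obj) ≫ H = f.hom - g.hom := by simp [H]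
    exact h₁.symm

lemma homotopyEquivalences_structB {conf : ObjectProperty (ShortComplex E)} {x y : Chb E}
    (e : HomotopyEquiv x.obj y.obj) :
    (structB conf).homotopyEquivalences (ObjectProperty.homMk e.hom : x ⟶ y) :=
  ⟨ObjectProperty.homMk e.inv, homotopic_structB_iff.2 ⟨e.homotopyHomInvId⟩,
    homotopic_structB_iff.2 ⟨e.homotopyInvHomId⟩⟩

lemma exists_contraction {conf : ObjectProperty (ShortComplex E)} {x : Chb E}
    (hx : (structB conf).contractible x) : ∃ s : ∀ i j, x.obj.X i ⟶ x.obj.X j,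
    ∀ i j k, i + 1 = j → j + 1 = k → x.obj.d j k ≫ s k j + s j i ≫ x.obj.d i j = 𝟙 (x.obj.X j) := by
  obtain ⟨h⟩ := homotopic_structB_iff.1 hx
  refine ⟨h.hom, fun i j k hij hjk => ?_⟩
  have := h.comm j
  rw [dNext_eq h.hom (show (ComplexShape.up ℤ).Rel j k from hjk),
    prevD_eq h.hom (show (ComplexShape.up ℤ).Rel i j from hij)] at this
  exact (this.trans (add_zero _)).symm

namespace BicomplicialCategory

variable (𝓑 : BicomplicialCategory E)

/-- Inductive step for contracting total objects: `p` is the total object so far, `x`, `y`, `z` are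
the next three terms. The map `h` inverts `g : p ⟶ x` up to the homotopy `H` on one side and up to
`d ≫ s` on the other. The condition `H ≫ g = 0` is carried along because it kills the one error term
of the new homotopy. -/
lemma exists_contraction_cone {p x y z : E} {g : p ⟶ x} {d : x ⟶ y} {s : y ⟶ x} {d' : y ⟶ z}
    {s' : z ⟶ y} (hd : g ≫ d = 0) {h : x ⟶ p} {H : 𝓑.C.obj p ⟶ p} (h₁ : h ≫ g = 𝟙 _ - d ≫ s)
    (h₂ : 𝟙 _ = g ≫ h + 𝓑.inc p ≫ H) (h₃ : H ≫ g = 0) (h₄ : d' ≫ s' + s ≫ d = 𝟙 y) :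
    ∃ (h' : y ⟶ 𝓑.cone g) (H' : 𝓑.C.obj (𝓑.cone g) ⟶ 𝓑.cone g),
      h' ≫ 𝓑.coneDesc g 0 d (by rw [comp_zero, hd]) = 𝟙 _ - d' ≫ s' ∧
      𝟙 _ = 𝓑.coneDesc g 0 d (by rw [comp_zero, hd]) ≫ h' + 𝓑.inc _ ≫ H' ∧
      H' ≫ 𝓑.coneDesc g 0 d (by rw [comp_zero, hd]) = 0 := by
  have e₁ : 𝓑.inc p ≫ 𝓑.C.map (g ≫ h) = g ≫ h ≫ 𝓑.inc p := by
    rw [← 𝓑.inc_naturality, Category.assoc]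
  have e₂ : 𝓑.inc p ≫ (𝓑.C.map (𝓑.inc p) - 𝓑.inc (𝓑.C.obj p)) = g ≫ 0 := by
    rw [Preadditive.comp_sub, 𝓑.inc_naturality, sub_self, comp_zero]
  -- On `C p` this is `C (g h) + (C ι - ι_C) C H = 𝟙 - ι_C C H`. The difference `C ι - ι_C` is
  -- annihilated by `ι_p`, so it descends to the cone by zero on `x`.
  let a : 𝓑.cone g ⟶ 𝓑.C.obj p := 𝓑.coneDesc g (𝓑.C.map (g ≫ h)) (h ≫ 𝓑.inc p) e₁ +
    𝓑.coneDesc g _ 0 e₂ ≫ 𝓑.C.map H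
  have ha : 𝓑.inc _ ≫ 𝓑.C.map a ≫ 𝓑.r.app p = a := by
    rw [← Category.assoc, ← 𝓑.inc_naturality, Category.assoc]
    exact (congrArg (a ≫ ·) (𝓑.ι_C_r p)).trans (Category.comp_id a)
  have hC : 𝓑.C.map (g ≫ h) + 𝓑.C.map (𝓑.inc p) ≫ 𝓑.C.map H = 𝟙 _ := by
    rw [← Functor.map_comp, ← Functor.map_add, ← h₂, CategoryTheory.Functor.map_id]
  refine ⟨s ≫ 𝓑.coneInr g, 𝓑.C.map a ≫ 𝓑.r.app p ≫ 𝓑.coneInl g, ?_, ?_, ?_⟩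
  · simp [← h₄]
  · have : 𝓑.inc (𝓑.cone g) ≫ 𝓑.C.map a ≫ 𝓑.r.app p ≫ 𝓑.coneInl g = a ≫ 𝓑.coneInl g := by
      simpa only [Category.assoc] using ha =≫ 𝓑.coneInl g
    rw [this]
    apply 𝓑.cone_hom_ext
    -- The error term becomes `H ≫ ι_p` by naturality, and in the cone this is `H ≫ g` followed by
    -- the inclusion of `x`, which is zero.
    · have hH : 𝓑.inc (𝓑.C.obj p) ≫ 𝓑.C.map H ≫ 𝓑.coneInl g = 0 := by
        rw [← Category.assoc, ← 𝓑.inc_naturality, Category.assoc, cone_condition, ← Category.assoc,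
          h₃, zero_comp]
      simp only [a, Preadditive.comp_add, Preadditive.add_comp, coneInl_desc_assoc, zero_comp,
        zero_add, Category.comp_id, Category.assoc, Preadditive.sub_comp, hH, sub_zero]
      rw [← Category.assoc (𝓑.C.map (𝓑.inc p)), ← Preadditive.add_comp, hC, Category.id_comp]
    · simp only [a, Preadditive.comp_add, Preadditive.add_comp, coneInr_desc_assoc, zero_comp,
        add_zero, Category.comp_id, Category.assoc, cone_condition]
      rw [← Category.assoc h, h₁, Preadditive.sub_comp, Category.id_comp, Category.assoc,
        add_sub_cancel]
  · simp

/-- The contraction `s` of the complex starts the induction with `h = s` and `H = 0`, the term below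
the lowest one being zero; `exists_contraction_cone` adds one term at a time. -/
lemma exists_contraction_partialTotal {x : CochainComplex E ℤ} (s : ∀ i j, x.X i ⟶ x.X j)
    (hs : ∀ i j k, i + 1 = j → j + 1 = k → x.d j k ≫ s k j + s j i ≫ x.d i j = 𝟙 (x.X j))
    (n : ℕ) (b c e : ℤ) (hc : b + 1 = c) (he : c + 1 = e) (hx : ∀ i < b - n, IsZero (x.X i)) :
    ∃ (h : x.X c ⟶ (𝓑.partialTotal n b).obj x)
      (H : 𝓑.C.obj ((𝓑.partialTotal n b).obj x) ⟶ (𝓑.partialTotal n b).obj x),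
      h ≫ (𝓑.partialTotal n b).g x c = 𝟙 _ - x.d c e ≫ s e c ∧
      𝟙 _ = (𝓑.partialTotal n b).g x c ≫ h + 𝓑.inc _ ≫ H ∧
      H ≫ (𝓑.partialTotal n b).g x c = 0 := by
  induction n generalizing b c e with
  | zero =>
    refine ⟨s c b, 0, ?_, ?_, zero_comp⟩
    · rw [← hs b c e hc he]
      exact (add_sub_cancel_left _ _).symm
    · have h₁ := hs (b - 1) b c (by omega) hc
      rw [(hx (b - 1) (by simp)).eq_of_tgt (s b (b - 1)) 0, zero_comp, add_zero] at h₁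
      rw [comp_zero, add_zero]
      exact h₁.symm
  | succ n ih =>
    obtain ⟨h, H, h₁, h₂, h₃⟩ := ih (b - 1) b c (by omega) hc fun i hi => hx i (by push_cast; omega)
    have h₄ := hs b c e hc he
    exact 𝓑.exists_contraction_cone ((𝓑.partialTotal n (b - 1)).g_d x b c) h₁ h₂ h₃ h₄

/-- A bounded contractible complex has a contractible total object. -/
lemma contractible_partialTotal {conf : ObjectProperty (ShortComplex E)} {x : Chb E}
    (hx : (structB conf).contractible x) {M : ℕ} (hM : concentrated E M x.obj) :
    𝓑.contractible ((𝓑.partialTotal (2 * M) M).obj x.obj) := by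
  obtain ⟨s, hs⟩ := exists_contraction hx
  obtain ⟨h, H, -, h₂, -⟩ := 𝓑.exists_contraction_partialTotal s hs (2 * M) M _ _ rfl rfl
    fun i hi => hM i (by rw [abs_of_neg] <;> push_cast at hi <;> omega)
  -- Above the top degree `h` starts from zero, so `H` alone is a contraction.
  rw [(hM (M + 1) (by grind)).eq_of_src h 0, comp_zero, zero_add] at h₂
  exact homotopic_zero_iff.2 ⟨H, h₂⟩

variable {𝓑} {w : MorphismProperty E} (hw : 𝓑.IsComplicialWeakEquivalences w)
include hw

/-- Closure under extensions is inherited from the degreewise conflations; the new input is that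
contractible complexes have contractible total objects. -/
lemma isComplicialWeakEquivalences_tw_structB :
    (structB 𝓑.conflation).frob.IsComplicialWeakEquivalences (𝓑.tw w) :=
  (isComplicial_structB 𝓑.exact).isFrobenius_frob.toIsComplicial.isComplicialWeakEquivalences_of
    (tw_hasTwoOutOfThreeProperty hw) (fun φ h h' => tw_ext hw φ h.1 h'.1) (tw_id hw) fun x hx => by
      obtain ⟨M, hM⟩ := x.property
      exact (acyclicTw_iff hw hM).2 (hw.trivial_of_contractible (𝓑.contractible_partialTotal
        (conf := 𝓑.conflation) hx hM))

lemma isNullClass_acyclicTw_structB :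
    (structB 𝓑.conflation).frob.IsNullClass (𝓑.acyclicTw w) :=
  (isComplicial_structB 𝓑.exact).isFrobenius_frob.toIsComplicial.isNullClass_trivialObjects
    (isComplicialWeakEquivalences_tw_structB hw)

lemma acyclic_le_acyclicTw : acyclic 𝓑.conflation ≤ 𝓑.acyclicTw w := by
  rintro x ⟨y, hy, ⟨e⟩⟩
  refine ((isComplicialWeakEquivalences_tw_structB hw).trivial_iff
    ((isComplicialWeakEquivalences_tw_structB hw).homotopyEquivalences_le _
      (homotopyEquivalences_structB (conf := 𝓑.conflation) e))).2 (strictlyAcyclic_le_acyclicTw hw y hy)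

end BicomplicialCategory
end Bicomplicial

end

/-! ### The total complex of a short exact sequence of complexes is strictly acyclic. -/

noncomputable section

namespace Bicomplicial

set_option linter.unusedSectionVars false

open ConeStructure CochainComplex CochainComplex.HomComplex

variable {E : Type u} [Category.{v} E] [Preadditive E] [HasZeroObject E] [HasBinaryBiproducts E]
  {conf : ObjectProperty (ShortComplex E)} (hE : IsExactStructure conf)

section
include hE

lemma IsExactStructure.isDeflation_of_isPullback {y z z' y' : E} {p : y ⟶ z} {f : z' ⟶ z}
    {f' : y' ⟶ y} {p' : y' ⟶ z'} (sq : IsPullback f' p' p f) (hp : IsDeflation conf p) :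
    IsDeflation conf p' := by
  obtain ⟨x, i, h⟩ := hp.exists_conf
  have w : i ≫ p = (0 : x ⟶ z') ≫ f := by rw [h.1, zero_comp]
  exact (hE.conf_pullback h sq (sq.lift_fst i 0 w) (sq.lift_snd _ _ _)).isDeflation

lemma IsExactStructure.isDeflation_of_isIso {x y : E} (p : x ⟶ y) [IsIso p] : IsDeflation conf p :=
  (hE.conf_of_isIso' p (isZero_zero E) 0).isDeflation

/-- A complex which looks like the total complex of a degreewise admissible short exact sequence
is strictly acyclic. -/
lemma strictlyAcyclic_of_conf {U M C : CochainComplex E ℤ} {Y : CochainComplex E ℤ} (hY : bounded E Y)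
    {i : U ⟶ M} {p : M ⟶ C}
    (h : ∀ n, Conf conf (i.f n) (p.f n))
    (πa : ∀ n, Y.X n ⟶ U.X (n + 1 + 1)) (πb : ∀ n, Y.X n ⟶ M.X (n + 1))
    (πe : ∀ n, Y.X n ⟶ C.X n) (ιa : ∀ n, U.X (n + 1 + 1) ⟶ Y.X n)
    (ιb : ∀ n, M.X (n + 1) ⟶ Y.X n) (ιe : ∀ n, C.X n ⟶ Y.X n)
    (haa : ∀ n, ιa n ≫ πa n = 𝟙 _) (hab : ∀ n, ιa n ≫ πb n = 0) (hae : ∀ n, ιa n ≫ πe n = 0)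
    (hba : ∀ n, ιb n ≫ πa n = 0) (hbb : ∀ n, ιb n ≫ πb n = 𝟙 _) (hbe : ∀ n, ιb n ≫ πe n = 0)
    (hea : ∀ n, ιe n ≫ πa n = 0) (heb : ∀ n, ιe n ≫ πb n = 0) (hee : ∀ n, ιe n ≫ πe n = 𝟙 _)
    (tot : ∀ n, πa n ≫ ιa n + πb n ≫ ιb n + πe n ≫ ιe n = 𝟙 _)
    (hb : ∀ n, Y.d n (n + 1) ≫ πb (n + 1) =
      -(πa n ≫ i.f (n + 1 + 1) + πb n ≫ M.d (n + 1) (n + 1 + 1)))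
    (he : ∀ n, Y.d n (n + 1) ≫ πe (n + 1) = πb n ≫ p.f (n + 1) + πe n ≫ C.d n (n + 1)) :
    strictlyAcyclic conf ⟨Y, hY⟩ := by
  -- `Z n` is the object of cocycles of `Y`. A triple `(u, m, c)` is a cocycle when `p m = -d c` and
  -- `i u = -d m`. The first equation is the pullback defining `Z n`; it forces `d m` into the image
  -- of `i`, so that `u` is determined by `m`.
  choose Z f g j sq hj hjg using fun n => hE.exists_pullback (h (n + 1)) (-(C.d n (n + 1)))
  have hext {n : ℤ} {T : E} {a b : T ⟶ Y.X n} (h₁ : a ≫ πa n = b ≫ πa n)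
      (h₂ : a ≫ πb n = b ≫ πb n) (h₃ : a ≫ πe n = b ≫ πe n) : a = b := by
    rw [← Category.comp_id a, ← Category.comp_id b, ← tot n]
    simp only [Preadditive.comp_add, ← Category.assoc, h₁, h₂, h₃]
  have hα (n : ℤ) : ∃ α : Z n ⟶ U.X (n + 1 + 1),
      α ≫ i.f (n + 1 + 1) = -(f n ≫ M.d (n + 1) (n + 1 + 1)) := by
    refine hE.exists_lift (h _) _ ?_
    have h₁ := (sq n).w =≫ C.d (n + 1) (n + 1 + 1)
    rw [Category.assoc, Category.assoc, p.comm] at h₁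
    rw [Preadditive.neg_comp, Category.assoc, h₁]
    simp
  choose α hα using hα
  have hdb (n : ℤ) : (πa n ≫ i.f (n + 1 + 1) + πb n ≫ M.d (n + 1) (n + 1 + 1)) =
      -(Y.d n (n + 1) ≫ πb (n + 1)) := by rw [hb, neg_neg]
  have hq (n : ℤ) : (Y.d n (n + 1) ≫ πb (n + 1)) ≫ p.f (n + 1 + 1) =
      (Y.d n (n + 1) ≫ πe (n + 1)) ≫ (-(C.d (n + 1) (n + 1 + 1))) := by
    have := Y.d n (n + 1) ≫= he (n + 1)
    rw [← Category.assoc, Y.d_comp_d, zero_comp, Preadditive.comp_add] at this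
    rw [Preadditive.comp_neg, Category.assoc, Category.assoc]
    exact eq_neg_of_add_eq_zero_left this.symm
  -- `q` is the differential of `Y`, corestricted to the cocycles.
  choose q hqf hqg using fun n => (⟨(sq (n + 1)).lift _ _ (hq n), (sq (n + 1)).lift_fst _ _ _,
    (sq (n + 1)).lift_snd _ _ _⟩ : ∃ q : Y.X n ⟶ Z (n + 1),
      q ≫ f (n + 1) = Y.d n (n + 1) ≫ πb (n + 1) ∧
      q ≫ g (n + 1) = Y.d n (n + 1) ≫ πe (n + 1))
  let k (n : ℤ) : Z n ⟶ Y.X n := α n ≫ ιa n + f n ≫ ιb n + g n ≫ ιe n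
  have hka (n : ℤ) : k n ≫ πa n = α n := by simp [k, haa, hba, hea]
  have hkb (n : ℤ) : k n ≫ πb n = f n := by simp [k, hab, hbb, heb]
  have hke (n : ℤ) : k n ≫ πe n = g n := by simp [k, hae, hbe, hee]
  have hqα (n : ℤ) : q n ≫ α (n + 1) = Y.d n (n + 1) ≫ πa (n + 1) := by
    have := hE.mono (h (n + 1 + 1 + 1))
    have h₁ := Y.d n (n + 1) ≫= hdb (n + 1)
    rw [Preadditive.comp_neg, ← Category.assoc (Y.d n (n + 1)) (Y.d _ _), Y.d_comp_d,
      zero_comp, neg_zero, Preadditive.comp_add] at h₁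
    rw [← cancel_mono (i.f (n + 1 + 1 + 1)), Category.assoc, hα, Preadditive.comp_neg,
      ← Category.assoc, hqf, Category.assoc, Category.assoc]
    exact (eq_neg_of_add_eq_zero_left h₁).symm
  have hkq (n : ℤ) : k n ≫ q n = 0 := by
    refine (sq (n + 1)).hom_ext ?_ ?_
    · rw [Category.assoc, hqf, hb, zero_comp, Preadditive.comp_neg, Preadditive.comp_add,
        ← Category.assoc, hka, ← Category.assoc, hkb, hα, neg_add_cancel, neg_zero]
    · rw [Category.assoc, hqg, he, zero_comp, Preadditive.comp_add,
        ← Category.assoc, hkb, ← Category.assoc, hke, (sq n).w, Preadditive.comp_neg,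
        neg_add_cancel]
  refine ⟨Z, k, q, hkq, fun n => (hE.conf_of_isKernel ?_ (hkq n) ⟨fun a b hab => ?_⟩
    fun x hx => ?_).2, fun n => ?_⟩
  · have hιa : ιa n ≫ q n = -j (n + 1) := by
      refine (sq (n + 1)).hom_ext ?_ ?_
      · rw [Category.assoc, hqf, hb, Preadditive.neg_comp, hj, Preadditive.comp_neg,
          Preadditive.comp_add, ← Category.assoc, haa, ← Category.assoc, hab]
        simp
      · rw [Category.assoc, hqg, he, Preadditive.neg_comp, (hjg (n + 1)).1,
          Preadditive.comp_add, ← Category.assoc, hab, ← Category.assoc, hae]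
        simp
    have hιb : (ιb n ≫ q n) ≫ g (n + 1) = p.f (n + 1) := by
      rw [Category.assoc, hqg, he, Preadditive.comp_add, ← Category.assoc, hbb,
        ← Category.assoc, hbe]
      simp
    -- Already on the summands `U` and `M`, up to the sign on `U`, the map `q n` is a deflation:
    -- there it is the base change of `p.f (n + 1)` along `g (n + 1)`. The summand `C` is then added
    -- by `isDeflation_desc`.
    let D : U.X (n + 1 + 1) ⊞ M.X (n + 1) ⟶ Z (n + 1) := biprod.desc (j (n + 1)) (ιb n ≫ q n)
    have hD : IsPullback D biprod.snd (g (n + 1)) (p.f (n + 1)) :=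
      hE.isPullback_of_conf (hjg (n + 1)) (hE.conf_biprod _ _) _ _
        (by ext <;> simp [D, (hjg (n + 1)).1, hqg, he, reassoc_of% hbb, reassoc_of% hbe])
        (by simp [D])
    have hD' := hE.isDeflation_of_isPullback hD.flip (h (n + 1)).isDeflation
    let e : Y.X n ≅ (U.X (n + 1 + 1) ⊞ M.X (n + 1)) ⊞ C.X n :=
      { hom := biprod.lift (biprod.lift (-πa n) (πb n)) (πe n)
        inv := biprod.desc (biprod.desc (-ιa n) (ιb n)) (ιe n)
        hom_inv_id := by simpa using tot n
        inv_hom_id := by ext <;> simp [haa, hab, hae, hba, hbb, hbe, hea, heb, hee] }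
    have heq : q n = e.hom ≫ biprod.desc D (ιe n ≫ q n) := by
      have h₁ := tot n =≫ q n
      simp only [Preadditive.add_comp, Category.assoc, Category.id_comp, hιa] at h₁
      refine h₁.symm.trans ?_
      simp [e, D]
    rw [heq]
    have : IsIso e.hom := e.isIso_hom
    exact hE.deflation_comp _ _ (hE.isDeflation_of_isIso _) (hE.isDeflation_desc hD' _)
  · refine (sq n).hom_ext ?_ ?_
    · rw [← hkb, ← Category.assoc, hab, Category.assoc]
    · rw [← hke, ← Category.assoc, hab, Category.assoc]
  · have h₁ : x ≫ πb n ≫ p.f (n + 1) = -(x ≫ πe n ≫ C.d n (n + 1)) := by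
      have := hx =≫ g (n + 1)
      rw [Category.assoc, hqg, he, Preadditive.comp_add, zero_comp] at this
      exact eq_neg_of_add_eq_zero_left this
    have h₂ : x ≫ πa n ≫ i.f (n + 1 + 1) = -(x ≫ πb n ≫ M.d (n + 1) (n + 1 + 1)) := by
      have := hx =≫ f (n + 1)
      rw [Category.assoc, hqf, hb, Preadditive.comp_neg, Preadditive.comp_add, zero_comp,
        neg_eq_zero] at this
      exact eq_neg_of_add_eq_zero_left this
    have w : (x ≫ πb n) ≫ p.f (n + 1) = (x ≫ πe n) ≫ (-(C.d n (n + 1))) := by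
      rw [Category.assoc, h₁, Preadditive.comp_neg, Category.assoc]
    refine ⟨(sq n).lift _ _ w, hext ?_ ?_ ?_⟩
    · have := hE.mono (h (n + 1 + 1))
      rw [Category.assoc, hka, ← cancel_mono (i.f (n + 1 + 1)), Category.assoc, hα,
        Preadditive.comp_neg, ← Category.assoc, (sq n).lift_fst, Category.assoc, Category.assoc, h₂]
    · rw [Category.assoc, hkb, (sq n).lift_fst]
    · rw [Category.assoc, hke, (sq n).lift_snd]
  · refine hext ?_ ?_ ?_
    · rw [Category.assoc, hka, hqα]
    · rw [Category.assoc, hkb, hqf]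
    · rw [Category.assoc, hke, hqg]

/-- With `φ` given by `p` on `m` and zero on `u`, its cone has the terms `u.X (n + 2) ⊞ m.X (n + 1)
⊞ c.X n`: it is the total complex of the sequence. -/
lemma exists_strictlyAcyclic_coneB {u m c : Chb E} {i : u ⟶ m} {p : m ⟶ c}
    (h : Conf (levelConflation conf) i p) :
    ∃ φ : coneB i ⟶ c, strictlyAcyclic conf (coneB φ) := by
  have h0 : i.hom ≫ p.hom = 0 := congrArg (·.hom) h.1
  let φ' : mappingCone i.hom ⟶ c.obj := mappingCone.desc i.hom 0 p.hom (by simp [h0])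
  have hφ' (n : ℤ) : φ'.f n = (mappingCone.snd i.hom).v n n (add_zero n) ≫ p.hom.f n := by
    rw [mappingCone.ext_from_iff _ (n + 1) n rfl]
    simp [φ']
  refine ⟨ObjectProperty.homMk φ', ?_⟩
  refine strictlyAcyclic_of_conf hE (Y := mappingCone φ') _ (conf_level_iff.1 h)
    (fun n => (mappingCone.fst φ').1.v n (n + 1) rfl ≫
      (mappingCone.fst i.hom).1.v (n + 1) (n + 1 + 1) rfl)
    (fun n => (mappingCone.fst φ').1.v n (n + 1) rfl ≫
      (mappingCone.snd i.hom).v (n + 1) (n + 1) (add_zero _))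
    (fun n => (mappingCone.snd φ').v n n (add_zero _))
    (fun n => (mappingCone.inl i.hom).v (n + 1 + 1) (n + 1) (by omega) ≫
      (mappingCone.inl φ').v (n + 1) n (by omega))
    (fun n => (mappingCone.inr i.hom).f (n + 1) ≫ (mappingCone.inl φ').v (n + 1) n (by omega))
    (fun n => (mappingCone.inr φ').f n)
    (by simp) (by simp) (by simp) (by simp) (by simp) (by simp) (by simp) (by simp) (by simp)
    ?_ ?_ ?_
  all_goals intro n
  · rw [mappingCone.ext_from_iff _ (n + 1) n rfl]
    refine ⟨?_, by simp⟩
    rw [mappingCone.ext_from_iff _ (n + 1 + 1) (n + 1) rfl]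
    simp
  · rw [mappingCone.d_fst_v_assoc φ' n (n + 1) (n + 1 + 1) rfl rfl]
    simp [mappingCone.d_snd_v i.hom (n + 1) (n + 1 + 1) rfl]
  · simp [mappingCone.d_snd_v φ' n (n + 1) rfl, hφ']

end
end Bicomplicial

end

/-! ### Generation of the complexes with trivial total object, and null closures. -/

noncomputable section

namespace Bicomplicial

set_option linter.unusedSectionVars false

open ConeStructure CochainComplex CochainComplex.HomComplex

/-! ### Null classes and cones -/

namespace ConeStructure.IsNullClass

variable {K : Type u} [Category.{v} K] [Preadditive K] {𝓚 : ConeStructure K}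
  (hK : 𝓚.IsComplicial) {N : ObjectProperty K} (hN : 𝓚.IsNullClass N)
include hK hN

lemma cone_obj (x : K) : N (𝓚.C.obj x) := hN.contractible_le _ (hK.contractible_C x)

lemma suspension_iff {x t : K} {π : 𝓚.C.obj x ⟶ t} (h : Conf 𝓚.conflation (𝓚.inc x) π) :
    N t ↔ N x :=
  ⟨fun ht => hN.left h (hN.cone_obj hK x) ht, fun hx => hN.right h hx (hN.cone_obj hK x)⟩

variable {x y c : K} {f : x ⟶ y} {j : 𝓚.C.obj x ⟶ c} {k : y ⟶ c}
  (sq : IsPushout (𝓚.inc x) f j k)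
include sq

/-- A cone is an extension of the suspension of its source by its target, and `N` contains an object
together with its suspension. So `N` has two out of three for triangles; the next two lemmas are the
other cases. -/
lemma cone (hx : N x) (hy : N y) : N c := by
  obtain ⟨t, π, q, -, h, h'⟩ := hK.conf_cone sq
  exact hN.mid h' hy ((hN.suspension_iff hK h).2 hx)

lemma target (hx : N x) (hc : N c) : N y := by
  obtain ⟨t, π, q, -, h, h'⟩ := hK.conf_cone sq
  exact hN.left h' hc ((hN.suspension_iff hK h).2 hx)

lemma source (hy : N y) (hc : N c) : N x := by
  obtain ⟨t, π, q, -, h, h'⟩ := hK.conf_cone sq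
  exact (hN.suspension_iff hK h).1 (hN.right h' hy hc)

end ConeStructure.IsNullClass

variable {E : Type u} [Category.{v} E] [Preadditive E]

lemma IsExactStructure.isZero_mid {conf : ObjectProperty (ShortComplex E)}
    (hE : IsExactStructure conf) {x y z : E} {i : x ⟶ y} {p : y ⟶ z} (h : Conf conf i p)
    (hx : IsZero x) (hz : IsZero z) : IsZero y := by
  obtain ⟨l, hl⟩ := hE.exists_lift h (𝟙 y) (hz.eq_of_tgt _ _)
  rw [IsZero.iff_id_eq_zero, ← hl, hx.eq_of_src i 0, comp_zero]

lemma IsExactStructure.isZero_right {conf : ObjectProperty (ShortComplex E)}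
    (hE : IsExactStructure conf) {x y z : E} {i : x ⟶ y} {p : y ⟶ z} (h : Conf conf i p)
    (hy : IsZero y) : IsZero z := by
  have := hE.epi h
  rw [IsZero.iff_id_eq_zero, ← cancel_epi p]
  exact hy.eq_of_src _ _

lemma IsExactStructure.exists_retraction {conf : ObjectProperty (ShortComplex E)}
    (hE : IsExactStructure conf) {x y z : E} {i : x ⟶ y} {p : y ⟶ z} (h : Conf conf i p)
    {s : z ⟶ y} (hs : s ≫ p = 𝟙 z) : ∃ r : y ⟶ x, i ≫ r = 𝟙 x ∧ r ≫ i + p ≫ s = 𝟙 y := by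
  obtain ⟨r, hr⟩ := hE.exists_lift h (𝟙 y - p ≫ s) (by simp [hs])
  have := hE.mono h
  refine ⟨r, ?_, by rw [hr]; abel⟩
  rw [← cancel_mono i, Category.assoc, hr, Preadditive.comp_sub, ← Category.assoc, h.1]
  simp

variable [HasZeroObject E] [HasBinaryBiproducts E]

section Generation

variable {conf : ObjectProperty (ShortComplex E)} (hE : IsExactStructure conf)
include hE

lemma isComplicial_frob_structB : (structB conf).frob.IsComplicial :=
  (isComplicial_structB hE).isFrobenius_frob.toIsComplicial

variable {N : ObjectProperty (Chb E)} (hN : (structB conf).frob.IsNullClass N)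
include hN

lemma null_coneB {x y : Chb E} (f : x ⟶ y) (hx : N x) (hy : N y) : N (coneB f) :=
  hN.cone (isComplicial_frob_structB hE) (isPushout_coneB (conf := conf) f) hx hy

lemma null_target {x y : Chb E} (f : x ⟶ y) (hx : N x) (hf : N (coneB f)) : N y :=
  hN.target (isComplicial_frob_structB hE) (isPushout_coneB (conf := conf) f) hx hf

lemma null_source {x y : Chb E} (f : x ⟶ y) (hy : N y) (hf : N (coneB f)) : N x :=
  hN.source (isComplicial_frob_structB hE) (isPushout_coneB (conf := conf) f) hy hf

lemma null_iff_of_iso {x y : Chb E} (e : x ≅ y) : N x ↔ N y :=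
  ⟨hN.of_iso (isComplicial_frob_structB hE).exact e,
    hN.of_iso (isComplicial_frob_structB hE).exact e.symm⟩

lemma null_shiftB_iff {x : Chb E} : N (shiftB 1 x) ↔ N x :=
  hN.suspension_iff (isComplicial_frob_structB hE) (conf_inc_structB hE x)

end Generation

section

variable {𝓑 : BicomplicialCategory E} {w : MorphismProperty E}
  (hw : 𝓑.IsComplicialWeakEquivalences w) {N : ObjectProperty (Chb E)}
  (hN : (structB 𝓑.conflation).frob.IsNullClass N) (hN₁ : acyclic 𝓑.conflation ≤ N)
  (hN₂ : acyclicLw w ≤ N)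

lemma strictlyAcyclic_le_acyclic {conf : ObjectProperty (ShortComplex E)} :
    strictlyAcyclic conf ≤ acyclic conf := fun x hx => ⟨x, hx, ⟨HomotopyEquiv.refl _⟩⟩

include hw hN hN₁ hN₂

/-- Null classes of `𝔹` which contain the acyclic and the degreewise trivial complexes do not
distinguish the cones with respect to `𝔸` and `𝔹`. -/
lemma null_coneB_iff {x y c : Chb E} {f : x ⟶ y} {j : 𝓑.structA.C.obj x ⟶ c} {k : y ⟶ c}
    (sq : IsPushout (𝓑.structA.inc x) f j k) : N (coneB f) ↔ N c := by
  have hA := 𝓑.isComplicial_structA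
  have hB := isComplicial_frob_structB 𝓑.exact
  -- The intermediate object is the chain mapping cone of `i`. It maps to the degreewise cone `c`
  -- with strictly acyclic cone, and it is an extension of the chain mapping cone of `f` by the cone
  -- of `0 ⟶ C x`, where `C x` is degreewise contractible.
  let i := biprod.lift (𝓑.structA.inc x) f
  have h₁ : N (coneB i) ↔ N c := by
    obtain ⟨φ, hφ⟩ := exists_strictlyAcyclic_coneB 𝓑.exact
      (hA.exact.conf_of_isPushout (hA.inflation_inc x) sq)
    have hφ := hN₁ _ (strictlyAcyclic_le_acyclic _ hφ)
    exact ⟨fun h => null_target 𝓑.exact hN φ h hφ, fun h => null_source 𝓑.exact hN φ h hφ⟩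
  rw [← h₁]
  obtain ⟨c₁, j₁, k₁, sq₁⟩ := hB.exists_cone (0 : (0 : Chb E) ⟶ 𝓑.structA.C.obj x)
  obtain ⟨s, t, hst⟩ := hB.exists_conf_cone_map (hB.exact.conf_zero_left x)
    (hB.exact.conf_biprod (𝓑.structA.C.obj x) y) (f₁ := 0) (f₂ := i) (f₃ := f) (by simp)
    (by simp [i]) sq₁ (isPushout_coneB (conf := 𝓑.conflation) i)
    (isPushout_coneB (conf := 𝓑.conflation) f)
  have hC : N (𝓑.structA.C.obj x) := hN₂ _ fun n =>
    hw.trivial_of_contractible (𝓑.isComplicial.contractible_C _)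
  have hc₁ : N c₁ := hN.cone hB sq₁ (hN.contractible_le _ (contractible_of_isZero (isZero_zero _))) hC
  exact ⟨fun h => hN.mid hst hc₁ h, fun h => hN.right hst hc₁ h⟩

end

section

variable {conf : ObjectProperty (ShortComplex E)} (hE : IsExactStructure conf)
include hE

/-- Removing the lowest component of a complex. -/
lemma exists_splitting {x : Chb E} {a : ℤ} (hx : ∀ i < a, IsZero (x.obj.X i)) :
    ∃ (u y : Chb E) (f : u ⟶ shiftB 1 y), Nonempty (coneB f ≅ shiftB 1 x) ∧
      (∀ i ≠ a, IsZero (u.obj.X i)) ∧ IsZero (y.obj.X a) ∧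
      ∀ i, IsZero (x.obj.X i) → IsZero (y.obj.X i) := by
  -- The projection to the lowest term is a chain map because no differential ends in degree `a`.
  let π : x.obj ⟶ (HomologicalComplex.single E (ComplexShape.up ℤ) a).obj (x.obj.X a) :=
    HomologicalComplex.mkHomToSingle (𝟙 _) fun i hi => (hx i (by
      have : i + 1 = a := hi
      omega)).eq_of_src _ _
  have hu (i : ℤ) (hi : i ≠ a) : IsZero
      (((HomologicalComplex.single E (ComplexShape.up ℤ) a).obj (x.obj.X a)).X i) :=
    HomologicalComplex.isZero_single_obj_X _ _ _ _ hi
  have hπ : IsIso (π.f a) := by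
    dsimp only [π]
    rw [HomologicalComplex.mkHomToSingle_f]
    infer_instance
  let u : Chb E := ⟨(HomologicalComplex.single E (ComplexShape.up ℤ) a).obj (x.obj.X a),
    a.natAbs, fun i hi => hu i (by grind)⟩
  let π' : x ⟶ u := ObjectProperty.homMk π
  have h (i : ℤ) : ∃ (Z : E) (p : Z ⟶ x.obj.X i), Conf conf p (π.f i) ∧ (i = a → IsZero Z) ∧
      (IsZero (x.obj.X i) → IsZero Z) := by
    by_cases hi : i = a
    · subst hi
      exact ⟨0, 0, hE.conf_of_isIso' _ (isZero_zero _) _, fun _ => isZero_zero _,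
        fun _ => isZero_zero _⟩
    · exact ⟨_, 𝟙 _, hE.conf_of_isIso _ (hu i hi) _, fun h => (hi h).elim, id⟩
  choose Z p hp hZ₁ hZ₂ using h
  obtain ⟨y, g, hg, hy⟩ := exists_level_kernel hE π' Z p hp
  have hg' := conf_level_iff.1 hg
  have hs (i : ℤ) : ∃ s : u.obj.X i ⟶ x.obj.X i, s ≫ π.f i = 𝟙 _ := by
    by_cases hi : i = a
    · subst hi
      exact ⟨inv (π.f i), by simp⟩
    · exact ⟨0, (hu i hi).eq_of_src _ _⟩
  choose s hs using hs
  choose r hr hrs using fun i => hE.exists_retraction (hg' i) (hs i)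
  -- The sequence `y ⟶ x ⟶ u` is degreewise split; the cone of its connecting morphism `u ⟶ y[1]` is
  -- `x[1]`.
  let S : ShortComplex (CochainComplex E ℤ) := ShortComplex.mk g.hom π (congrArg (·.hom) hg.1)
  let σ (n : ℤ) : (S.map (HomologicalComplex.eval E (ComplexShape.up ℤ) n)).Splitting :=
    { r := r n
      s := s n
      f_r := hr n
      s_g := hs n
      id := hrs n }
  refine ⟨u, y, ObjectProperty.homMk (homOfDegreewiseSplit S σ),
    ⟨(bounded E).isoMk (mappingConeHomOfDegreewiseSplitIso S σ)⟩, hu, ?_, fun i hi => ?_⟩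
  · rw [hy]; exact hZ₁ a rfl
  · rw [hy]; exact hZ₂ i hi

end

section

variable {𝓑 : BicomplicialCategory E} {w : MorphismProperty E}
  (hw : 𝓑.IsComplicialWeakEquivalences w) {N : ObjectProperty (Chb E)}
  (hN : (structB 𝓑.conflation).frob.IsNullClass N) (hN₁ : acyclic 𝓑.conflation ≤ N)
  (hN₂ : acyclicLw w ≤ N)
include hw hN hN₁ hN₂

/-- Induction on the length `n` of the support: `x` is exchanged for a degreewise cone with shorter
support, without changing membership in `N` or in the class of `tw`-trivial complexes. -/
lemma acyclicTw_le_of_concentrated (n : ℕ) : ∀ (a : ℤ) (x : Chb E)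
    (_ : ∀ i < a, IsZero (x.obj.X i)) (_ : ∀ i, a + n < i → IsZero (x.obj.X i)),
    𝓑.acyclicTw w x → N x := by
  induction n with
  | zero =>
    intro a x h₁ h₂ hx
    refine hN₂ _ (BicomplicialCategory.acyclicLw_of_acyclicTw_of_single hw (a := a) (fun i hi => ?_) hx)
    rcases lt_or_gt_of_ne hi with h | h
    · exact h₁ i h
    · exact h₂ i (by simpa using h)
  | succ n ih =>
    intro a x h₁ h₂
    obtain ⟨u, y, f, ⟨e⟩, hu, hy, hy'⟩ := exists_splitting 𝓑.exact h₁
    have hA := 𝓑.isComplicial_structA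
    obtain ⟨c, j, k, sq⟩ := hA.exists_cone f
    -- Stated for an arbitrary null class, since it is used both for `N` and for the class of
    -- complexes with trivial total object.
    have key {N : ObjectProperty (Chb E)}
        (hN : (structB 𝓑.conflation).frob.IsNullClass N) (hN₁ : acyclic 𝓑.conflation ≤ N)
        (hN₂ : acyclicLw w ≤ N) : N x ↔ N c := by
      rw [← null_coneB_iff hw hN hN₁ hN₂ sq, null_iff_of_iso 𝓑.exact hN e,
        null_shiftB_iff 𝓑.exact hN]
    rw [key hN hN₁ hN₂, key (BicomplicialCategory.isNullClass_acyclicTw_structB hw)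
      (BicomplicialCategory.acyclic_le_acyclicTw hw)
      (BicomplicialCategory.acyclicLw_le_acyclicTw hw)]
    -- In degree `i` the cone is an extension of the suspension of `u.X i` by `y.X (i + 1)`. As `y`
    -- lives in degrees `a + 1` to `a + n + 1`, the shifted complex fits over degree `a` and the
    -- cone lives in degrees `a` to `a + n`.
    have hc (i : ℤ) (hi : i ≠ a) (hi' : IsZero (y.obj.X (i + 1))) : IsZero (c.obj.X i) := by
      obtain ⟨t, π, q, -, h, h'⟩ := hA.conf_cone sq
      exact 𝓑.exact.isZero_mid (conf_level_iff.1 h' i) hi'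
        (𝓑.exact.isZero_right (conf_level_iff.1 h i) (𝓑.C.map_isZero (hu i hi)))
    refine ih a c (fun i hi => hc i hi.ne ?_) fun i hi => hc i (by omega) ?_
    · rcases eq_or_ne (i + 1) a with h | h
      · rwa [h]
      · exact hy' _ (h₁ _ (by omega))
    · exact hy' _ (h₂ _ (by push_cast; omega))

/-- The null classes of `𝔹` which contain the acyclic and the degreewise trivial complexes contain
the complexes with trivial total object. -/
theorem acyclicTw_le : 𝓑.acyclicTw w ≤ N := fun x hx => by
  obtain ⟨m, hm⟩ := x.property
  exact acyclicTw_le_of_concentrated hw hN hN₁ hN₂ (2 * m) (-m) x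
    (fun i hi => hm i (by grind)) (fun i hi => hm i (by grind)) hx

end

/-! ### Closures -/

lemma le_zigzagClosure {K : Type u} [Category.{v} K] (w : MorphismProperty K)
    (D : ObjectProperty K) : D ≤ zigzagClosure w D := fun x hx => ⟨x, hx, .refl x⟩

lemma zigzagClosure_le {K : Type u} [Category.{v} K] {w : MorphismProperty K}
    {D N : ObjectProperty K} (h : D ≤ N) (hN : ∀ {x y : K} (f : x ⟶ y), w f → (N x ↔ N y)) :
    zigzagClosure w D ≤ N := by
  rintro x ⟨y, hy, hxy⟩
  suffices N x ↔ N y from this.2 (h _ hy)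
  clear hy
  induction hxy with
  | rel x y h => obtain ⟨f, hf⟩ := h; exact hN f hf
  | refl => rfl
  | symm _ _ _ ih => exact ih.symm
  | trans _ _ _ _ _ ih ih' => exact ih.trans ih'

section

variable {conf : ObjectProperty (ShortComplex E)} (hE : IsExactStructure conf)

lemma acyclic_of_iso {x y : Chb E} (e : HomotopyEquiv x.obj y.obj) (hy : acyclic conf y) :
    acyclic conf x := by
  obtain ⟨z, hz, ⟨e'⟩⟩ := hy
  exact ⟨z, hz, ⟨e.trans e'⟩⟩

lemma isZero_obj_X {x : Chb E} (hx : IsZero x) (i : ℤ) : IsZero (x.obj.X i) :=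
  (HomologicalComplex.eval E (ComplexShape.up ℤ) i).map_isZero ((bounded E).ι.map_isZero hx)

lemma homotopyEquivOfContractible {x y : Chb E} (hx : (structB conf).contractible x)
    (hy : (structB conf).contractible y) : Nonempty (HomotopyEquiv x.obj y.obj) := by
  obtain ⟨h⟩ := homotopic_structB_iff.1 hx
  obtain ⟨h'⟩ := homotopic_structB_iff.1 hy
  exact ⟨⟨0, 0, (Homotopy.ofEq (by simp)).trans h.symm, (Homotopy.ofEq (by simp)).trans h'.symm⟩⟩

include hE

lemma strictlyAcyclic_zero : strictlyAcyclic conf (0 : Chb E) :=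
  ⟨fun _ => 0, fun _ => 0, fun _ => 0, fun _ => comp_zero, fun i => by
      have : IsIso (0 : (0 : Chb E).obj.X i ⟶ (0 : E)) :=
        ⟨0, (isZero_obj_X (isZero_zero _) i).eq_of_src _ _, (isZero_zero _).eq_of_src _ _⟩
      exact (hE.conf_of_isIso' (0 : (0 : Chb E).obj.X i ⟶ (0 : E)) (isZero_zero _) 0).2,
    fun i => (isZero_obj_X (isZero_zero _) i).eq_of_src _ _⟩

lemma acyclic_of_contractible {x : Chb E} (hx : (structB conf).contractible x) :
    acyclic conf x :=
  ⟨0, strictlyAcyclic_zero hE,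
    homotopyEquivOfContractible hx (contractible_of_isZero (isZero_zero _))⟩

lemma acyclic_of_isZero {x : Chb E} (hx : IsZero x) : acyclic conf x :=
  acyclic_of_contractible hE (contractible_of_isZero hx)

omit hE in
lemma isZero_of_obj_X {x : Chb E} (hx : ∀ i, IsZero (x.obj.X i)) : IsZero x := by
  rw [IsZero.iff_id_eq_zero]
  ext i
  exact (hx i).eq_of_src _ _

omit hE in
lemma isIso_inr_of_isZero {x y : Chb E} (f : x ⟶ y) (hx : IsZero x) :
    IsIso (ObjectProperty.homMk (mappingCone.inr f.hom) : y ⟶ coneB f) := by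
  have hC : IsZero (coneB (𝟙 x)) := isZero_of_obj_X fun i =>
    (mappingCone.isZero_X_iff _ _).2 ⟨isZero_obj_X hx _, isZero_obj_X hx _⟩
  -- The pushout square does not involve the conflations, so any class will do.
  exact (isPushout_coneB (conf := fun _ => True) f).isIso_inr_of_isIso
    ⟨0, hx.eq_of_src _ _, hC.eq_of_src _ _⟩

omit hE in
lemma qis_zero_iff {x y : Chb E} (f : x ⟶ y) (hx : IsZero x) : qis conf f ↔ acyclic conf y := by
  have := isIso_inr_of_isZero f hx
  let e := HomotopyEquiv.ofIso ((bounded E).ι.mapIso (asIso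
    (ObjectProperty.homMk (mappingCone.inr f.hom) : y ⟶ coneB f)))
  exact ⟨acyclic_of_iso e, acyclic_of_iso e.symm⟩

end

section

variable {𝓑 : BicomplicialCategory E} {w : MorphismProperty E}
  (hw : 𝓑.IsComplicialWeakEquivalences w)
include hw

lemma qis_le_tw : qis 𝓑.conflation ≤ 𝓑.tw w := fun _ _ f hf =>
  ((isComplicial_frob_structB 𝓑.exact).weq_iff_trivial_cone
    (BicomplicialCategory.isComplicialWeakEquivalences_tw_structB hw)
    (isPushout_coneB (conf := 𝓑.conflation) f)).2 (BicomplicialCategory.acyclic_le_acyclicTw hw _ hf)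

lemma zigzagClosure_qis_le : zigzagClosure (qis 𝓑.conflation) (acyclicLw w) ≤ 𝓑.acyclicTw w :=
  zigzagClosure_le (BicomplicialCategory.acyclicLw_le_acyclicTw hw) fun f hf =>
    (BicomplicialCategory.isComplicialWeakEquivalences_tw_structB hw).trivial_iff
      (qis_le_tw hw f hf)

lemma zigzagClosure_lw_le : zigzagClosure (lw w) (acyclic 𝓑.conflation) ≤ 𝓑.acyclicTw w :=
  zigzagClosure_le (BicomplicialCategory.acyclic_le_acyclicTw hw) fun f hf =>
    (BicomplicialCategory.isComplicialWeakEquivalences_tw_structB hw).trivial_iff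
      (BicomplicialCategory.lw_le_tw hw f hf)

lemma acyclicLw_zero : acyclicLw w (0 : Chb E) := fun i =>
  hw.trivial_of_isZero (isZero_obj_X (isZero_zero _) i)

lemma acyclic_le_zigzagClosure_qis :
    acyclic 𝓑.conflation ≤ zigzagClosure (qis 𝓑.conflation) (acyclicLw w) := fun _ hx =>
  ⟨0, acyclicLw_zero hw, .symm _ _ (.rel _ _ ⟨0, (qis_zero_iff _ (isZero_zero _)).2 hx⟩)⟩

lemma acyclicLw_le_zigzagClosure_lw :
    acyclicLw w ≤ zigzagClosure (lw w) (acyclic 𝓑.conflation) := fun _ hx =>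
  ⟨0, acyclic_of_isZero 𝓑.exact (isZero_zero _), .symm _ _ (.rel _ _ ⟨0, fun i =>
    hw.of_trivial (acyclicLw_zero hw i) (hx i) _⟩)⟩

theorem acyclicTw_eq_nullClosure_structB : 𝓑.acyclicTw w =
    (structB 𝓑.conflation).frob.nullClosure
      (zigzagClosure (qis 𝓑.conflation) (acyclicLw w)) := by
  refine le_antisymm (fun x hx M hM h => ?_) fun x hx => hx _
    (BicomplicialCategory.isNullClass_acyclicTw_structB hw) (zigzagClosure_qis_le hw)
  exact acyclicTw_le hw hM ((acyclic_le_zigzagClosure_qis hw).trans h)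
    ((le_zigzagClosure _ _).trans h) x hx

theorem acyclicTw_eq_nullClosure_structA : 𝓑.acyclicTw w =
    𝓑.structA.nullClosure (zigzagClosure (lw w) (acyclic 𝓑.conflation)) := by
  refine le_antisymm (fun x hx M hM h => ?_) fun x hx => hx _
    (BicomplicialCategory.isNullClass_acyclicTw_structA hw) (zigzagClosure_lw_le hw)
  -- Frobenius conflations of `𝔹` are degreewise conflations and contractible complexes of `𝔹` are
  -- acyclic, so a null class of `𝔸` containing the acyclic complexes is null in `𝔹` as well.
  have hM' : (structB 𝓑.conflation).frob.IsNullClass M :=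
    ⟨fun x hx => h _ (le_zigzagClosure _ _ _ (acyclic_of_contractible 𝓑.exact hx)),
      fun S hS => hM.prop_X₃ S hS.1, fun S hS => hM.prop_X₂ S hS.1, fun S hS => hM.prop_X₁ S hS.1⟩
  exact acyclicTw_le hw hM' ((le_zigzagClosure _ _).trans h)
    ((acyclicLw_le_zigzagClosure_lw hw).trans h) x hx

end

end Bicomplicial

end

/-! ### Weak equivalences defined by a null class, and zig-zags as spans. -/

noncomputable section

namespace Bicomplicial

namespace ConeStructure

set_option linter.unusedSectionVars false

variable {K : Type u} [Category.{v} K] [Preadditive K] [HasZeroObject K] [HasBinaryBiproducts K]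
  {𝓚 : ConeStructure K}

/-! ### The weak equivalences defined by a null class -/

section

variable (hK : 𝓚.IsComplicial) {N : ObjectProperty K} (hN : 𝓚.IsNullClass N)
  {W : MorphismProperty K} (hW : ∀ {x y c : K} {f : x ⟶ y} {j : 𝓚.C.obj x ⟶ c} {k : y ⟶ c},
    IsPushout (𝓚.inc x) f j k → (W f ↔ N c))
include hK hN hW

lemma IsNullClass.weq_ext {x₁ x₂ x₃ y₁ y₂ y₃ : K} {i : x₁ ⟶ x₂} {p : x₂ ⟶ x₃} {i' : y₁ ⟶ y₂}
    {p' : y₂ ⟶ y₃} (h : Conf 𝓚.conflation i p) (h' : Conf 𝓚.conflation i' p') {f₁ : x₁ ⟶ y₁}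
    {f₂ : x₂ ⟶ y₂} {f₃ : x₃ ⟶ y₃} (e₁ : i ≫ f₂ = f₁ ≫ i') (e₂ : p ≫ f₃ = f₂ ≫ p') :
    (W f₁ → W f₃ → W f₂) ∧ (W f₁ → W f₂ → W f₃) ∧ (W f₂ → W f₃ → W f₁) := by
  obtain ⟨c₁, j₁, k₁, sq₁⟩ := hK.exists_cone f₁
  obtain ⟨c₂, j₂, k₂, sq₂⟩ := hK.exists_cone f₂
  obtain ⟨c₃, j₃, k₃, sq₃⟩ := hK.exists_cone f₃
  obtain ⟨s, t, hst⟩ := hK.exists_conf_cone_map h h' e₁ e₂ sq₁ sq₂ sq₃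
  rw [hW sq₁, hW sq₂, hW sq₃]
  exact ⟨hN.mid hst, hN.right hst, hN.left hst⟩

lemma IsNullClass.weq_of_isIso {x y : K} (f : x ⟶ y) [IsIso f] : W f := by
  obtain ⟨c, j, k, sq⟩ := hK.exists_cone f
  rw [hW sq]
  have : IsIso j := sq.isIso_inl_of_isIso
  exact hN.of_iso hK.exact (asIso j) (hN.cone_obj hK x)

/-- The matrix `Φ` is an extension of `g` by `f` and also an extension of `f ≫ g` by the identity of
`y`. Two out of three for composites thus reduces to two out of three for conflations. -/
lemma IsNullClass.weq_comp {x y z : K} (f : x ⟶ y) (g : y ⟶ z) :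
    (W f → W g → W (f ≫ g)) ∧ (W f → W (f ≫ g) → W g) ∧ (W g → W (f ≫ g) → W f) := by
  let Φ : x ⊞ y ⟶ y ⊞ z := biprod.desc (f ≫ biprod.inl) (biprod.lift (-𝟙 y) g)
  have h₁ := hN.weq_ext hK hW (hK.exact.conf_biprod x y) (hK.exact.conf_biprod y z)
    (f₁ := f) (f₂ := Φ) (f₃ := g) (by simp [Φ]) (by ext <;> simp [Φ])
  have h₂ := hN.weq_ext hK hW (hK.exact.conf_biprod' x y)
    (hK.exact.conf_of_split (i := biprod.lift (-𝟙 y) g) (p := biprod.desc g (𝟙 z))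
      biprod.inr (-biprod.fst) (by simp) (by simp) (by simp) (by ext <;> simp))
    (f₁ := 𝟙 y) (f₂ := Φ) (f₃ := f ≫ g) (by simp [Φ]) (by ext <;> simp [Φ])
  have h₃ : W Φ ↔ W (f ≫ g) := by
    have := hN.weq_of_isIso hK hW (𝟙 y)
    exact ⟨h₂.2.1 this, h₂.1 this⟩
  rw [← h₃]
  exact ⟨h₁.1, h₁.2.1, fun hg hΦ => h₁.2.2 hΦ hg⟩

lemma IsNullClass.isComplicialWeakEquivalences : 𝓚.IsComplicialWeakEquivalences W := by
  refine hK.isComplicialWeakEquivalences_of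
    { comp_mem := fun f g => (hN.weq_comp hK hW f g).1
      of_postcomp := fun f g => (hN.weq_comp hK hW f g).2.2
      of_precomp := fun f g => (hN.weq_comp hK hW f g).2.1 }
    (fun φ h h' => (hN.weq_ext hK hW (conf_mk h) (conf_mk h') φ.comm₁₂.symm φ.comm₂₃.symm).1)
    (fun x => hN.weq_of_isIso hK hW _) fun x hx => ?_
  obtain ⟨c, j, k, sq⟩ := hK.exists_cone (0 : (0 : K) ⟶ x)
  exact (hW sq).2 (hN.cone hK sq (hN.contractible_le _ (contractible_of_isZero (isZero_zero _)))
    (hN.contractible_le _ hx))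

end

section

variable {W : MorphismProperty K} (hK : 𝓚.IsComplicial) (hW : 𝓚.IsComplicialWeakEquivalences W)
include hK hW

lemma IsComplicial.trivial_of_weq {x y z : K} {i : x ⟶ y} {p : y ⟶ z}
    (h : Conf 𝓚.conflation i p) (hp : W p) : trivialObjects W x := by
  have h₁ : W (0 : x ⟶ (0 : K)) := hK.weq_left hW h (hK.exact.conf_zero_left z) (f₂ := p)
    (f₃ := 𝟙 z) (by simp [h.1]) (by simp) hp (hW.of_isIso _)
  exact (hW.trivial_iff h₁).2 (hW.trivial_of_isZero (isZero_zero K))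

lemma IsComplicial.weq_of_isPullback {y z z' y' : K} {p : y ⟶ z} {f : z' ⟶ z}
    {f' : y' ⟶ y} {p' : y' ⟶ z'} (sq : IsPullback f' p' p f) (hp : IsDeflation 𝓚.conflation p)
    (hp' : W p) : W p' := by
  obtain ⟨x, i, h⟩ := hp.exists_conf
  have w : i ≫ p = (0 : x ⟶ z') ≫ f := by rw [h.1, zero_comp]
  exact hK.weq_of_conf_right hW (hK.exact.conf_pullback h sq (sq.lift_fst i 0 w) (sq.lift_snd _ _ _))
    (hK.trivial_of_weq hW h hp')

/-- Objects which are connected by a span of admissible epimorphisms which are weak equivalences. -/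
def span (𝓚 : ConeStructure K) (W : MorphismProperty K) (x y : K) : Prop :=
  ∃ (t : K) (p : t ⟶ x) (q : t ⟶ y), IsDeflation 𝓚.conflation p ∧ W p ∧
    IsDeflation 𝓚.conflation q ∧ W q

omit hW in
variable {hK} in
lemma span.symm {x y : K} (h : span 𝓚 W x y) : span 𝓚 W y x := by
  obtain ⟨t, p, q, h₁, h₂, h₃, h₄⟩ := h
  exact ⟨t, q, p, h₃, h₄, h₁, h₂⟩

lemma span_refl (x : K) : span 𝓚 W x x :=
  ⟨x, 𝟙 x, 𝟙 x, hK.exact.deflation_id x, hW.of_isIso _, hK.exact.deflation_id x, hW.of_isIso _⟩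

lemma span_trans {x y z : K} (h : span 𝓚 W x y) (h' : span 𝓚 W y z) : span 𝓚 W x z := by
  obtain ⟨t, p, q, h₁, h₂, h₃, h₄⟩ := h
  obtain ⟨t', p', q', h₁', h₂', h₃', h₄'⟩ := h'
  obtain ⟨s, a, b, sq, -⟩ := hK.exact.deflation_pullback q p' h₃
  have ha := hK.exact.isDeflation_of_isPullback sq.flip h₁'
  have hb := hK.exact.isDeflation_of_isPullback sq h₃
  exact ⟨s, a ≫ p, b ≫ q', hK.exact.deflation_comp _ _ ha h₁,
    IsComplicialWeakEquivalences.comp W hW (hK.weq_of_isPullback hW sq.flip h₁' h₂') h₂,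
    hK.exact.deflation_comp _ _ hb h₃',
    IsComplicialWeakEquivalences.comp W hW (hK.weq_of_isPullback hW sq h₃ h₄) h₄'⟩

variable (hT : ∀ y : K, ∃ (y' : K) (q : 𝓚.C.obj y' ⟶ y), Conf 𝓚.conflation (𝓚.inc y') q)
include hT

/-- With a deflation `q` from a contractible object onto `y`, the morphism `(f, q) : x ⊞ C y' ⟶ y`
is a deflation equivalent to `f`, and the projection to `x` is the other leg. -/
lemma span_of_weq {x y : K} {f : x ⟶ y} (hf : W f) : span 𝓚 W x y := by
  obtain ⟨y', q, hq⟩ := hT y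
  have hC := hW.trivial_of_contractible (hK.contractible_C y')
  have hfst : W (biprod.fst : x ⊞ 𝓚.C.obj y' ⟶ x) :=
    hK.weq_of_conf_right hW (hK.exact.conf_biprod' _ _) hC
  have hinl : W (biprod.inl : x ⟶ x ⊞ 𝓚.C.obj y') :=
    hK.weq_of_conf_left hW (hK.exact.conf_biprod _ _) hC
  have hdef : IsDeflation 𝓚.conflation (biprod.desc f q) := by
    have h₁ := hK.exact.isDeflation_desc hq.isDeflation f
    have h₂ : biprod.desc f q = (biprod.braiding _ _).hom ≫ biprod.desc q f := by ext <;> simp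
    rw [h₂]
    exact hK.exact.deflation_comp _ _ (hK.exact.isDeflation_of_isIso _) h₁
  exact ⟨x ⊞ 𝓚.C.obj y', biprod.fst, biprod.desc f q, (hK.exact.conf_biprod' _ _).isDeflation,
    hfst, hdef, hW.of_precomp hinl (by simpa using hf)⟩

lemma span_of_eqvGen {x y : K} (h : Relation.EqvGen (fun a b => ∃ f : a ⟶ b, W f) x y) :
    span 𝓚 W x y := by
  induction h with
  | rel x y h => obtain ⟨f, hf⟩ := h; exact span_of_weq hK hW hT hf
  | refl x => exact span_refl hK hW x
  | symm x y _ ih => exact ih.symm (hK := hK)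
  | trans x y z _ _ h h' => exact span_trans hK hW h h'

end

lemma zigzagClosure_iff_of_weq {W : MorphismProperty K} {D : ObjectProperty K} {x y : K}
    {f : x ⟶ y} (hf : W f) : zigzagClosure W D x ↔ zigzagClosure W D y :=
  ⟨fun ⟨z, hz, h⟩ => ⟨z, hz, .trans _ _ _ (.symm _ _ (.rel _ _ ⟨f, hf⟩)) h⟩,
    fun ⟨z, hz, h⟩ => ⟨z, hz, .trans _ _ _ (.rel _ _ ⟨f, hf⟩) h⟩⟩

end ConeStructure
end Bicomplicial

end

/-! ### Factorizability makes the zig-zag closure a null class. -/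

noncomputable section

namespace Bicomplicial

namespace ConeStructure

set_option linter.unusedSectionVars false

variable {K : Type u} [Category.{v} K] [Preadditive K] [HasZeroObject K] [HasBinaryBiproducts K]
  {𝓚 : ConeStructure K}

/-- A homotopy factorization is a factorization through an object which is enlarged by a
contractible object. -/
lemma exists_factorization (hK : 𝓚.IsComplicial) {P : ObjectProperty K} (hP : 𝓚.IsNullClass P)
    {x y z : K} {f : x ⟶ y} {a : x ⟶ z} {b : z ⟶ y} (hz : P z) (h : 𝓚.Homotopic f (a ≫ b)) :
    ∃ (z' : K) (a' : x ⟶ z') (b' : z' ⟶ y), P z' ∧ a' ≫ b' = f ∧ IsInflation 𝓚.conflation a' := by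
  obtain ⟨H, hH⟩ := h
  refine ⟨𝓚.C.obj x ⊞ z, biprod.lift (𝓚.inc x) a, biprod.desc H b,
    hP.mid (hK.exact.conf_biprod _ _) (hP.cone_obj hK x) hz, ?_,
    hK.exact.isInflation_lift (hK.inflation_inc x) a⟩
  rw [biprod.lift_desc, ← hH, sub_add_cancel]

/-- Any morphism between an object of `P` and an object of `Q` factors up to homotopy through an
object of `P` and `Q`. -/
def HomotopyFactorizable (𝓚 : ConeStructure K) (P Q : ObjectProperty K) : Prop :=
  ∀ {x y : K} (f : x ⟶ y), P x → Q y → ∃ (z : K) (a : x ⟶ z) (b : z ⟶ y),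
    (P z ∧ Q z) ∧ 𝓚.Homotopic f (a ≫ b)

lemma IsNullClass.inf {P Q : ObjectProperty K} (hP : 𝓚.IsNullClass P) (hQ : 𝓚.IsNullClass Q) :
    𝓚.IsNullClass (fun x => P x ∧ Q x) where
  contractible_le x hx := ⟨hP.contractible_le x hx, hQ.contractible_le x hx⟩
  prop_X₃ S h h₁ h₂ := ⟨hP.prop_X₃ S h h₁.1 h₂.1, hQ.prop_X₃ S h h₁.2 h₂.2⟩
  prop_X₂ S h h₁ h₂ := ⟨hP.prop_X₂ S h h₁.1 h₂.1, hQ.prop_X₂ S h h₁.2 h₂.2⟩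
  prop_X₁ S h h₁ h₂ := ⟨hP.prop_X₁ S h h₁.1 h₂.1, hQ.prop_X₁ S h h₁.2 h₂.2⟩

variable (hK : 𝓚.IsComplicial) {W : MorphismProperty K} (hW : 𝓚.IsComplicialWeakEquivalences W)
  {N : ObjectProperty K} (hN : 𝓚.IsNullClass N)

include hK hW

lemma zigzagClosure_cone_iff {x₁ x₂ y₁ y₂ c₁ c₂ : K}
    {a : x₁ ⟶ x₂} {b : y₁ ⟶ y₂} {f₁ : x₁ ⟶ y₁} {f₂ : x₂ ⟶ y₂} (e : a ≫ f₂ = f₁ ≫ b)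
    {j₁ : 𝓚.C.obj x₁ ⟶ c₁} {k₁ : y₁ ⟶ c₁} (sq₁ : IsPushout (𝓚.inc x₁) f₁ j₁ k₁)
    {j₂ : 𝓚.C.obj x₂ ⟶ c₂} {k₂ : y₂ ⟶ c₂} (sq₂ : IsPushout (𝓚.inc x₂) f₂ j₂ k₂)
    (ha : W a) (hb : W b) : zigzagClosure W N c₁ ↔ zigzagClosure W N c₂ := by
  obtain ⟨s, hj, hk⟩ := IsComplicial.exists_cone_map e sq₁ sq₂
  exact zigzagClosure_iff_of_weq (hK.weq_cone_map hW e sq₁ sq₂ hj hk ha hb)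

include hN

/-- The obstruction to moving `f` from `t` to an object of `N` is its restriction to the trivial
kernel `m` of `q`. That restriction factors through some `l` which is trivial and in `N`. Pushing
out along `m ⟶ l` replaces `t` by an equivalent extension `P` of `n₁` by `l`, which is in `N`, and
`f` factors through `P`. -/
lemma zigzagClosure_cone_of_left (hf : HomotopyFactorizable 𝓚 (trivialObjects W) N)
    {t n₁ n₂ c : K} {q : t ⟶ n₁} (hq : IsDeflation 𝓚.conflation q) (hqW : W q) (hn₁ : N n₁)
    (hn₂ : N n₂) {f : t ⟶ n₂} {j : 𝓚.C.obj t ⟶ c} {k : n₂ ⟶ c}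
    (sq : IsPushout (𝓚.inc t) f j k) : zigzagClosure W N c := by
  obtain ⟨m, i, h⟩ := hq.exists_conf
  have hm := hK.trivial_of_weq hW h hqW
  obtain ⟨l, a, b, hl, hab⟩ := hf (i ≫ f) hm hn₂
  obtain ⟨l, a, b, ⟨hl₁, hl₂⟩, hab, ha⟩ := exists_factorization hK
    ((hK.isNullClass_trivialObjects hW).inf hN) hl hab
  obtain ⟨P, a', i', sq', h'⟩ := hK.exact.inflation_pushout i a h.isInflation
  have hP : Conf 𝓚.conflation i' (sq'.desc q 0 (by rw [h.1, comp_zero])) :=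
    hK.exact.conf_pushout h sq' (sq'.inl_desc _ _ _) (sq'.inr_desc _ _ _)
  have hPN : N P := hN.mid hP hl₂ hn₁
  have ha' : W a' := hW.ext h hP sq'.w (f₁ := a) (f₃ := 𝟙 _) (by simp)
    (hW.of_trivial hm hl₁ _) (hW.of_isIso _)
  obtain ⟨c', j', k', sq₂⟩ := hK.exists_cone (sq'.desc f b hab.symm)
  exact (zigzagClosure_cone_iff hK hW (a := a') (b := 𝟙 _) (by simp) sq sq₂ ha' (hW.of_isIso _)).2
    (le_zigzagClosure _ _ _ (hN.cone hK sq₂ hPN hn₂))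

/-- Here the target is changed instead. Pushing out along `q` gives `n₁ ⟶ t'` with the same cone up
to equivalence and a weak equivalence `n₂ ⟶ t'`, whose cone `m` is trivial. The morphism `n₁ ⟶ m`
factors through some `l` which is trivial and in `N`, so `n₁ ⟶ t'` lifts, up to a contractible
summand, to an extension `P` of `l` by `n₂`, which is in `N` and equivalent to `t'`. -/
lemma zigzagClosure_cone_of_right
    (hf : HomotopyFactorizable 𝓚 N (trivialObjects W))
    {t n₁ n₂ c : K} {q : t ⟶ n₁} (hqW : W q) (hn₁ : N n₁)
    (hn₂ : N n₂) {f : t ⟶ n₂} {j : 𝓚.C.obj t ⟶ c} {k : n₂ ⟶ c}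
    (sq : IsPushout (𝓚.inc t) f j k) : zigzagClosure W N c := by
  have hC (x : K) := hW.trivial_of_contractible (hK.contractible_C x)
  let i := biprod.lift (𝓚.inc t) f
  have hi := hK.exact.isInflation_lift (hK.inflation_inc t) f
  obtain ⟨t', b, i', sq', hi'⟩ := hK.exact.inflation_pushout i q hi
  obtain ⟨d, r, h⟩ := hi.exists_conf
  have hP : Conf 𝓚.conflation i' (sq'.desc r 0 (by rw [h.1, comp_zero])) :=
    hK.exact.conf_pushout h sq' (sq'.inl_desc _ _ _) (sq'.inr_desc _ _ _)
  have hb : W b := hW.ext h hP (f₁ := q) (f₃ := 𝟙 _) sq'.w (by simp) hqW (hW.of_isIso _)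
  have hsnd : W (biprod.snd : 𝓚.C.obj t ⊞ n₂ ⟶ n₂) :=
    hK.weq_of_conf_right hW (hK.exact.conf_biprod _ _) (hC t)
  have hinr : W (biprod.inr : n₂ ⟶ 𝓚.C.obj t ⊞ n₂) :=
    hW.of_postcomp hsnd (by simpa using hW.of_isIso _)
  obtain ⟨c₁, j₁, k₁, sq₁⟩ := hK.exists_cone i
  rw [← zigzagClosure_cone_iff hK hW (a := 𝟙 t) (b := biprod.snd) (by simp [i]) sq₁ sq
    (hW.of_isIso _) hsnd]
  obtain ⟨c₂, j₂, k₂, sq₂⟩ := hK.exists_cone i'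
  rw [zigzagClosure_cone_iff hK hW sq'.w.symm sq₁ sq₂ hqW hb]
  obtain ⟨m, hm⟩ := (hK.exact.isInflation_lift (hK.inflation_inc n₂) (biprod.inr ≫ b)).exists_conf
  obtain ⟨π, hm⟩ := hm
  have hmW : trivialObjects W m := by
    have h₁ : W (biprod.lift (𝓚.inc n₂) (biprod.inr ≫ b)) := by
      have h₂ : W (biprod.snd : 𝓚.C.obj n₂ ⊞ t' ⟶ t') :=
        hK.weq_of_conf_right hW (hK.exact.conf_biprod _ _) (hC n₂)
      exact hW.of_postcomp h₂ (by
        simpa using IsComplicialWeakEquivalences.comp W hW hinr hb)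
    have h₃ : W (0 : (0 : K) ⟶ m) := hK.weq_right hW (hK.exact.conf_zero_right n₂) hm
      (f₁ := 𝟙 _) (f₃ := 0) (by simp) (by simp [hm.1]) (hW.of_isIso _) h₁
    exact h₃
  obtain ⟨l, u, v, hl, huv⟩ := hf (i' ≫ biprod.inr ≫ π) hn₁ hmW
  obtain ⟨l, u, v, ⟨hl₁, hl₂⟩, huv, hu⟩ := exists_factorization hK
    (hN.inf (hK.isNullClass_trivialObjects hW)) hl huv
  obtain ⟨P, g, s, e, sqP, he, hPc⟩ := hK.exact.exists_pullback hm v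
  have hPN : N P := hN.mid hPc hn₂ hl₁
  have hg : W g := hW.ext hPc hm (f₁ := 𝟙 _) (f₃ := v) (by simpa using he) sqP.w.symm
    (hW.of_isIso _) (hW.of_trivial hl₂ hmW _)
  have hsnd' : W (biprod.snd : 𝓚.C.obj n₂ ⊞ t' ⟶ t') :=
    hK.weq_of_conf_right hW (hK.exact.conf_biprod _ _) (hC n₂)
  let θ : n₁ ⟶ P := sqP.lift (i' ≫ biprod.inr) u (by rw [Category.assoc, huv])
  obtain ⟨c₃, j₃, k₃, sq₃⟩ := hK.exists_cone θ
  rw [← zigzagClosure_cone_iff hK hW (a := 𝟙 n₁) (b := g ≫ biprod.snd) (f₁ := θ) (by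
    simp only [θ, Category.id_comp]
    rw [← Category.assoc, sqP.lift_fst]
    simp) sq₃ sq₂ (hW.of_isIso _)
    (IsComplicialWeakEquivalences.comp W hW hg hsnd')]
  exact le_zigzagClosure _ _ _ (hN.cone hK sq₃ hn₁ hPN)

variable (hT : ∀ y : K, ∃ (y' : K) (q : 𝓚.C.obj y' ⟶ y), Conf 𝓚.conflation (𝓚.inc y') q)
  (hf : HomotopyFactorizable 𝓚 N (trivialObjects W) ∨ HomotopyFactorizable 𝓚 (trivialObjects W) N)

include hT

/-- The span between `u` and an object `n` of `N` is desuspended: over its apex `t` there are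
extensions `a` by `x` and `b` by `n'`, with `a`, `b` trivial. Their fibre product over `t` is an
extension of `b` by `x` and of `a` by `n'`, so it is equivalent to both `x` and `n'`. -/
lemma zigzagClosure_of_suspension {x u : K} {π : 𝓚.C.obj x ⟶ u}
    (h : Conf 𝓚.conflation (𝓚.inc x) π) (hu : zigzagClosure W N u) : zigzagClosure W N x := by
  obtain ⟨n, hn, hun⟩ := hu
  obtain ⟨t, p, q, hp, hpW, hq, hqW⟩ := span_of_eqvGen hK hW hT hun
  obtain ⟨n', π', h'⟩ := hT n
  have hn' := (hN.suspension_iff hK h').1 hn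
  obtain ⟨a, f₁, g₁, i₁, sq₁, -, h₁⟩ := hK.exact.exists_pullback h p
  obtain ⟨b, f₂, g₂, i₂, sq₂, -, h₂⟩ := hK.exact.exists_pullback h' q
  have hC (x : K) := hW.trivial_of_contractible (hK.contractible_C x)
  have ha : trivialObjects W a := (hW.trivial_iff (hK.weq_of_isPullback hW sq₁.flip hp hpW)).2 (hC x)
  have hb : trivialObjects W b :=
    (hW.trivial_iff (hK.weq_of_isPullback hW sq₂.flip hq hqW)).2 (hC n')
  obtain ⟨P, f₃, g₃, i₃, sq₃, -, h₃⟩ := hK.exact.exists_pullback h₁ g₂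
  have w : i₂ ≫ g₂ = (0 : n' ⟶ a) ≫ g₁ := by rw [h₂.1, zero_comp]
  have h₄ := hK.exact.conf_pullback h₂ sq₃.flip (sq₃.flip.lift_fst i₂ 0 w) (sq₃.flip.lift_snd _ _ _)
  rw [zigzagClosure_iff_of_weq (hK.weq_of_conf_left hW h₃ hb),
    ← zigzagClosure_iff_of_weq (hK.weq_of_conf_left hW h₄ ha)]
  exact le_zigzagClosure _ _ _ hn'

include hf

lemma zigzagClosure_cone {x y c : K} {f : x ⟶ y} {j : 𝓚.C.obj x ⟶ c} {k : y ⟶ c}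
    (sq : IsPushout (𝓚.inc x) f j k) (hx : zigzagClosure W N x) (hy : zigzagClosure W N y) :
    zigzagClosure W N c := by
  obtain ⟨n₁, hn₁, hx⟩ := hx
  obtain ⟨n₂, hn₂, hy⟩ := hy
  obtain ⟨t, p, q, hp, hpW, hq, hqW⟩ := span_of_eqvGen hK hW hT hx
  obtain ⟨s, p', q', hp', hpW', hq', hqW'⟩ := span_of_eqvGen hK hW hT hy
  obtain ⟨r, a, b, sq', hb⟩ := hK.exact.deflation_pullback p' (p ≫ f) hp'
  -- Up to equivalence `f` becomes `a : r ⟶ s`, and then a morphism from `r` to `n₂`, where `r` has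
  -- a deflation in `W` to `n₁`: exactly the situation of the two preceding cone lemmas.
  have hbW := hK.weq_of_isPullback hW sq' hp' hpW'
  obtain ⟨c₁, j₁, k₁, sq₁⟩ := hK.exists_cone a
  obtain ⟨c₂, j₂, k₂, sq₂⟩ := hK.exists_cone (a ≫ q')
  rw [← zigzagClosure_cone_iff hK hW (a := b ≫ p) (b := p') (by rw [sq'.w, Category.assoc]) sq₁ sq
    (IsComplicialWeakEquivalences.comp W hW hbW hpW) hpW',
    zigzagClosure_cone_iff hK hW (a := 𝟙 r) (b := q') (by simp) sq₁ sq₂ (hW.of_isIso _) hqW']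
  have hbq := IsComplicialWeakEquivalences.comp W hW hbW hqW
  rcases hf with hf | hf
  · exact zigzagClosure_cone_of_right hK hW hN hf hbq hn₁ hn₂ sq₂
  · exact zigzagClosure_cone_of_left hK hW hN hf (hK.exact.deflation_comp _ _ hb hq) hbq hn₁ hn₂ sq₂

/-- If `N` and the trivial objects are factorizable in one of the two orders, then the closure of
`N` under weak equivalences is a null class. -/
theorem isNullClass_zigzagClosure : 𝓚.IsNullClass (zigzagClosure W N) := by
  have h0 : zigzagClosure W N (0 : K) := le_zigzagClosure _ _ _
    (hN.contractible_le _ (contractible_of_isZero (isZero_zero _)))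
  have left {x y z : K} {i : x ⟶ y} {p : y ⟶ z} (h : Conf 𝓚.conflation i p)
      (hy : zigzagClosure W N y) (hz : zigzagClosure W N z) : zigzagClosure W N x := by
    obtain ⟨c₁, j₁, k₁, sq₁⟩ := hK.exists_cone (0 : x ⟶ (0 : K))
    obtain ⟨c₂, j₂, k₂, sq₂⟩ := hK.exists_cone p
    obtain ⟨c₃, j₃, k₃, sq₃⟩ := hK.exists_cone (𝟙 z)
    -- The cones of `x ⟶ 0`, of `p` and of `𝟙 z` form a conflation whose last term is trivial. So
    -- the suspension of `x` is equivalent to the cone of `p`.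
    obtain ⟨s, t, hst⟩ := hK.exists_conf_cone_map h (hK.exact.conf_zero_left z) (by simp [h.1])
      (by simp) sq₁ sq₂ sq₃
    have hs := hK.weq_of_conf_left hW hst ((hK.weq_iff_trivial_cone hW sq₃).1 (hW.of_isIso _))
    obtain ⟨T, π, r, -, h₁, h₂⟩ := hK.conf_cone sq₁
    have hr := hK.weq_of_conf_right hW h₂ (hW.trivial_of_isZero (isZero_zero K))
    refine zigzagClosure_of_suspension hK hW hN hT h₁ ?_
    rw [← zigzagClosure_iff_of_weq hr, zigzagClosure_iff_of_weq hs]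
    exact zigzagClosure_cone hK hW hN hT hf sq₂ hy hz
  have right {x y z c : K} {i : x ⟶ y} {p : y ⟶ z} (h : Conf 𝓚.conflation i p)
      {j : 𝓚.C.obj x ⟶ c} {k : y ⟶ c} (sq : IsPushout (𝓚.inc x) i j k) :
      zigzagClosure W N c ↔ zigzagClosure W N z := by
    obtain ⟨q, -, hq⟩ := hK.conf_cone_of_conf h sq
    exact zigzagClosure_iff_of_weq (hK.weq_of_conf_right hW hq
      (hW.trivial_of_contractible (hK.contractible_C x)))
  refine .of_conf (fun x hx => le_zigzagClosure _ _ _ (hN.contractible_le x hx)) left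
    (fun {x y z i p} h hx hz => ?_) fun {x y z i p} h hx hy => ?_
  · obtain ⟨c, j, k, sq⟩ := hK.exists_cone i
    obtain ⟨t, π, q, -, h₁, h₂⟩ := hK.conf_cone sq
    -- `y` is the kernel of a deflation from the cone of `i`, which is equivalent to `z`, to the
    -- suspension of `x`. The latter is handled by comparison with the cone of `x ⟶ 0`.
    refine left h₂ ((right h sq).2 hz) ?_
    obtain ⟨c', j', k', sq'⟩ := hK.exists_cone (0 : x ⟶ (0 : K))
    obtain ⟨T, π', r, hr, h₁', h₂'⟩ := hK.conf_cone sq'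
    have hc' := zigzagClosure_cone hK hW hN hT hf sq' hx h0
    rw [zigzagClosure_iff_of_weq (hK.weq_of_conf_right hW h₂'
      (hW.trivial_of_isZero (isZero_zero K)))] at hc'
    obtain ⟨φ, hφ⟩ := hK.exact.exists_desc h₁ π' h₁'.1
    have : IsIso φ := by
      obtain ⟨ψ, hψ⟩ := hK.exact.exists_desc h₁' π h₁.1
      have := hK.exact.epi h₁
      have := hK.exact.epi h₁'
      refine ⟨ψ, ?_, ?_⟩
      · rw [← cancel_epi π, ← Category.assoc, hφ, hψ, Category.comp_id]
      · rw [← cancel_epi π', ← Category.assoc, hψ, hφ, Category.comp_id]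
    exact (zigzagClosure_iff_of_weq (hW.of_isIso φ)).2 hc'
  · obtain ⟨c, j, k, sq⟩ := hK.exists_cone i
    exact (right h sq).1 (zigzagClosure_cone hK hW hN hT hf sq hx hy)

end ConeStructure
end Bicomplicial

end

/-! ### Passage to the homotopy category, and the factorizable case. -/

noncomputable section

namespace Bicomplicial

namespace ConeStructure

set_option linter.unusedSectionVars false

variable {K : Type u} [Category.{v} K] [Preadditive K] {𝓚 : ConeStructure K}

/-! ### The homotopy category -/

lemma toPi0_map_eq_iff {x y : K} {f g : x ⟶ y} :
    𝓚.toPi0.map f = 𝓚.toPi0.map g ↔ 𝓚.Homotopic f g :=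
  CategoryTheory.Quotient.functor_map_eq_iff _ _ _

lemma homotopyEquivalences.toPi0_iso {x y : K} {f : x ⟶ y} (hf : 𝓚.homotopyEquivalences f) :
    Nonempty (𝓚.toPi0.obj x ≅ 𝓚.toPi0.obj y) := by
  obtain ⟨g, h₁, h₂⟩ := hf
  exact ⟨𝓚.toPi0.map f, 𝓚.toPi0.map g,
    by rw [← Functor.map_comp, ← CategoryTheory.Functor.map_id, toPi0_map_eq_iff]; exact h₁,
    by rw [← Functor.map_comp, ← CategoryTheory.Functor.map_id, toPi0_map_eq_iff]; exact h₂⟩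

lemma exists_homotopyEquivalence {x y : K} (e : 𝓚.toPi0.obj x ≅ 𝓚.toPi0.obj y) :
    ∃ f : x ⟶ y, 𝓚.homotopyEquivalences f := by
  obtain ⟨f, hf⟩ := 𝓚.toPi0.map_surjective e.hom
  obtain ⟨g, hg⟩ := 𝓚.toPi0.map_surjective e.inv
  exact ⟨f, g, by rw [← toPi0_map_eq_iff]; simp [hf, hg],
    by rw [← toPi0_map_eq_iff]; simp [hf, hg]⟩

lemma homotopyEquivalences_of_contractible {x y : K} (hx : 𝓚.contractible x)
    (hy : 𝓚.contractible y) : 𝓚.homotopyEquivalences (0 : x ⟶ y) := by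
  refine ⟨0, ?_, ?_⟩
  · rw [homotopic_iff_sub]; simpa using Homotopic.neg_zero hx
  · rw [homotopic_iff_sub]; simpa using Homotopic.neg_zero hy

/-- Extending `ι_x` along `i` and composing with the contraction splits `i`; the complement of the
contractible summand is `z`. -/
lemma IsFrobenius.homotopyEquivalences_of_conf (hK : 𝓚.IsFrobenius) {x y z : K} {i : x ⟶ y}
    {p : y ⟶ z} (h : Conf 𝓚.conflation i p) (hx : 𝓚.contractible x) :
    𝓚.homotopyEquivalences p := by
  obtain ⟨H, hH⟩ := homotopic_zero_iff.1 hx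
  obtain ⟨g, hg⟩ := hK.exists_extension h x (𝓚.inc x)
  have hr : i ≫ g ≫ H = 𝟙 x := by rw [← Category.assoc, hg, ← hH]
  obtain ⟨s, hs⟩ := hK.exact.exists_desc h (𝟙 y - (g ≫ H) ≫ i) (by
    rw [Preadditive.comp_sub, ← Category.assoc, hr]; simp)
  have := hK.exact.epi h
  have hsp : s ≫ p = 𝟙 z := by
    rw [← cancel_epi p, ← Category.assoc, hs, Preadditive.sub_comp, Category.assoc, h.1]
    simp
  refine ⟨s, ?_, ⟨0, by simp [hsp]⟩⟩
  rw [homotopic_iff_sub, hs]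
  simpa using Homotopic.neg_zero (homotopic_of_contractible hx (g ≫ H) i)

section

variable [HasZeroObject K] [HasBinaryBiproducts K] (hK : 𝓚.IsComplicial)
include hK

lemma IsTriangulatedSubcategory.isNullClass {D : ObjectProperty 𝓚.Pi0}
    (hD : 𝓚.IsTriangulatedSubcategory D) :
    𝓚.frob.IsNullClass (D.inverseImage 𝓚.toPi0) := by
  have hF := hK.isFrobenius_frob
  have hD' := hD.isClosedUnderIsomorphisms
  have he {x y : K} {f : x ⟶ y} (hf : 𝓚.homotopyEquivalences f) :
      D (𝓚.toPi0.obj x) ↔ D (𝓚.toPi0.obj y) := by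
    obtain ⟨e⟩ := hf.toPi0_iso
    exact D.prop_iff_of_iso e
  -- For Frobenius conflations the cone of `i` is homotopy equivalent to `z`, so two out of three
  -- for triangles becomes two out of three for conflations.
  have hc {x y z c : K} {i : x ⟶ y} {p : y ⟶ z} (h : Conf 𝓚.frob.conflation i p)
      {j : 𝓚.C.obj x ⟶ c} {k : y ⟶ c} (sq : IsPushout (𝓚.inc x) i j k) :
      D (𝓚.toPi0.obj c) ↔ D (𝓚.toPi0.obj z) := by
    obtain ⟨q, -, hq⟩ := hF.conf_cone_of_conf h sq
    exact he (hF.homotopyEquivalences_of_conf hq (hF.contractible_C x))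
  refine .of_conf (fun x hx => ?_) (fun {x y z i p} h h₁ h₂ => ?_) (fun {x y z i p} h h₁ h₂ => ?_)
    fun {x y z i p} h h₁ h₂ => ?_
  · exact (he (homotopyEquivalences_of_contractible hx
      (contractible_of_isZero (isZero_zero K)))).2 (hD.zero _ (isZero_zero K))
  all_goals obtain ⟨c, j, k, sq⟩ := hK.exists_cone i
  · exact hD.prop_source i j k sq h₁ ((hc h sq).2 h₂)
  · exact hD.prop_target i j k sq h₁ ((hc h sq).2 h₂)
  · exact (hc h sq).1 (hD.prop_cone i j k sq h₁ h₂)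

omit hK in
lemma IsFactorizable.homotopyFactorizable {D D' : ObjectProperty 𝓚.Pi0}
    (h : 𝓚.IsFactorizable D D') :
    HomotopyFactorizable 𝓚.frob (D.inverseImage 𝓚.toPi0) (D'.inverseImage 𝓚.toPi0) := by
  intro x y f hx hy
  obtain ⟨⟨z⟩, a, b, hz, hz', hab⟩ := h.factors (𝓚.toPi0.map f) hx hy
  obtain ⟨a, rfl⟩ := 𝓚.toPi0.map_surjective (Y := z) a
  obtain ⟨b, rfl⟩ := 𝓚.toPi0.map_surjective (X := z) b
  refine ⟨z, a, b, ⟨hz, hz'⟩, ?_⟩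
  rw [← Functor.map_comp, eq_comm, toPi0_map_eq_iff] at hab
  exact hab

/-- If the images in the homotopy category of a class of objects and of the trivial objects are
factorizable in one of the two orders, then the closure under weak equivalences of this class is a
null class. -/
theorem isNullClass_zigzagClosure_of_isFactorizable {W : MorphismProperty K}
    (hW : 𝓚.frob.IsComplicialWeakEquivalences W) {P Q : ObjectProperty K}
    (hQ : trivialObjects W = Q)
    (hT : ∀ y : K, ∃ (y' : K) (q : 𝓚.C.obj y' ⟶ y), Conf 𝓚.frob.conflation (𝓚.inc y') q)
    (h : 𝓚.IsFactorizable (P.map 𝓚.toPi0) (Q.map 𝓚.toPi0) ∨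
      𝓚.IsFactorizable (Q.map 𝓚.toPi0) (P.map 𝓚.toPi0)) :
    𝓚.frob.IsNullClass (zigzagClosure W P) := by
  subst hQ
  have hP : 𝓚.IsTriangulatedSubcategory (P.map 𝓚.toPi0) := h.elim (·.left) (·.right)
  -- Trivial objects are invariant under homotopy equivalence, so closing under isomorphisms in the
  -- homotopy category adds none.
  have hQ : (((trivialObjects W).map 𝓚.toPi0).inverseImage 𝓚.toPi0) = trivialObjects W := by
    refine le_antisymm ?_ fun x hx => ObjectProperty.prop_map_obj _ _ hx
    rintro x ⟨y, hy, ⟨e⟩⟩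
    obtain ⟨f, hf⟩ := exists_homotopyEquivalence e
    exact (hW.trivial_iff (hW.homotopyEquivalences_le f hf)).1 hy
  -- Homotopy equivalences are in `W`, so the isomorphism closure of `P` has the same zig-zag
  -- closure as `P`.
  have hZ : zigzagClosure W ((P.map 𝓚.toPi0).inverseImage 𝓚.toPi0) = zigzagClosure W P := by
    refine le_antisymm (zigzagClosure_le ?_ fun f hf => zigzagClosure_iff_of_weq hf)
      (zigzagClosure_le (fun x hx => le_zigzagClosure _ _ _ (ObjectProperty.prop_map_obj _ _ hx))
        fun f hf => zigzagClosure_iff_of_weq hf)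
    rintro x ⟨y, hy, ⟨e⟩⟩
    obtain ⟨f, hf⟩ := exists_homotopyEquivalence e
    exact (zigzagClosure_iff_of_weq (hW.homotopyEquivalences_le f hf)).1 (le_zigzagClosure _ _ _ hy)
  rw [← hZ]
  refine isNullClass_zigzagClosure hK.isFrobenius_frob.toIsComplicial hW
    (hP.isNullClass hK) hT ?_
  rw [← hQ]
  rcases h with h | h
  · exact Or.inl h.homotopyFactorizable
  · exact Or.inr h.homotopyFactorizable

end

end ConeStructure

set_option linter.unusedSectionVars false

section

variable {E : Type u} [Category.{v} E] [Preadditive E] [HasZeroObject E] [HasBinaryBiproducts E]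

section

variable {conf : ObjectProperty (ShortComplex E)} (hE : IsExactStructure conf)
include hE

lemma trivialObjects_qis : trivialObjects (qis conf) = acyclic conf := by
  ext x
  exact qis_zero_iff _ (isZero_zero _)

lemma isComplicialWeakEquivalences_qis (h : (structB conf).frob.IsNullClass (acyclic conf)) :
    (structB conf).frob.IsComplicialWeakEquivalences (qis conf) := by
  refine h.isComplicialWeakEquivalences (isComplicial_frob_structB hE) fun {x y c f j k} sq => ?_
  have e := (isPushout_coneB (conf := conf) f).isoIsPushout _ _ sq
  exact null_iff_of_iso hE h e

/-- Acyclicity is invariant under homotopy equivalence by definition, so the acyclic complexes are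
the full preimage of their image. -/
lemma isNullClass_acyclic_of_isTriangulatedSubcategory
    (h : (structB conf).IsTriangulatedSubcategory ((acyclic conf).map (structB conf).toPi0)) :
    (structB conf).frob.IsNullClass (acyclic conf) := by
  have h₁ := h.isNullClass (isComplicial_structB hE)
  have h₂ : ((acyclic conf).map (structB conf).toPi0).inverseImage (structB conf).toPi0 =
      acyclic conf := by
    refine le_antisymm ?_ fun x hx => ObjectProperty.prop_map_obj _ _ hx
    rintro x ⟨y, hy, ⟨e⟩⟩
    obtain ⟨f, g, hf, hg⟩ := ConeStructure.exists_homotopyEquivalence e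
    obtain ⟨a⟩ := homotopic_structB_iff.1 hf
    obtain ⟨b⟩ := homotopic_structB_iff.1 hg
    exact acyclic_of_iso ⟨g.hom, f.hom, b, a⟩ hy
  rwa [h₂] at h₁

end

variable {𝓑 : BicomplicialCategory E} {w : MorphismProperty E}
  (hw : 𝓑.IsComplicialWeakEquivalences w)
include hw

lemma trivialObjects_lw : trivialObjects (lw w) = acyclicLw w := by
  ext x
  refine forall_congr' fun i => ?_
  let e : (0 : Chb E).obj.X i ≅ 0 := (isZero_obj_X (isZero_zero _) i).iso (isZero_zero E)
  exact BicomplicialCategory.weq_iff_of_iso hw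
    (Arrow.isoMk e (Iso.refl _) ((isZero_obj_X (isZero_zero _) i).eq_of_src _ _))

lemma isComplicialWeakEquivalences_lw :
    𝓑.structA.IsComplicialWeakEquivalences (lw w) where
  saturated :=
    { comp_mem := fun f g hf hg i => hw.saturated.comp_mem _ _ (hf i) (hg i)
      of_postcomp := fun f g hg hfg i => hw.of_postcomp (hg i) (hfg i)
      of_precomp := fun f g hf hfg i => hw.of_precomp (hf i) (hfg i) }
  extensional {S S'} φ h h' h₁ h₃ i := hw.ext (conf_mk (h i)) (conf_mk (h' i))
    (congrArg (fun ψ => ψ.hom.f i) φ.comm₁₂.symm) (congrArg (fun ψ => ψ.hom.f i) φ.comm₂₃.symm)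
    (h₁ i) (h₃ i)
  homotopyEquivalences_le := by
    rintro x y f ⟨g, ⟨H, hH⟩, ⟨H', hH'⟩⟩ i
    exact hw.homotopyEquivalences_le _ ⟨g.hom.f i, ⟨H.hom.f i, congrArg (fun ψ => ψ.hom.f i) hH⟩,
      ⟨H'.hom.f i, congrArg (fun ψ => ψ.hom.f i) hH'⟩⟩

theorem acyclicTw_eq_zigzagClosure_lw
    (h : 𝓑.structA.IsFactorizable ((acyclic 𝓑.conflation).map 𝓑.structA.toPi0)
          ((acyclicLw w).map 𝓑.structA.toPi0) ∨
        𝓑.structA.IsFactorizable ((acyclicLw w).map 𝓑.structA.toPi0)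
          ((acyclic 𝓑.conflation).map 𝓑.structA.toPi0)) :
    𝓑.acyclicTw w = zigzagClosure (lw w) (acyclic 𝓑.conflation) := by
  have hA := 𝓑.isComplicial_structA
  have hF := hA.isFrobenius_frob.toIsComplicial
  have hl := isComplicialWeakEquivalences_lw hw
  have hZ := ConeStructure.isNullClass_zigzagClosure_of_isFactorizable hA
    ⟨hl.saturated, fun φ h h' => hl.extensional φ h.1 h'.1, hl.homotopyEquivalences_le⟩
    (trivialObjects_lw hw) 𝓑.exists_desuspension_structA h
  -- The null class obtained so far concerns Frobenius conflations only. For any conflation of `𝔸`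
  -- the map from the cone of `i` to `z` is in `lw`, which extends two out of three to all of them.
  have hc {x y z c : Chb E} {i : x ⟶ y} {p : y ⟶ z} (h : Conf 𝓑.structA.conflation i p)
      {j : 𝓑.structA.C.obj x ⟶ c} {k : y ⟶ c} (sq : IsPushout (𝓑.structA.inc x) i j k) :
      zigzagClosure (lw w) (acyclic 𝓑.conflation) c ↔
        zigzagClosure (lw w) (acyclic 𝓑.conflation) z := by
    obtain ⟨q, -, hq⟩ := hA.conf_cone_of_conf h sq
    exact ConeStructure.zigzagClosure_iff_of_weq (hA.weq_of_conf_right hl hq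
      (hl.trivial_of_contractible (hA.contractible_C x)))
  have hZ' : 𝓑.structA.IsNullClass (zigzagClosure (lw w) (acyclic 𝓑.conflation)) := by
    refine .of_conf hZ.contractible_le (fun {x y z i p} h h₁ h₂ => ?_)
      (fun {x y z i p} h h₁ h₂ => ?_) fun {x y z i p} h h₁ h₂ => ?_
    all_goals obtain ⟨c, j, k, sq⟩ := hA.exists_cone i
    · exact hZ.source hF sq h₁ ((hc h sq).2 h₂)
    · exact hZ.target hF sq h₁ ((hc h sq).2 h₂)
    · exact (hc h sq).1 (hZ.cone hF sq h₁ h₂)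
  refine le_antisymm ?_ (zigzagClosure_lw_le hw)
  rw [acyclicTw_eq_nullClosure_structA hw]
  exact fun x hx => hx _ hZ' le_rfl

theorem acyclicTw_eq_zigzagClosure_qis
    (h : (structB 𝓑.conflation).IsFactorizable
          ((acyclic 𝓑.conflation).map (structB 𝓑.conflation).toPi0)
          ((acyclicLw w).map (structB 𝓑.conflation).toPi0) ∨
        (structB 𝓑.conflation).IsFactorizable
          ((acyclicLw w).map (structB 𝓑.conflation).toPi0)
          ((acyclic 𝓑.conflation).map (structB 𝓑.conflation).toPi0)) :
    𝓑.acyclicTw w = zigzagClosure (qis 𝓑.conflation) (acyclicLw w) := by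
  have hA := isNullClass_acyclic_of_isTriangulatedSubcategory 𝓑.exact (h.elim (·.left) (·.right))
  -- The roles are exchanged with respect to `𝔸`: here the acyclic complexes are the trivial
  -- objects, whence `h.symm`.
  have hZ := ConeStructure.isNullClass_zigzagClosure_of_isFactorizable (isComplicial_structB 𝓑.exact)
    (isComplicialWeakEquivalences_qis 𝓑.exact hA) (trivialObjects_qis 𝓑.exact)
    (exists_desuspension_structB 𝓑.exact) h.symm
  refine le_antisymm ?_ (zigzagClosure_qis_le hw)
  rw [acyclicTw_eq_nullClosure_structB hw]
  exact fun x hx => hx _ hZ le_rfl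

end

end Bicomplicial

end

/-! ### Null classes of `𝔹` and triangulated subcategories of the homotopy category. -/

noncomputable section

namespace Bicomplicial

set_option linter.unusedSectionVars false

open Pretriangulated

/-! ### Verdier quotients -/

section Triangulated

variable {T : Type u} [Category.{v} T] [HasZeroObject T] [HasShift T ℤ] [Preadditive T]
  [∀ n : ℤ, (shiftFunctor T n).Additive] [Pretriangulated T]

variable (T) in
lemma isTriangulated_isZero : ObjectProperty.IsTriangulated (C := T) IsZero where
  exists_zero := ⟨0, isZero_zero T, isZero_zero T⟩
  isStableUnderShiftBy n := ⟨fun _ hx => (shiftFunctor T n).map_isZero hx⟩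
  ext₂' t ht h₁ h₃ := ObjectProperty.le_isoClosure _ _ (Triangle.isZero₂_of_isZero₁₃ t ht h₁ h₃)

lemma isTriangulated_kernel {S : Type*} [Category S] [HasZeroObject S] [HasShift S ℤ]
    [Preadditive S] [∀ n : ℤ, (shiftFunctor S n).Additive] [Pretriangulated S] (F : S ⥤ T)
    [F.CommShift ℤ] [F.IsTriangulated] : F.kernel.IsTriangulated := by
  have := isTriangulated_isZero T
  infer_instance

lemma le_triClosure (P : ObjectProperty T) : P ≤ triClosure P :=
  fun x hx _ _ _ h => h x hx

lemma isStableUnderShift_of_prop_shift_one_iff {P : ObjectProperty T}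
    [P.IsClosedUnderIsomorphisms] (h : ∀ X : T, P (X⟦(1 : ℤ)⟧) ↔ P X) :
    P.IsStableUnderShift ℤ where
  isStableUnderShiftBy n := ⟨fun X hX => by
    change P (X⟦n⟧)
    induction n with
    | zero => exact P.prop_of_iso ((shiftFunctorZero T ℤ).symm.app X) hX
    | succ n ih =>
      exact P.prop_of_iso ((shiftFunctorAdd' T (n : ℤ) 1 _ rfl).symm.app X) ((h _).2 ih)
    | pred n ih =>
      refine (h _).1 (P.prop_of_iso ((shiftFunctorAdd' T (-(n : ℤ) - 1) 1 (-n) (by ring)).app X) ih)⟩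

lemma exists_distinguished_of_iso {X Y Z Z' : T} {f : X ⟶ Y} {g : Y ⟶ Z} {h : Z ⟶ X⟦(1 : ℤ)⟧}
    (hT : Triangle.mk f g h ∈ distTriang T) (e : Z ≅ Z') :
    ∃ (g' : Y ⟶ Z') (h' : Z' ⟶ X⟦(1 : ℤ)⟧), Triangle.mk f g' h' ∈ distTriang T :=
  ⟨g ≫ e.hom, e.inv ≫ h, isomorphic_distinguished _ hT _
    (Triangle.isoMk _ _ (Iso.refl _) (Iso.refl _) e.symm
      ((Category.comp_id _).trans (Category.id_comp _).symm)
      (((Category.assoc _ _ _).trans (congrArg (g ≫ ·) e.hom_inv_id)).trans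
        ((Category.comp_id _).trans (Category.id_comp _).symm))
      ((congrArg ((e.inv ≫ h) ≫ ·) (CategoryTheory.Functor.map_id _ _)).trans
        (Category.comp_id _)))⟩

variable [IsTriangulated T]

lemma isZero_Q_obj {P : ObjectProperty T} [P.IsTriangulated] {x : T} (hx : P x) :
    IsZero (P.trW.Q.obj x) := by
  have h : P.trW (0 : x ⟶ 0) := ObjectProperty.trW.mk P
    (contractible_distinguished₂ x) (P.le_shift (1 : ℤ) x hx)
  have := Localization.inverts P.trW.Q P.trW _ h
  exact (P.trW.Q.map_isZero (isZero_zero T)).of_iso (asIso (P.trW.Q.map (0 : x ⟶ 0)))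

/-- An object which vanishes in a Verdier quotient is a direct factor of an object of the
subcategory. -/
lemma exists_retract_of_isZero_Q_obj {P : ObjectProperty T} [P.IsTriangulated] {x : T}
    (hx : IsZero (P.trW.Q.obj x)) : ∃ (e : T) (a : x ⟶ e) (b : e ⟶ x), P e ∧ a ≫ b = 𝟙 x := by
  -- The identity of `x` becomes zero after composition with some `s : y ⟶ x` whose cone `e` is in
  -- `P`, so it factors through `e`.
  obtain ⟨y, s, hs, h⟩ := (MorphismProperty.map_eq_iff_precomp P.trW.Q P.trW (𝟙 x) 0).1
    (hx.eq_of_src _ _)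
  obtain ⟨e, a, δ, ht, he⟩ := hs
  obtain ⟨b, hb⟩ := Triangle.yoneda_exact₂ _ ht (𝟙 x) (h.trans comp_zero)
  exact ⟨e, a, b, he, hb.symm⟩

end Triangulated

section

variable {E : Type u} [Category.{v} E] [Preadditive E] [HasZeroObject E] [HasBinaryBiproducts E]

instance : (toHb E).Full := by
  unfold toHb
  infer_instance

lemma exists_toHb_obj_eq (X : Hb E) : ∃ x : Chb E, (toHb E).obj x = X :=
  ⟨⟨X.obj.as, (boundedH_quotient_obj_iff _).1 X.property⟩, rfl⟩

lemma toHb_map_eq_iff (conf : ObjectProperty (ShortComplex E)) {x y : Chb E} {f g : x ⟶ y} :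
    (toHb E).map f = (toHb E).map g ↔ (structB conf).Homotopic f g := by
  rw [homotopic_structB_iff]
  refine ⟨fun h => ⟨HomotopyCategory.homotopyOfEq _ _ (congrArg (fun φ => φ.hom) h)⟩,
    fun ⟨h⟩ => ?_⟩
  ext1
  exact HomotopyCategory.eq_of_homotopy _ _ h

lemma toHb_iso_of_homotopyEquivalences {conf : ObjectProperty (ShortComplex E)} {x y : Chb E}
    {f : x ⟶ y} (hf : (structB conf).homotopyEquivalences f) :
    Nonempty ((toHb E).obj x ≅ (toHb E).obj y) := by
  obtain ⟨g, h₁, h₂⟩ := hf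
  exact ⟨(toHb E).map f, (toHb E).map g,
    by rw [← Functor.map_comp, ← CategoryTheory.Functor.map_id, toHb_map_eq_iff conf]; exact h₁,
    by rw [← Functor.map_comp, ← CategoryTheory.Functor.map_id, toHb_map_eq_iff conf]; exact h₂⟩

lemma exists_homotopyEquivalence_of_toHb_iso (conf : ObjectProperty (ShortComplex E))
    {x y : Chb E} (e : (toHb E).obj x ≅ (toHb E).obj y) :
    ∃ f : x ⟶ y, (structB conf).homotopyEquivalences f := by
  obtain ⟨f, hf⟩ := (toHb E).map_surjective e.hom
  obtain ⟨g, hg⟩ := (toHb E).map_surjective e.inv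
  exact ⟨f, g, by rw [← toHb_map_eq_iff]; simp [hf, hg], by rw [← toHb_map_eq_iff]; simp [hf, hg]⟩

lemma toHb_coneB_iso {x y : Chb E} (f : x ⟶ y) {T : Triangle (Hb E)} (hT : T ∈ distTriang (Hb E))
    (e₁ : T.obj₁ ≅ (toHb E).obj x) (e₂ : T.obj₂ ≅ (toHb E).obj y)
    (comm : T.mor₁ ≫ e₂.hom = e₁.hom ≫ (toHb E).map f) :
    Nonempty (T.obj₃ ≅ (toHb E).obj (coneB f)) := by
  have h := isoTriangleOfIso₁₂ _ _ ((boundedH E).ι.map_distinguished T hT)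
    (HomotopyCategory.mappingCone_triangleh_distinguished f.hom) ((boundedH E).ι.mapIso e₁)
    ((boundedH E).ι.mapIso e₂) ((boundedH E).ι.congr_map comm)
  exact ⟨(boundedH E).fullyFaithfulι.preimageIso (Triangle.π₃.mapIso h)⟩

lemma exists_distinguished_toHb {x y : Chb E} (f : x ⟶ y) :
    ∃ (g : (toHb E).obj y ⟶ (toHb E).obj (coneB f)) (h : (toHb E).obj (coneB f) ⟶ _),
      Triangle.mk ((toHb E).map f) g h ∈ distTriang (Hb E) := by
  obtain ⟨Z, g, h, hT⟩ := distinguished_cocone_triangle ((toHb E).map f)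
  obtain ⟨e⟩ := toHb_coneB_iso f hT (Iso.refl _) (Iso.refl _)
    ((Category.comp_id _).trans (Category.id_comp _).symm)
  exact exists_distinguished_of_iso hT e

variable {conf : ObjectProperty (ShortComplex E)} (hE : IsExactStructure conf)
include hE

lemma isNullClass_inverseImage_toHb {D : ObjectProperty (Hb E)} [D.IsTriangulated]
    [D.IsClosedUnderIsomorphisms] :
    (structB conf).frob.IsNullClass (D.inverseImage (toHb E)) := by
  have hF := (isComplicial_structB hE).isFrobenius_frob
  have he {x y : Chb E} {f : x ⟶ y} (hf : (structB conf).homotopyEquivalences f) :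
      D ((toHb E).obj x) ↔ D ((toHb E).obj y) := by
    obtain ⟨e⟩ := toHb_iso_of_homotopyEquivalences hf
    exact D.prop_iff_of_iso e
  have hc {x y z : Chb E} {i : x ⟶ y} {p : y ⟶ z} (h : Conf (structB conf).frob.conflation i p) :
      D ((toHb E).obj (coneB i)) ↔ D ((toHb E).obj z) := by
    obtain ⟨q, -, hq⟩ := hF.conf_cone_of_conf h (isPushout_coneB (conf := conf) i)
    exact he (hF.homotopyEquivalences_of_conf hq (hF.contractible_C x))
  refine .of_conf (fun x hx => ?_) (fun {x y z i p} h h₁ h₂ => ?_) (fun {x y z i p} h h₁ h₂ => ?_)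
    fun {x y z i p} h h₁ h₂ => ?_
  · refine D.prop_of_isZero ?_
    rw [IsZero.iff_id_eq_zero, ← CategoryTheory.Functor.map_id,
      (toHb_map_eq_iff conf (g := 0)).2 hx]
    rfl
  all_goals obtain ⟨g, δ, hT⟩ := exists_distinguished_toHb i
  · exact D.ext_of_isTriangulatedClosed₁ _ hT h₁ ((hc h).2 h₂)
  · exact D.ext_of_isTriangulatedClosed₂ _ hT h₁ ((hc h).2 h₂)
  · exact (hc h).1 (D.ext_of_isTriangulatedClosed₃ _ hT h₁ h₂)

variable {N : ObjectProperty (Chb E)} (hN : (structB conf).frob.IsNullClass N)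
include hN

/-- A null class is invariant under homotopy equivalence, since their cones belong to it. -/
lemma map_toHb_obj_iff (x : Chb E) : N.map (toHb E) ((toHb E).obj x) ↔ N x := by
  refine ⟨?_, fun hx => ObjectProperty.prop_map_obj _ _ hx⟩
  rintro ⟨y, hy, ⟨e⟩⟩
  obtain ⟨f, hf⟩ := exists_homotopyEquivalence_of_toHb_iso conf e
  have hW := hN.isComplicialWeakEquivalences (isComplicial_frob_structB hE)
    (W := fun _ _ f => N (coneB f)) fun {x y c f j k} sq =>
      null_iff_of_iso hE hN ((isPushout_coneB (conf := conf) f).isoIsPushout _ _ sq)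
  exact null_target hE hN f hy (hW.homotopyEquivalences_le f hf)

lemma exists_cone_of_distinguished {T : Triangle (Hb E)} (hT : T ∈ distTriang (Hb E)) :
    ∃ (x y : Chb E) (f : x ⟶ y), (N.map (toHb E) T.obj₁ ↔ N x) ∧ (N.map (toHb E) T.obj₂ ↔ N y) ∧
      (N.map (toHb E) T.obj₃ ↔ N (coneB f)) := by
  obtain ⟨x, hx⟩ := exists_toHb_obj_eq T.obj₁
  obtain ⟨y, hy⟩ := exists_toHb_obj_eq T.obj₂
  obtain ⟨f, hf⟩ := (toHb E).map_surjective (eqToHom hx ≫ T.mor₁ ≫ eqToHom hy.symm)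
  obtain ⟨e⟩ := toHb_coneB_iso f hT (eqToIso hx.symm) (eqToIso hy.symm) (by simp [hf])
  refine ⟨x, y, f, ?_, ?_, ?_⟩
  · rw [← hx, map_toHb_obj_iff hE hN]
  · rw [← hy, map_toHb_obj_iff hE hN]
  · rw [(N.map (toHb E)).prop_iff_of_iso e, map_toHb_obj_iff hE hN]

lemma isTriangulated_map_toHb : (N.map (toHb E)).IsTriangulated := by
  have h₀ : N.map (toHb E) 0 :=
    have hz := (toHb E).map_isZero (isZero_zero _)
    ObjectProperty.prop_of_iso _ (hz.iso (isZero_zero _)) ((map_toHb_obj_iff hE hN _).2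
      (hN.contractible_le _ (ConeStructure.contractible_of_isZero (isZero_zero _))))
  have : (N.map (toHb E)).IsStableUnderShift ℤ :=
    -- The triangle `X ⟶ 0 ⟶ X[1]` expresses the shift by a cone, so both directions are two out of
    -- three.
    isStableUnderShift_of_prop_shift_one_iff fun X => by
      obtain ⟨x, y, f, h₁, h₂, h₃⟩ := exists_cone_of_distinguished hE hN
        (contractible_distinguished₂ X)
      have hy := h₂.1 h₀
      exact ⟨fun h => h₁.2 (null_source hE hN f hy (h₃.1 h)),
        fun h => h₃.2 (null_coneB hE hN f (h₁.1 h) hy)⟩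
  have : (N.map (toHb E)).IsTriangulatedClosed₂ := .mk' fun T hT h h' => by
    obtain ⟨x, y, f, h₁, h₂, h₃⟩ := exists_cone_of_distinguished hE hN hT
    exact h₂.2 (null_target hE hN f (h₁.1 h) (h₃.1 h'))
  exact { exists_zero := ⟨0, isZero_zero _, h₀⟩ }

end

end Bicomplicial

end

/-! ### Quasi-weak equivalences as a thick closure. -/

noncomputable section

namespace Bicomplicial

set_option linter.unusedSectionVars false

open Pretriangulated ConeStructure

/-! ### Functors on Verdier quotients -/

section Triangulated

variable {T : Type u} [Category.{v} T] [HasZeroObject T] [HasShift T ℤ] [Preadditive T]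
  [∀ n : ℤ, (shiftFunctor T n).Additive] [Pretriangulated T] [IsTriangulated T]
  {S : Type*} [Category S] [HasZeroObject S] [HasShift S ℤ] [Preadditive S]
  [∀ n : ℤ, (shiftFunctor S n).Additive] [Pretriangulated S]

lemma isInvertedBy_of_le_kernel {P : ObjectProperty T} (F : T ⥤ S) [F.CommShift ℤ]
    [F.IsTriangulated] (hP : P ≤ F.kernel) : P.trW.IsInvertedBy F := by
  rintro x y f ⟨e, g, h, hT, he⟩
  exact (Triangle.isZero₃_iff_isIso₁ _ (F.map_distinguished _ hT)).1 (hP e he)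

lemma isTriangulated_lift {P : ObjectProperty T} [P.IsTriangulated] (F : T ⥤ S)
    [F.CommShift ℤ] [F.IsTriangulated] (h : P.trW.IsInvertedBy F) :
    letI := Functor.commShiftOfLocalization P.trW.Q P.trW ℤ F (Localization.lift F h P.trW.Q)
    (Localization.lift F h P.trW.Q).IsTriangulated := by
  let := Functor.commShiftOfLocalization P.trW.Q P.trW ℤ F (Localization.lift F h P.trW.Q)
  have := Localization.essSurj_mapArrow P.trW.Q P.trW
  exact Functor.isTriangulated_of_precomp_iso (Localization.Lifting.iso P.trW.Q P.trW F
    (Localization.lift F h P.trW.Q))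

end Triangulated

section

variable {E : Type u} [Category.{v} E] [Preadditive E] [HasZeroObject E] [HasBinaryBiproducts E]

section

variable (conf : ObjectProperty (ShortComplex E)) (w : MorphismProperty E)

instance (n : ℤ) : (shiftFunctor (DbPair conf w) n).Additive :=
  Triangulated.Localization.instAdditiveLocalizationShiftFunctorInt (imageDb conf w).trW n

instance : Pretriangulated (DbPair conf w) :=
  Triangulated.Localization.instPretriangulatedLocalization (imageDb conf w).trW

instance : (imageDb conf w).trW.Q.IsTriangulated :=
  Triangulated.Localization.isTriangulated_functor (imageDb conf w).trW.Q (imageDb conf w).trW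

/-- The projection from the homotopy category to the derived category of a pair. -/
def quotientDbPair : Hb E ⥤ DbPair conf w := (acyclicH conf).trW.Q ⋙ (imageDb conf w).trW.Q

instance : (quotientDbPair conf w).CommShift ℤ := by
  unfold quotientDbPair
  infer_instance

instance : (quotientDbPair conf w).IsTriangulated := by
  unfold quotientDbPair
  infer_instance

lemma qw_iff {x y : Chb E} (f : x ⟶ y) :
    qw conf w f ↔ IsZero ((quotientDbPair conf w).obj ((toHb E).obj (coneB f))) := by
  obtain ⟨g, h, hT⟩ := exists_distinguished_toHb f
  exact (Triangle.isZero₃_iff_isIso₁ _ ((quotientDbPair conf w).map_distinguished _ hT)).symm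

lemma acyclic_le_kernel : acyclic conf ≤ (quotientDbPair conf w).kernel.inverseImage (toHb E) :=
  fun x hx => (imageDb conf w).trW.Q.map_isZero
    (isZero_Q_obj (P := acyclicH conf) (le_triClosure _ _ ((ObjectProperty.strictMap_iff _ _ _).2 ⟨x, hx, rfl⟩)))

lemma acyclicLw_le_kernel :
    acyclicLw w ≤ (quotientDbPair conf w).kernel.inverseImage (toHb E) :=
  fun x hx => isZero_Q_obj (P := imageDb conf w) (le_triClosure _ _ ((ObjectProperty.strictMap_iff _ _ _).2 ⟨x, hx, rfl⟩))

instance : (qw conf w).IsStableUnderRetracts := by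
  have : qw conf w = (MorphismProperty.isomorphisms _).inverseImage (toDbPair conf w) := rfl
  rw [this]
  infer_instance

/-- The derived category of a pair is the universal target among the Verdier quotients. -/
lemma exists_factorization_quotientDbPair {P : ObjectProperty (Hb E)} [P.IsTriangulated]
    (h₁ : (acyclic conf).strictMap (toHb E) ≤ P) (h₂ : (acyclicLw w).strictMap (toHb E) ≤ P) :
    ∃ V : DbPair conf w ⥤ P.trW.Localization, Nonempty (quotientDbPair conf w ⋙ V ≅ P.trW.Q) := by
  have hk : P ≤ P.trW.Q.kernel := fun x hx => isZero_Q_obj hx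
  have hk' := isTriangulated_kernel P.trW.Q
  -- The quotient functor by `P` is extended twice: its kernel contains the acyclic complexes, and
  -- the kernel of the induced functor on `D_b(E)` contains the image of the degreewise trivial
  -- ones. Kernels of triangulated functors are triangulated, so generators suffice.
  have h₃ : acyclicH conf ≤ P.trW.Q.kernel :=
    fun x hx => hx _ hk' inferInstance (h₁.trans hk)
  have i₁ := isInvertedBy_of_le_kernel P.trW.Q h₃
  let V₁ := Localization.lift P.trW.Q i₁ (acyclicH conf).trW.Q
  have e₁ : (acyclicH conf).trW.Q ⋙ V₁ ≅ P.trW.Q := Localization.fac _ _ _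
  let := Functor.commShiftOfLocalization (acyclicH conf).trW.Q (acyclicH conf).trW ℤ P.trW.Q V₁
  have : V₁.IsTriangulated := isTriangulated_lift P.trW.Q i₁
  have hk₁ := isTriangulated_kernel V₁
  have h₄ : imageDb conf w ≤ V₁.kernel := fun x hx => hx _ hk₁ inferInstance (by
    intro y hy
    obtain ⟨z, hz, rfl⟩ := (ObjectProperty.strictMap_iff _ _ _).1 hy
    exact (isZero_Q_obj (h₂ _ ((ObjectProperty.strictMap_iff _ _ _).2 ⟨z, hz, rfl⟩))).of_iso
      (e₁.app ((toHb E).obj z)))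
  have i₂ : (imageDb conf w).trW.IsInvertedBy V₁ := isInvertedBy_of_le_kernel V₁ h₄
  exact ⟨Localization.lift V₁ i₂ (imageDb conf w).trW.Q,
    ⟨Functor.isoWhiskerLeft (acyclicH conf).trW.Q (Localization.fac _ _ _) ≪≫ e₁⟩⟩

end

/-- An object which is a direct factor up to homotopy is a direct factor, up to a cone. -/
lemma exists_retract_biprod (conf : ObjectProperty (ShortComplex E))
    {x y : Chb E} (a : x ⟶ y) (b : y ⟶ x) (h : (structB conf).Homotopic (𝟙 x) (a ≫ b)) :
    Nonempty (Retract x (y ⊞ (structB conf).C.obj x)) := by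
  obtain ⟨H, hH⟩ := h
  exact ⟨biprod.lift a ((structB conf).inc x), biprod.desc b H, by simp [← hH]⟩

variable {𝓑 : BicomplicialCategory E} {w : MorphismProperty E}
  (hw : 𝓑.IsComplicialWeakEquivalences w)
include hw

lemma isNullClass_kernel : (structB 𝓑.conflation).frob.IsNullClass
    ((quotientDbPair 𝓑.conflation w).kernel.inverseImage (toHb E)) := by
  have := isTriangulated_kernel (quotientDbPair 𝓑.conflation w)
  exact isNullClass_inverseImage_toHb 𝓑.exact

lemma isComplicialWeakEquivalences_qw :
    (structB 𝓑.conflation).frob.IsComplicialWeakEquivalences (qw 𝓑.conflation w) :=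
  (isNullClass_kernel hw).isComplicialWeakEquivalences (isComplicial_frob_structB 𝓑.exact)
    fun {_ _ _ f _ _} sq => (qw_iff _ _ f).trans (null_iff_of_iso 𝓑.exact (isNullClass_kernel hw)
      ((isPushout_coneB (conf := 𝓑.conflation) f).isoIsPushout _ _ sq))

lemma weq_iff_trivial_coneB {W : MorphismProperty (Chb E)}
    (hW : (structB 𝓑.conflation).frob.IsComplicialWeakEquivalences W) {x y : Chb E} (f : x ⟶ y) :
    W f ↔ trivialObjects W (coneB f) :=
  (isComplicial_frob_structB 𝓑.exact).weq_iff_trivial_cone hW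
    (isPushout_coneB (conf := 𝓑.conflation) f)

/-- The complexes vanishing in `D_b(E, w)` form a null class to which `acyclicTw_le` applies; it is
used for the cone of `f`. -/
lemma tw_le_qw : 𝓑.tw w ≤ qw 𝓑.conflation w := fun x y f hf => by
  rw [qw_iff]
  exact acyclicTw_le hw (isNullClass_kernel hw) (acyclic_le_kernel _ _) (acyclicLw_le_kernel _ _)
    _ ((weq_iff_trivial_coneB hw (BicomplicialCategory.isComplicialWeakEquivalences_tw_structB hw)
      f).1 hf)

/-- The complexes which vanish in the derived category of the pair are the direct factors of
complexes with trivial total object. -/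
lemma exists_retract_of_isZero {x : Chb E}
    (hx : IsZero ((quotientDbPair 𝓑.conflation w).obj ((toHb E).obj x))) :
    ∃ y : Chb E, 𝓑.acyclicTw w y ∧ Nonempty (Retract x y) := by
  have hN := BicomplicialCategory.isNullClass_acyclicTw_structB hw
  have hK := isComplicial_frob_structB 𝓑.exact
  have := isTriangulated_map_toHb 𝓑.exact hN
  have h {D : ObjectProperty (Chb E)} (hD : D ≤ 𝓑.acyclicTw w) :
      D.strictMap (toHb E) ≤ (𝓑.acyclicTw w).map (toHb E) := fun _ hy => by
    obtain ⟨z, hz, rfl⟩ := (ObjectProperty.strictMap_iff _ _ _).1 hy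
    exact ObjectProperty.prop_map_obj _ _ (hD z hz)
  -- Vanishing in `D_b(E, w)` entails vanishing in the quotient by the complexes with trivial total
  -- object, where vanishing objects are direct factors up to homotopy. Adding `C x` makes the
  -- retraction strict.
  obtain ⟨V, ⟨e⟩⟩ := exists_factorization_quotientDbPair 𝓑.conflation w
    (h (BicomplicialCategory.acyclic_le_acyclicTw hw))
    (h (BicomplicialCategory.acyclicLw_le_acyclicTw hw))
  obtain ⟨Y, a, b, hY, hab⟩ := exists_retract_of_isZero_Q_obj
    (P := (𝓑.acyclicTw w).map (toHb E)) (x := (toHb E).obj x) ((Functor.map_isZero _ (isZero_zero _)).of_iso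
      ((e.app _).symm ≪≫ V.mapIso (hx.iso (Functor.map_isZero _ (isZero_zero _))) ≪≫ e.app 0))
  obtain ⟨y, rfl⟩ := exists_toHb_obj_eq Y
  obtain ⟨a, rfl⟩ := (toHb E).map_surjective a
  obtain ⟨b, rfl⟩ := (toHb E).map_surjective b
  rw [map_toHb_obj_iff 𝓑.exact hN] at hY
  rw [← Functor.map_comp, ← CategoryTheory.Functor.map_id, eq_comm,
    toHb_map_eq_iff 𝓑.conflation] at hab
  exact ⟨_, hN.mid (hK.exact.conf_biprod y _) hY (hN.cone_obj hK x),
    exists_retract_biprod 𝓑.conflation a b hab⟩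

theorem qw_eq_thickClosure_tw :
    qw 𝓑.conflation w = (structB 𝓑.conflation).frob.thickClosure (𝓑.tw w) := by
  refine le_antisymm (fun _ _ f hf W hW hW' h => ?_) fun _ _ _ hf =>
    hf _ (isComplicialWeakEquivalences_qw hw) inferInstance (tw_le_qw hw)
  rw [weq_iff_trivial_coneB hw hW]
  obtain ⟨z, hz, ⟨r⟩⟩ := exists_retract_of_isZero hw ((qw_iff _ _ f).1 hf)
  -- `0 ⟶ coneB f` is a retract of `0 ⟶ z`, which is in `tw` and hence in `W`.
  exact hW'.of_retract (g := (0 : 0 ⟶ z)) ⟨Arrow.homMk (𝟙 0) r.i, Arrow.homMk (𝟙 0) r.r, by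
    ext <;> simp⟩ (h _ hz)

theorem qw_eq_tw (h : w.IsStableUnderRetracts) : qw 𝓑.conflation w = 𝓑.tw w := by
  refine le_antisymm ?_ (tw_le_qw hw)
  rw [qw_eq_thickClosure_tw hw]
  have : (𝓑.tw w).IsStableUnderRetracts := by
    unfold BicomplicialCategory.tw
    infer_instance
  exact fun _ _ _ hf =>
    hf _ (BicomplicialCategory.isComplicialWeakEquivalences_tw_structB hw) this le_rfl

end

end Bicomplicial

end

theorem mainTheorem6 {E : Type u} [Category.{v} E] [Preadditive E] [HasZeroObject E]
    [HasBinaryBiproducts E] (𝓑 : BicomplicialCategory E) (w : MorphismProperty E)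
    (hw : 𝓑.IsComplicialWeakEquivalences w) :
    (𝓑.acyclicTw w = (structB 𝓑.conflation).frob.nullClosure
        (zigzagClosure (qis 𝓑.conflation) (acyclicLw w)) ∧
      𝓑.acyclicTw w = 𝓑.structA.nullClosure (zigzagClosure (lw w) (acyclic 𝓑.conflation))) ∧
    ((𝓑.structA.IsFactorizable ((acyclic 𝓑.conflation).map 𝓑.structA.toPi0)
          ((acyclicLw w).map 𝓑.structA.toPi0) ∨
        𝓑.structA.IsFactorizable ((acyclicLw w).map 𝓑.structA.toPi0)
          ((acyclic 𝓑.conflation).map 𝓑.structA.toPi0)) →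
      𝓑.acyclicTw w = zigzagClosure (lw w) (acyclic 𝓑.conflation)) ∧
    (((structB 𝓑.conflation).IsFactorizable
          ((acyclic 𝓑.conflation).map (structB 𝓑.conflation).toPi0)
          ((acyclicLw w).map (structB 𝓑.conflation).toPi0) ∨
        (structB 𝓑.conflation).IsFactorizable
          ((acyclicLw w).map (structB 𝓑.conflation).toPi0)
          ((acyclic 𝓑.conflation).map (structB 𝓑.conflation).toPi0)) →
      𝓑.acyclicTw w = zigzagClosure (qis 𝓑.conflation) (acyclicLw w)) ∧
    qw 𝓑.conflation w = (structB 𝓑.conflation).frob.thickClosure (𝓑.tw w) ∧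
    (w.IsStableUnderRetracts → qw 𝓑.conflation w = 𝓑.tw w) := by
  exact ⟨⟨acyclicTw_eq_nullClosure_structB hw, acyclicTw_eq_nullClosure_structA hw⟩,
    acyclicTw_eq_zigzagClosure_lw hw, acyclicTw_eq_zigzagClosure_qis hw,
    qw_eq_thickClosure_tw hw, qw_eq_tw hw⟩
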